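/- **Theorem 3.10 (well-posedness for the Hamilton Hartree system).** Let $d\ge 1$ and let $\Gamma\in C^3(\mathbb R^d;\mathbb R)$ be even with bounded derivatives of orders $1,2,3$. Put $\hat V(x,\xi)=-\nabla\Gamma(x)\cdot\xi$ for $x,\xi\in\mathbb R^d$, and consider the Hamilton Hartree equation on $\mathbb R^d\times\mathbb R^d$, $$ i\,\partial_t\hat\alpha(t,\hat z)=\big(\nabla_x\cdot\nabla_\xi+(\hat V*|\hat\alpha(t)|^2)(\hat z)\big)\,\hat\alpha(t,\hat z),\qquad \hat z=(x,\xi). \tag{HHt}$$ Let $M^1=\mathcal F(W^{1,2}(\mathbb R^d_x\times\mathbb R^d_v;\mathbb C))$ with the norm $\|\hat\alpha\|_{M^1}=\|\mathcal F^{-1}\hat\alpha\|_{W^{1,2}}$, where $(\mathcal F\alpha)(x,\xi)=(2\pi)^{-d/2}\int\alpha(x,v)e^{-iv\cdot\xi}\,dv$ is the ($L^2$-isometric) Fourier transform in the velocity and $\|\alpha\|_{W^{1,2}}^2=\|\alpha\|_{L^2}^2+\|\nabla_x\alpha\|_{L^2}^2+\|\nabla_v\alpha\|_{L^2}^2$.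 A *global solution* with initial datum $\mathring{\hat\alpha}\in M^1$ is a map $\hat\alpha\in C([0,\infty);L^2)\cap L^\infty_{\rm loc}([0,\infty);M^1)$, with the $M^1$ bound holding at every time, such that $\hat\alpha(0)=\mathring{\hat\alpha}$ and, for every $\varphi\in C_c^\infty(\mathbb R^d\times\mathbb R^d;\mathbb C)$ and every $t\ge0$ (with a one-sided derivative at $t=0$), $$ i\,\frac{d}{dt}\int\hat\alpha(t)\,\varphi\,d\hat z=\int\hat\alpha(t)\,\big(\nabla_x\cdot\nabla_\xi\varphi+(\hat V*|\hat\alpha(t)|^2)\,\varphi\big)\,d\hat z . $$ 1. For every $\mathring{\hat\alpha}\in M^1$ there is a unique global solution $\hat\alpha$ of (HHt) with $\hat\alpha(0)=\mathring{\hat\alpha}$. 2. For every $T<\infty$ the solution map $M^1\to L^\infty([0,T];L^2)$, $\mathring{\hat\alpha}\mapsto\hat\alpha|_{[0,T]}$, is locally Lipschitz continuous: every point of $M^1$ has an $M^1$-ball around it and a constant $L$ such that $\sup_{0\le t\le T}\|\hat\alpha(t)-\hat\beta(t)\|_{L^2}\le L\,\|\mathring{\hat\alpha}-\mathring{\hat\beta}\|_{M^1}$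 for all initial data $\mathring{\hat\alpha},\mathring{\hat\beta}$ in that ball. 3. Every such solution lies in $L^\infty([0,\infty);L^2)\cap L^\infty_{\rm loc}([0,\infty);M^1)$. -/

import Mathlib

open MeasureTheory Set Filter Topology
open scoped FourierTransform ContDiff NNReal ENNReal

noncomputable section

namespace HamiltonHartree

/-- Position (or velocity, or conjugate) space `ℝ^d` with its Euclidean structure. -/
abbrev Space (d : ℕ) : Type := EuclideanSpace ℝ (Fin d)

/-- The one particle phase space `ℝ^d × ℝ^d`. Its points are `(x, v)` before, and `(x, ξ)` after, the
velocity Fourier transform. -/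
abbrev Phase (d : ℕ) : Type := Space d × Space d

/-- Complex valued square integrable functions on phase space (Lebesgue measure). -/
abbrev L2 (d : ℕ) : Type := Lp ℂ 2 (volume : Measure (Phase d))

/-- The `i`-th coordinate direction in the first variable `x`. -/
def dirX {d : ℕ} (i : Fin d) : Phase d := (EuclideanSpace.single i 1, 0)

/-- The `i`-th coordinate direction in the second variable (`v` or `ξ`). -/
def dirV {d : ℕ} (i : Fin d) : Phase d := (0, EuclideanSpace.single i 1)

/-- Test functions: smooth with compact support. -/
def IsTest {d : ℕ} (φ : Phase d → ℂ) : Prop := ContDiff ℝ ∞ φ ∧ HasCompactSupport φ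

/-- `g` is the weak (distributional) derivative of `f` in the direction `w`. -/
def HasWeakDeriv {d : ℕ} (f g : L2 d) (w : Phase d) : Prop :=
  ∀ φ : Phase d → ℂ, IsTest φ →
    ∫ z, f z * fderiv ℝ φ z w = - ∫ z, g z * φ z

/-- The norm of `W^{1,2}` of phase space,
`(‖f‖₂² + ∑ᵢ ‖∂_{xᵢ} f‖₂² + ∑ᵢ ‖∂_{vᵢ} f‖₂²)^{1/2}`. The weak derivatives `gx`, `gv` are unique when
they exist, so that the infimum is over at most one element; it is `∞` if they do not exist. -/
def sobolevNorm {d : ℕ} (f : L2 d) : ℝ≥0∞ :=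
  ⨅ (gx : Fin d → L2 d) (gv : Fin d → L2 d)
    (_ : ∀ i, HasWeakDeriv f (gx i) (dirX i)) (_ : ∀ i, HasWeakDeriv f (gv i) (dirV i)),
    ENNReal.ofReal (Real.sqrt (‖f‖ ^ 2 + ∑ i, ‖gx i‖ ^ 2 + ∑ i, ‖gv i‖ ^ 2))

/-- The Sobolev space `W^{1,2}` of phase space. -/
def W12 (d : ℕ) : Set (L2 d) := {f | sobolevNorm f < ⊤}

/-- `a` is the velocity Fourier transform of `f`,
`a (x, ξ) = (2π)^{-d/2} ∫ f (x, v) e^{-i v·ξ} dv`, understood as the `L²` Fourier transform on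
almost every slice `x = const`. Mathlib's transform `𝓕` has the kernel `e^{-2π i v·η}`, hence
`𝓕 (f (x, ·)) (η) = (2π)^{d/2} a (x, 2π η)`. -/
def IsVelocityFourier {d : ℕ} (f a : L2 d) : Prop :=
  ∀ᵐ x : Space d, ∃ h : MemLp (fun v : Space d => f (x, v)) 2 volume,
    ((𝓕 (h.toLp (fun v : Space d => f (x, v))) : Lp ℂ 2 (volume : Measure (Space d))) :
        Space d → ℂ)
      =ᵐ[volume] fun η => (((2 * Real.pi) ^ ((d : ℝ) / 2) : ℝ) : ℂ) * a (x, (2 * Real.pi) • η)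

/-- The space `M¹`: the image of `W^{1,2}` under the velocity Fourier transform. -/
def M1 (d : ℕ) : Set (L2 d) := {a | ∃ f ∈ W12 d, IsVelocityFourier f a}

/-- The norm of `M¹`, transported from `W^{1,2}` by the velocity Fourier transform. (Each `a` is
the transform of exactly one `f`, so that the infimum is over one element; it is `∞` off `M¹`.) -/
def m1Norm {d : ℕ} (a : L2 d) : ℝ≥0∞ := ⨅ (f : L2 d) (_ : IsVelocityFourier f a), sobolevNorm f

/-- Admissible potentials: `Γ` is even, of class `C³`, with bounded derivatives of orders
1, 2 and 3. -/
def IsPotential {d : ℕ} (Γ : Space d → ℝ) : Prop :=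
  (∀ x, Γ (-x) = Γ x) ∧ ContDiff ℝ 3 Γ ∧
    ∃ C : ℝ, ∀ k ∈ Finset.Icc 1 3, ∀ x, ‖iteratedFDeriv ℝ k Γ x‖ ≤ C

/-- The pair interaction `V̂ (x, ξ) = -∇Γ(x) · ξ`. -/
def pairPotential {d : ℕ} (Γ : Space d → ℝ) (z : Phase d) : ℝ := -inner ℝ (gradient Γ z.1) z.2

/-- The mean field potential `(V̂ * |a|²)(z) = ∫ V̂ (z - w) |a w|² dw`. -/
def meanField {d : ℕ} (Γ : Space d → ℝ) (a : L2 d) (z : Phase d) : ℝ :=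
  ∫ w, pairPotential Γ (z - w) * ‖a w‖ ^ 2

/-- The kinetic operator `(∇_x · ∇_ξ φ)(z) = ∑ᵢ ∂_{xᵢ} ∂_{ξᵢ} φ (z)` on smooth functions. -/
def kinetic {d : ℕ} (φ : Phase d → ℂ) (z : Phase d) : ℂ :=
  ∑ i, fderiv ℝ (fun w => fderiv ℝ φ w (dirV i)) z (dirX i)

/-- `a : [0, ∞) → M¹` is a global (weak) solution of the Hamilton Hartree equation
`i ∂ₜ a = (∇_x · ∇_ξ + V̂ * |a|²) a` with initial datum `a₀`: it is continuous in time with values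
in `L²`, locally bounded in time with values in `M¹`, starts at `a₀`, and satisfies the equation for
every `t ≥ 0` after pairing with any test function `φ` (the operator `∇_x · ∇_ξ` is its own
transpose). The values of `a` at negative times are irrelevant. -/
structure IsGlobalSolution {d : ℕ} (Γ : Space d → ℝ) (a₀ : L2 d) (a : ℝ → L2 d) : Prop where
  continuousOn : ContinuousOn a (Ici 0)
  locallyBounded : ∀ T : ℝ, ∃ C : ℝ≥0, ∀ t ∈ Icc 0 T, m1Norm (a t) ≤ C
  initial : a 0 = a₀
  equation : ∀ φ : Phase d → ℂ, IsTest φ → ∀ t : ℝ, 0 ≤ t →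
    HasDerivWithinAt (fun s => ∫ z, a s z * φ z)
      (-Complex.I * ∫ z, a t z * (kinetic φ z + (meanField Γ (a t) z : ℂ) * φ z)) (Ici 0) t

end HamiltonHartree

end

noncomputable section

namespace HamiltonHartree

variable {d : ℕ}

/-! The velocity Fourier transform turns v-derivatives into multiplication by iξ, so M¹ consists of
those a for which a, ∂_{x_i} a and ξ_i a are square integrable. `Reg C a` expresses this through
translation increments and truncated moments, a form that survives weak limits. `Reg.of_m1Norm_lt`
and `Reg.m1Norm_le` compare it with the M¹ norm up to a dimensional factor.

Since ∇Γ is bounded and Lipschitz, the mean field V = V̂ * |a|² is real, grows at most linearly in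
ξ, and has x-increments with the same growth. Reality makes V neutral for the L² energy. The
commutators [ξ_i, ∇_x·∇_ξ] = -∂_{x_i} and [∂_{x_i}, V] = ∂_{x_i}V close on the pair (‖ξa‖, ‖∂_x a‖),
and Gronwall bounds it exponentially in time. The coefficient of |ξ| in ∂_x V involves only ‖a‖₂,
which does not grow; the first moment of a enters only through a source term
(`GradBound.abs_meanField_shift_le`). Hence the bound is global in time, and it is reproduced by the
iteration.

For two solutions, V_a a - V_b b = V_a (a - b) + (V_a - V_b) b. The first term is energy neutral. In
the second, |V_a - V_b| ≤ c ‖a - b‖₂ (1 + |ξ|), and the factor 1 + |ξ| is absorbed by the moment of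
b. This is an L² Lipschitz estimate under a bound in M¹. It yields uniqueness, continuous
dependence, and the contraction property of the map sending b to the solution of the linear equation
with mean field V̂ * |b|².

Energy identities for weak solutions are proved after convolution with a real even kernel, where the
kinetic term becomes a bounded symmetric operator commuting with the mollifier. The linear equation
is solved by replacing derivatives with centered differences and cutting off the potential. The
generators are then bounded and a Dyson series applies; the discrete commutators obey the same
bounds uniformly, and a weak ultrafilter limit gives the solution (`AdmPot.exists_weakSol`). -/

instance instIsAddHaarMeasurePhase : (volume : Measure (Phase d)).IsAddHaarMeasure := by
  rw [Measure.volume_eq_prod]; infer_instance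

/-! ### Translations -/

/-- Translation `(T y a) z = a (z + y)` on `L²`. -/
def transl (y : Phase d) : L2 d →ₗᵢ[ℂ] L2 d :=
  Lp.compMeasurePreservingₗᵢ ℂ (fun z => z + y) (measurePreserving_add_right volume y)

lemma transl_coe (y : Phase d) (a : L2 d) : transl y a =ᵐ[volume] fun z => a (z + y) :=
  Lp.coeFn_compMeasurePreserving a (measurePreserving_add_right volume y)

lemma ae_shift {p : Phase d → Prop} (h : ∀ᵐ z, p z) (y : Phase d) : ∀ᵐ z, p (z + y) :=
  (measurePreserving_add_right volume y).quasiMeasurePreserving.ae h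

lemma transl_transl (y y' : Phase d) (a : L2 d) : transl y (transl y' a) = transl (y + y') a := by
  apply Lp.ext
  filter_upwards [transl_coe y (transl y' a), ae_shift (transl_coe y' a) y,
    transl_coe (y + y') a] with z h1 h2 h3
  rw [h1, h2, h3, add_assoc]

@[simp] lemma transl_zero (a : L2 d) : transl 0 a = a := by
  apply Lp.ext
  filter_upwards [transl_coe 0 a] with z h1
  rw [h1, add_zero]

@[simp] lemma norm_transl (y : Phase d) (a : L2 d) : ‖transl y a‖ = ‖a‖ :=
  (transl y).norm_map a

lemma transl_neg_transl (y : Phase d) (a : L2 d) : transl (-y) (transl y a) = a := by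
  rw [transl_transl]; simp

lemma transl_comm (y y' : Phase d) (a : L2 d) :
    transl y (transl y' a) = transl y' (transl y a) := by
  rw [transl_transl, transl_transl, add_comm]

lemma inner_transl_left (y : Phase d) (a b : L2 d) :
    inner ℂ (transl y a) b = inner ℂ a (transl (-y) b) := by
  rw [← (transl (-y)).inner_map_map, transl_neg_transl]

lemma continuousOn_transl {Z : Type*} [TopologicalSpace Z] {s : Set Z} {y : Z → Phase d}
    {a : Z → L2 d} (hy : ContinuousOn y s) (ha : ContinuousOn a s) :
    ContinuousOn (fun t => transl (y t) (a t)) s := by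
  let g0 : C(Phase d, C(Phase d, Phase d)) :=
    ContinuousMap.curry ⟨fun p : Phase d × Phase d => p.2 + p.1, by fun_prop⟩
  have hg : ContinuousOn (fun t => g0 (y t)) s := g0.continuous.comp_continuousOn hy
  exact ha.compMeasurePreservingLp hg
    (fun t => measurePreserving_add_right volume (y t)) (by simp)

lemma continuous_transl {Z : Type*} [TopologicalSpace Z] {y : Z → Phase d}
    {a : Z → L2 d} (hy : Continuous y) (ha : Continuous a) :
    Continuous (fun t => transl (y t) (a t)) := by
  rw [← continuousOn_univ] at *
  exact continuousOn_transl hy ha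

/-! ### Test functions -/

lemma IsTest.continuous {φ : Phase d → ℂ} (h : IsTest φ) : Continuous φ := h.1.continuous

lemma IsTest.memLp {φ : Phase d → ℂ} (h : IsTest φ) (p : ℝ≥0∞) : MemLp φ p volume :=
  h.continuous.memLp_of_hasCompactSupport h.2

/-- The class in `L²` of a test function. -/
def testLp (φ : Phase d → ℂ) (h : IsTest φ) : L2 d := (h.memLp 2).toLp φ

lemma testLp_coe {φ : Phase d → ℂ} (h : IsTest φ) : testLp φ h =ᵐ[volume] φ :=
  (h.memLp 2).coeFn_toLp

lemma dense_testLp : Dense {f : L2 d | ∃ φ, ∃ h : IsTest φ, f = testLp φ h} := by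
  refine (Lp.dense_hasCompactSupport_contDiff (F := ℂ) (μ := (volume : Measure (Phase d)))
    (p := 2) (by simp)).mono ?_
  rintro f ⟨g, hfg, hg1, hg2⟩
  refine ⟨g, ⟨hg2, hg1⟩, ?_⟩
  apply Lp.ext
  exact hfg.trans (testLp_coe _).symm

lemma IsTest.add {φ ψ : Phase d → ℂ} (h : IsTest φ) (h' : IsTest ψ) :
    IsTest (fun z => φ z + ψ z) := ⟨h.1.add h'.1, h.2.add h'.2⟩

lemma IsTest.conj {φ : Phase d → ℂ} (h : IsTest φ) : IsTest (fun z => starRingEnd ℂ (φ z)) :=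
  ⟨Complex.conjCLE.contDiff.comp h.1, h.2.comp_left (g := starRingEnd ℂ) (map_zero _)⟩

lemma IsTest.sum {ι : Type*} (s : Finset ι) {φ : ι → Phase d → ℂ} (h : ∀ i ∈ s, IsTest (φ i)) :
    IsTest (fun z => ∑ i ∈ s, φ i z) := by
  classical
  induction s using Finset.induction_on with
  | empty => exact ⟨by simpa using contDiff_const, by simp only [Finset.sum_empty]; exact HasCompactSupport.zero⟩
  | insert i s his ih =>
    simp only [Finset.sum_insert his]
    exact (h i (by simp)).add (ih fun j hj => h j (by simp [hj]))

lemma IsTest.shift {φ : Phase d → ℂ} (h : IsTest φ) (y : Phase d) :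
    IsTest (fun z => φ (z + y)) :=
  ⟨h.1.comp (contDiff_id.add contDiff_const), h.2.comp_homeomorph (Homeomorph.addRight y)⟩

lemma IsTest.fderiv {φ : Phase d → ℂ} (h : IsTest φ) (w : Phase d) :
    IsTest (fun z => fderiv ℝ φ z w) :=
  ⟨(h.1.fderiv_right (m := ∞) (by simp)).clm_apply contDiff_const,
    h.2.fderiv_apply ℝ w⟩

lemma IsTest.kinetic {φ : Phase d → ℂ} (h : IsTest φ) : IsTest (kinetic φ) := by
  unfold HamiltonHartree.kinetic
  exact IsTest.sum _ fun i _ => (h.fderiv (dirV i)).fderiv (dirX i)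

lemma fderiv_conj {φ : Phase d → ℂ} (h : IsTest φ) (z w : Phase d) :
    _root_.fderiv ℝ (fun z => starRingEnd ℂ (φ z)) z w
      = starRingEnd ℂ (_root_.fderiv ℝ φ z w) := by
  have h1 : HasFDerivAt φ (_root_.fderiv ℝ φ z) z :=
    (h.1.differentiable (by simp) z).hasFDerivAt
  have h2 := Complex.conjCLE.toContinuousLinearMap.hasFDerivAt.comp z h1
  have h3 : HasFDerivAt (fun z => starRingEnd ℂ (φ z)) _ z := h2
  rw [h3.fderiv]; rfl

lemma kinetic_conj {φ : Phase d → ℂ} (h : IsTest φ) (z : Phase d) :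
    kinetic (fun z => starRingEnd ℂ (φ z)) z = starRingEnd ℂ (kinetic φ z) := by
  unfold kinetic
  rw [map_sum]
  refine Finset.sum_congr rfl fun i _ => ?_
  rw [← fderiv_conj (h.fderiv (dirV i))]
  congr 2
  ext w
  exact fderiv_conj h w _

lemma inner_eq_integral (a b : L2 d) : inner ℂ a b = ∫ z, b z * starRingEnd ℂ (a z) := by
  rw [L2.inner_def]; rfl

lemma inner_testLp {φ : Phase d → ℂ} (h : IsTest φ) (a : L2 d) :
    inner ℂ (testLp φ h) a = ∫ z, a z * starRingEnd ℂ (φ z) := by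
  rw [inner_eq_integral]
  refine integral_congr_ae ?_
  filter_upwards [testLp_coe h] with z hz
  rw [hz]

lemma integral_mul_test {φ : Phase d → ℂ} (h : IsTest φ) (a : L2 d) :
    ∫ z, a z * φ z = inner ℂ (testLp _ h.conj) a := by
  rw [inner_testLp]; simp

lemma transl_testLp {φ : Phase d → ℂ} (h : IsTest φ) (y : Phase d) :
    transl y (testLp φ h) = testLp _ (h.shift y) := by
  apply Lp.ext
  filter_upwards [transl_coe y (testLp φ h), ae_shift (testLp_coe h) y,
    testLp_coe (h.shift y)] with z h1 h2 h3
  rw [h1, h2, h3]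

lemma testLp_congr {φ ψ : Phase d → ℂ} (h : IsTest φ) (h' : IsTest ψ) (e : ∀ z, φ z = ψ z) :
    testLp φ h = testLp ψ h' := by
  obtain rfl : φ = ψ := funext e
  rfl

lemma testLp_add {φ ψ : Phase d → ℂ} (h : IsTest φ) (h' : IsTest ψ) :
    testLp _ (h.add h') = testLp φ h + testLp ψ h' := rfl

lemma testLp_sum {ι : Type*} (s : Finset ι) {φ : ι → Phase d → ℂ} (h : ∀ i, IsTest (φ i)) :
    testLp _ (IsTest.sum s fun i _ => h i) = ∑ i ∈ s, testLp (φ i) (h i) := by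
  classical
  induction s using Finset.induction_on with
  | empty =>
    apply Lp.ext
    filter_upwards [testLp_coe (IsTest.sum ∅ fun i (_ : i ∈ (∅ : Finset ι)) => h i),
      Lp.coeFn_zero ℂ 2 (volume : Measure (Phase d))] with z h1 h2
    rw [h1]; simp
  | insert i s his ih =>
    rw [Finset.sum_insert his, ← ih, ← testLp_add]
    exact testLp_congr _ _ fun z => by simp [Finset.sum_insert his]

lemma testLp_kinetic {φ : Phase d → ℂ} (h : IsTest φ) : testLp _ h.kinetic
    = ∑ i, testLp _ ((h.fderiv (dirV i)).fderiv (dirX i)) := by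
  rw [← testLp_sum Finset.univ (fun i => (h.fderiv (dirV i)).fderiv (dirX i))]
  rfl

/-! ### Density arguments in a Hilbert space -/

section Hilbert

variable {H : Type*} [NormedAddCommGroup H] [InnerProductSpace ℂ H]

/-- The condition is closed in φ, so it extends from the dense set to φ = x. -/
lemma norm_le_of_dense {S : Set H} (hS : Dense S) {x : H} {C : ℝ} (hC : 0 ≤ C)
    (h : ∀ φ ∈ S, ‖inner ℂ φ x‖ ≤ C * ‖φ‖) : ‖x‖ ≤ C := by
  have h1 : ∀ φ : H, ‖inner ℂ φ x‖ ≤ C * ‖φ‖ := by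
    intro φ
    refine hS.induction (P := fun φ => ‖inner ℂ φ x‖ ≤ C * ‖φ‖) h ?_ φ
    exact isClosed_le (by fun_prop) (by fun_prop)
  rcases (norm_nonneg x).eq_or_lt with hx | hx
  · rwa [← hx]
  · have := h1 x
    rw [inner_self_eq_norm_sq_to_K] at this
    simp at this
    nlinarith

lemma eq_of_dense {S : Set H} (hS : Dense S) {x y : H}
    (h : ∀ φ ∈ S, inner ℂ φ x = inner ℂ φ y) : x = y := by
  rw [← sub_eq_zero, ← norm_le_zero_iff]
  refine norm_le_of_dense hS le_rfl fun φ hφ => ?_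
  rw [inner_sub_right, h φ hφ]; simp

/-- A weak primitive of a continuous curve is a strong primitive. -/
lemma hasDerivAt_of_weak [CompleteSpace H] {S : Set H} (hS : Dense S) {u u' : ℝ → H}
    (hu' : Continuous u')
    (h : ∀ φ ∈ S, ∀ t, HasDerivAt (fun s => inner ℂ φ (u s)) (inner ℂ φ (u' t)) t) (t : ℝ) :
    HasDerivAt u (u' t) t := by
  have h1 : ∀ t, HasDerivAt (fun r => ∫ s in (0 : ℝ)..r, u' s) (u' t) t := fun t =>
    intervalIntegral.integral_hasDerivAt_right (hu'.intervalIntegrable _ _)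
      hu'.aestronglyMeasurable.stronglyMeasurableAtFilter hu'.continuousAt
  have h2 : ∀ r, u r = u 0 + ∫ s in (0 : ℝ)..r, u' s := by
    intro r
    refine eq_of_dense hS fun φ hφ => ?_
    have h3 : ∀ t, HasDerivAt
        (fun s => inner ℂ φ (u s) - inner ℂ φ (∫ s in (0 : ℝ)..s, u' s)) 0 t := fun t => by
      have : HasDerivAt
          (fun s => inner ℂ φ (u s) - inner ℂ φ (∫ s in (0 : ℝ)..s, u' s))
          (inner ℂ φ (u' t) - inner ℂ φ (u' t)) t := (h φ hφ t).sub
        (((innerSL ℂ φ).restrictScalars ℝ).hasFDerivAt.comp_hasDerivAt t (h1 t))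
      rwa [sub_self] at this
    have h4 := is_const_of_deriv_eq_zero (fun t => (h3 t).differentiableAt)
      (fun t => (h3 t).deriv) r 0
    simp only [intervalIntegral.integral_same, inner_zero_right, sub_zero] at h4
    rw [inner_add_right, ← h4]; ring
  have h5 : u = fun r => u 0 + ∫ s in (0 : ℝ)..r, u' s := funext h2
  rw [h5]
  exact (h1 t).const_add _

end Hilbert

/-! ### Derivatives of translations -/

lemma hasDerivAt_inner_transl_test {φ ψ : Phase d → ℂ} (h : IsTest φ) (h' : IsTest ψ)
    (w : Phase d) (t : ℝ) :
    HasDerivAt (fun s : ℝ => inner ℂ (testLp ψ h') (transl (s • w) (testLp φ h)))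
      (inner ℂ (testLp ψ h') (transl (t • w) (testLp _ (h.fderiv w)))) t := by
  have e : ∀ (φ : Phase d → ℂ) (h : IsTest φ) (s : ℝ),
      inner ℂ (testLp ψ h') (transl (s • w) (testLp φ h))
        = ∫ z, φ (z + s • w) * starRingEnd ℂ (ψ z) := by
    intro φ h s
    rw [inner_testLp]
    refine integral_congr_ae ?_
    rw [transl_testLp]
    filter_upwards [testLp_coe (h.shift (s • w))] with z hz
    rw [hz]
  simp only [e]
  obtain ⟨C, hC⟩ := (h.fderiv w).continuous.bounded_above_of_compact_support (h.fderiv w).2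
  refine (hasDerivAt_integral_of_dominated_loc_of_deriv_le (μ := volume)
    (F := fun s z => φ (z + s • w) * starRingEnd ℂ (ψ z))
    (F' := fun s z => _root_.fderiv ℝ φ (z + s • w) w * starRingEnd ℂ (ψ z))
    (bound := fun z => C * ‖ψ z‖) (s := univ) univ_mem ?_ ?_ ?_ ?_ ?_ ?_).2
  · exact .of_forall fun s => ((h.shift _).continuous.mul h'.conj.continuous).aestronglyMeasurable
  · exact ((h.shift _).continuous.mul h'.conj.continuous).integrable_of_hasCompactSupport
      h'.conj.2.mul_left
  · exact (((h.fderiv w).shift _).continuous.mul h'.conj.continuous).aestronglyMeasurable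
  · refine .of_forall fun z s _ => ?_
    rw [norm_mul, RCLike.norm_conj]
    exact mul_le_mul_of_nonneg_right (hC _) (norm_nonneg _)
  · exact (h'.continuous.norm.integrable_of_hasCompactSupport h'.2.norm).const_mul C
  · refine .of_forall fun z s _ => ?_
    have h1 : HasFDerivAt φ (_root_.fderiv ℝ φ (z + s • w)) (z + s • w) :=
      (h.1.differentiable (by simp) _).hasFDerivAt
    have h2 : HasDerivAt (fun s : ℝ => z + s • w) w s := by
      simpa using ((hasDerivAt_id s).smul_const w).const_add z
    exact (h1.comp_hasDerivAt s h2).mul_const _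

/-- Only the scalar pairings are differentiated under the integral; the candidate derivative is norm
continuous, which upgrades weak to strong differentiability. -/
lemma hasDerivAt_transl_test {φ : Phase d → ℂ} (h : IsTest φ) (w : Phase d) (t : ℝ) :
    HasDerivAt (fun s : ℝ => transl (s • w) (testLp φ h))
      (transl (t • w) (testLp _ (h.fderiv w))) t := by
  refine hasDerivAt_of_weak dense_testLp
    (u' := fun s => transl (s • w) (testLp _ (h.fderiv w)))
    (continuous_transl (by fun_prop) continuous_const) ?_ t
  rintro _ ⟨ψ, h', rfl⟩ t
  exact hasDerivAt_inner_transl_test h h' w t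

lemma norm_transl_test_sub_le {φ : Phase d → ℂ} (h : IsTest φ) (w : Phase d) (t : ℝ) :
    ‖transl (t • w) (testLp φ h) - testLp φ h‖ ≤ |t| * ‖testLp _ (h.fderiv w)‖ := by
  have := Convex.norm_image_sub_le_of_norm_hasDerivWithin_le (s := univ)
    (C := ‖testLp _ (h.fderiv w)‖) (x := 0) (y := t)
    (fun s _ => (hasDerivAt_transl_test h w s).hasDerivWithinAt) (fun s _ => by simp)
    convex_univ (mem_univ _) (mem_univ _)
  simpa [mul_comm] using this

/-! ### Bounded real multipliers -/

/-- Multiplication by a bounded measurable real function, as an operator on `L²` (and `0` if the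
multiplier is not essentially bounded). -/
def mulOp (m : Phase d → ℝ) : L2 d →L[ℂ] L2 d :=
  open scoped Classical in
  if h : MemLp (fun z => (m z : ℂ)) ∞ volume then
    (ContinuousLinearMap.mul ℂ ℂ).holderL volume ∞ 2 2 (h.toLp _) else 0

/-- Bounded measurable functions. -/
def IsMult (m : Phase d → ℝ) : Prop := Measurable m ∧ ∃ C, ∀ z, |m z| ≤ C

lemma IsMult.memLp {m : Phase d → ℝ} (h : IsMult m) :
    MemLp (fun z => (m z : ℂ)) ∞ (volume : Measure (Phase d)) := by
  obtain ⟨h1, C, hC⟩ := h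
  exact memLp_top_of_bound (Complex.measurable_ofReal.comp h1).aestronglyMeasurable C
    (.of_forall fun z => by simpa using hC z)

lemma mulOp_coe {m : Phase d → ℝ} (h : IsMult m) (a : L2 d) :
    mulOp m a =ᵐ[volume] fun z => (m z : ℂ) * a z := by
  rw [mulOp, dif_pos h.memLp]
  have h1 := ContinuousLinearMap.coeFn_holder (r := 2) (ContinuousLinearMap.mul ℂ ℂ)
    (h.memLp.toLp _) a
  filter_upwards [h1, h.memLp.coeFn_toLp] with z h2 h3
  rw [h3] at h2
  exact h2

lemma norm_mulOp_le {m : Phase d → ℝ} (h : IsMult m) {C : ℝ} (hC : ∀ z, |m z| ≤ C) (a : L2 d) :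
    ‖mulOp m a‖ ≤ C * ‖a‖ := by
  refine Lp.norm_le_mul_norm_of_ae_le_mul ?_
  filter_upwards [mulOp_coe h a] with z hz
  rw [hz, norm_mul, Complex.norm_real]
  exact mul_le_mul_of_nonneg_right (hC z) (norm_nonneg _)

lemma norm_mulOp_le_mulOp {m n : Phase d → ℝ} (hm : IsMult m) (hn : IsMult n)
    (h : ∀ z, |m z| ≤ |n z|) (a : L2 d) : ‖mulOp m a‖ ≤ ‖mulOp n a‖ := by
  refine Lp.norm_le_norm_of_ae_le ?_
  filter_upwards [mulOp_coe hm a, mulOp_coe hn a] with z h1 h2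
  rw [h1, h2, norm_mul, norm_mul, Complex.norm_real, Complex.norm_real]
  exact mul_le_mul_of_nonneg_right (h z) (norm_nonneg _)

lemma inner_mulOp {m : Phase d → ℝ} (h : IsMult m) (a b : L2 d) :
    inner ℂ (mulOp m a) b = inner ℂ a (mulOp m b) := by
  rw [inner_eq_integral, inner_eq_integral]
  refine integral_congr_ae ?_
  filter_upwards [mulOp_coe h a, mulOp_coe h b] with z h1 h2
  rw [h1, h2, map_mul, Complex.conj_ofReal]; ring

lemma mulOp_mulOp_comm {m n : Phase d → ℝ} (hm : IsMult m) (hn : IsMult n) (a : L2 d) :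
    mulOp m (mulOp n a) = mulOp n (mulOp m a) := by
  apply Lp.ext
  filter_upwards [mulOp_coe hm (mulOp n a), mulOp_coe hn (mulOp m a), mulOp_coe hm a,
    mulOp_coe hn a] with z h1 h2 h3 h4
  rw [h1, h2, h3, h4]; ring

lemma IsMult.shift {m : Phase d → ℝ} (h : IsMult m) (y : Phase d) :
    IsMult (fun z => m (z + y)) :=
  ⟨h.1.comp (measurable_add_const y), h.2.imp fun _ hC _ => hC _⟩

lemma IsMult.sub {m n : Phase d → ℝ} (hm : IsMult m) (hn : IsMult n) :
    IsMult (fun z => m z - n z) := by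
  obtain ⟨h1, C, hC⟩ := hm
  obtain ⟨h2, D, hD⟩ := hn
  exact ⟨h1.sub h2, C + D, fun z => (abs_sub _ _).trans (add_le_add (hC z) (hD z))⟩

lemma mulOp_sub {m n : Phase d → ℝ} (hm : IsMult m) (hn : IsMult n) (a : L2 d) :
    mulOp (fun z => m z - n z) a = mulOp m a - mulOp n a := by
  apply Lp.ext
  filter_upwards [mulOp_coe hm a, mulOp_coe hn a, mulOp_coe (hm.sub hn) a,
    Lp.coeFn_sub (mulOp m a) (mulOp n a)] with z h1 h2 h3 h4
  rw [h3, h4, Pi.sub_apply, h1, h2]; push_cast; ring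

lemma transl_mulOp {m : Phase d → ℝ} (hm : IsMult m) (y : Phase d) (a : L2 d) :
    transl y (mulOp m a) = mulOp (fun z => m (z + y)) (transl y a) := by
  apply Lp.ext
  filter_upwards [transl_coe y (mulOp m a), ae_shift (mulOp_coe hm a) y, transl_coe y a,
    mulOp_coe (hm.shift y) (transl y a)] with z h1 h2 h3 h4
  rw [h1, h2, h4, h3]

/-! ### Weak limits along an ultrafilter -/

section WeakLimit

variable {H : Type*} [NormedAddCommGroup H] [InnerProductSpace ℂ H]

/-- Banach–Alaoglu and the Riesz isomorphism. A fixed ultrafilter replaces subsequences, so limits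
can be taken at all times simultaneously. -/
lemma exists_weak_limit [CompleteSpace H] {u : ℕ → H} {C : ℝ} (h : ∀ n, ‖u n‖ ≤ C) :
    ∃ x : H, ∀ φ, Tendsto (fun n => inner ℂ φ (u n)) (hyperfilter ℕ) (𝓝 (inner ℂ φ x)) := by
  let v : ℕ → WeakDual ℂ H := fun n =>
    StrongDual.toWeakDual (InnerProductSpace.toDual ℂ H (u n))
  have hv : ∀ n, v n ∈ WeakDual.toStrongDual ⁻¹' Metric.closedBall (0 : StrongDual ℂ H) C := by
    intro n
    simpa [v] using h n
  obtain ⟨l, -, hl⟩ := (WeakDual.isCompact_closedBall (0 : StrongDual ℂ H) C).ultrafilter_le_nhds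
    ((hyperfilter ℕ).map v) (by
      rw [Ultrafilter.coe_map, le_principal_iff]
      exact Filter.mem_map.2 (Filter.univ_mem' hv))
  refine ⟨(InnerProductSpace.toDual ℂ H).symm (WeakDual.toStrongDual l), fun φ => ?_⟩
  have h1 : Tendsto (fun n => v n φ) (hyperfilter ℕ) (𝓝 (l φ)) :=
    (WeakDual.eval_continuous φ).continuousAt.tendsto.comp hl
  -- The Riesz map places `u n` in the first, conjugate linear slot of the inner product;
  -- conjugation exchanges the slots.
  have h2 := (Complex.continuous_conj.tendsto _).comp h1
  have h3 : l φ = inner ℂ ((InnerProductSpace.toDual ℂ H).symm (WeakDual.toStrongDual l)) φ := by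
    rw [InnerProductSpace.toDual_symm_apply]; rfl
  rw [h3, inner_conj_symm] at h2
  refine h2.congr fun n => ?_
  simp only [Function.comp]
  rw [← inner_conj_symm φ (u n)]
  rfl

lemma norm_weak_limit_le {ι : Type*} {l : Filter ι} [l.NeBot] {u : ι → H} {x : H} {C : ℝ}
    (hx : ∀ φ, Tendsto (fun n => inner ℂ φ (u n)) l (𝓝 (inner ℂ φ x)))
    (h : ∀ᶠ n in l, ‖u n‖ ≤ C) : ‖x‖ ≤ C := by
  obtain ⟨n, hn⟩ := h.exists
  have hC : 0 ≤ C := (norm_nonneg _).trans hn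
  refine norm_le_of_dense dense_univ hC fun φ _ => ?_
  refine le_of_tendsto (hx φ).norm (h.mono fun n hn => ?_)
  calc ‖inner ℂ φ (u n)‖ ≤ ‖φ‖ * ‖u n‖ := norm_inner_le_norm _ _
    _ ≤ C * ‖φ‖ := by rw [mul_comm]; gcongr

end WeakLimit

/-! ### Weak derivatives and translations -/

/-- `HasWeakDeriv` pairs bilinearly and `inner` sesquilinearly; passing to conjugate test functions
translates one into the other. -/
lemma hasWeakDeriv_iff {f g : L2 d} {w : Phase d} : HasWeakDeriv f g w ↔
    ∀ φ (h : IsTest φ), inner ℂ (testLp _ (h.fderiv w)) f = - inner ℂ (testLp φ h) g := by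
  constructor
  · intro hf φ h
    have := hf _ h.conj
    rw [inner_testLp, inner_testLp, ← this]
    simp only [fderiv_conj h]
  · intro hf φ h
    have := hf _ h.conj
    rw [inner_testLp, inner_testLp] at this
    simpa [fderiv_conj h] using this

lemma transl_testLp_fderiv {φ : Phase d → ℂ} (h : IsTest φ) (y w : Phase d) :
    transl y (testLp _ (h.fderiv w)) = testLp _ ((h.shift y).fderiv w) := by
  rw [transl_testLp]
  exact testLp_congr _ _ fun z => by rw [fderiv_comp_add_right]

/-- In a pairing the translation moves to the test function, where it can be differentiated; the
weak derivative and the mean value inequality give the bound. -/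
lemma HasWeakDeriv.norm_transl_sub_le {f g : L2 d} {w : Phase d} (hf : HasWeakDeriv f g w)
    (t : ℝ) : ‖transl (t • w) f - f‖ ≤ |t| * ‖g‖ := by
  rw [hasWeakDeriv_iff] at hf
  refine norm_le_of_dense dense_testLp (by positivity) ?_
  rintro _ ⟨φ, h, rfl⟩
  have h1 : ∀ s : ℝ, HasDerivAt (fun s : ℝ => inner ℂ (transl (s • w) (testLp φ h)) f)
      (- inner ℂ (transl (s • w) (testLp φ h)) g) s := by
    intro s
    have := (hasDerivAt_transl_test h w s).inner ℂ (hasDerivAt_const s f)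
    rw [inner_zero_right, zero_add, transl_testLp_fderiv h, hf _ (h.shift _),
      ← transl_testLp] at this
    exact this
  have h2 := Convex.norm_image_sub_le_of_norm_hasDerivWithin_le (s := univ)
    (C := ‖testLp φ h‖ * ‖g‖) (x := 0) (y := -t)
    (fun s _ => (h1 s).hasDerivWithinAt)
    (fun s _ => by rw [norm_neg]; simpa using norm_inner_le_norm (transl (s • w) (testLp φ h)) g)
    convex_univ (mem_univ _) (mem_univ _)
  rw [inner_sub_right, ← neg_neg (t • w), ← inner_transl_left, ← neg_smul]
  simp only [zero_smul, transl_zero, sub_zero, Real.norm_eq_abs, abs_neg] at h2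
  linarith

/-- Bounded difference quotients have a weak limit point, which is the weak derivative and inherits
the bound. -/
lemma exists_hasWeakDeriv {f : L2 d} {w : Phase d} {C : ℝ}
    (hf : ∀ t : ℝ, ‖transl (t • w) f - f‖ ≤ C * |t|) : ∃ g, ‖g‖ ≤ C ∧ HasWeakDeriv f g w := by
  let t : ℕ → ℝ := fun n => ((n : ℝ) + 1)⁻¹
  have ht : ∀ n, 0 < t n := fun n => by positivity
  let u : ℕ → L2 d := fun n => ((t n)⁻¹ : ℂ) • (transl (t n • w) f - f)
  have hu : ∀ n, ‖u n‖ ≤ C := by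
    intro n
    have h1 := hf (t n)
    have h2 := ht n
    simp only [u, norm_smul, norm_inv, Complex.norm_real, Real.norm_eq_abs]
    rw [abs_of_pos h2] at *
    rw [inv_mul_le_iff₀ h2]
    linarith
  obtain ⟨g, hg⟩ := exists_weak_limit hu
  refine ⟨g, norm_weak_limit_le hg (.of_forall hu), hasWeakDeriv_iff.2 fun φ h => ?_⟩
  -- The sign arises because the adjoint of the translation by t is the translation by -t.
  have ht0 : Tendsto (fun n => - t n) atTop (𝓝[≠] 0) := by
    rw [tendsto_nhdsWithin_iff]
    constructor
    · simpa using (tendsto_one_div_add_atTop_nhds_zero_nat (𝕜 := ℝ)).neg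
    · exact .of_forall fun n => by simpa using (ht n).ne'
  have h1 := (hasDerivAt_transl_test h w 0).tendsto_slope.comp ht0
  have h2 : Tendsto (fun n => inner ℂ (testLp φ h) (u n)) atTop
      (𝓝 (- inner ℂ (testLp _ (h.fderiv w)) f)) := by
    have h3 := (h1.inner (𝕜 := ℂ) (tendsto_const_nhds (x := f))).neg
    rw [zero_smul, transl_zero] at h3
    refine h3.congr fun n => ?_
    simp only [Function.comp, slope_def_module, sub_zero, u, zero_smul, transl_zero]
    rw [inner_smul_right, inner_sub_right, ← neg_neg (t n • w), ← inner_transl_left,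
      ← neg_smul, RCLike.real_smul_eq_coe_smul (K := ℂ) (-t n)⁻¹, inner_smul_left, inner_sub_left]
    simp
  have h4 := tendsto_nhds_unique (hg (testLp φ h)) (h2.mono_left Nat.hyperfilter_le_atTop)
  rw [h4, neg_neg]

/-! ### Slices of `L²` functions on phase space -/

/-- Square integrable functions of the velocity (or of its dual variable). -/
abbrev SliceL2 (d : ℕ) : Type := Lp ℂ 2 (volume : Measure (Space d))

lemma lintegral_enorm_sq {α : Type*} {m : MeasurableSpace α} {μ : Measure α} (f : Lp ℂ 2 μ) :
    ∫⁻ z, ‖f z‖ₑ ^ 2 ∂μ = ‖f‖ₑ ^ 2 := by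
  rw [Lp.enorm_def, eLpNorm_eq_lintegral_rpow_enorm_toReal (by simp) (by simp)]
  simp only [ENNReal.toReal_ofNat, ENNReal.rpow_ofNat]
  rw [← ENNReal.rpow_natCast, ← ENNReal.rpow_mul]
  simp

lemma memLp_two_of_lintegral {α : Type*} {m : MeasurableSpace α} {μ : Measure α} {f : α → ℂ}
    (hf : AEStronglyMeasurable f μ) (h : ∫⁻ z, ‖f z‖ₑ ^ 2 ∂μ < ⊤) : MemLp f 2 μ := by
  refine ⟨hf, ?_⟩
  rw [eLpNorm_lt_top_iff_lintegral_rpow_enorm_lt_top (by simp) (by simp)]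
  simpa using h

lemma memLp_slice (f : L2 d) : ∀ᵐ x : Space d, MemLp (fun v : Space d => f (x, v)) 2 volume := by
  have h1 : ∫⁻ x : Space d, ∫⁻ v : Space d, ‖f (x, v)‖ₑ ^ 2 = ‖f‖ₑ ^ 2 := by
    rw [← lintegral_enorm_sq]
    exact (lintegral_prod _ ((Lp.stronglyMeasurable f).enorm.pow_const 2).aemeasurable).symm
  have h2 : Measurable fun x : Space d => ∫⁻ v : Space d, ‖f (x, v)‖ₑ ^ 2 :=
    ((Lp.stronglyMeasurable f).enorm.pow_const 2).lintegral_prod_right'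
  filter_upwards [ae_lt_top h2 (by rw [h1]; simp)] with x hx
  exact memLp_two_of_lintegral
    ((Lp.stronglyMeasurable f).comp_measurable measurable_prodMk_left).aestronglyMeasurable hx

/-- The slice `v ↦ f (x, v)` as an element of `L²`. -/
def slice (f : L2 d) (x : Space d) : SliceL2 d :=
  open scoped Classical in
  if h : MemLp (fun v : Space d => f (x, v)) 2 volume then h.toLp _ else 0

lemma slice_coe (f : L2 d) :
    ∀ᵐ x : Space d, (slice f x : Space d → ℂ) =ᵐ[volume] fun v => f (x, v) := by
  filter_upwards [memLp_slice f] with x hx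
  rw [slice, dif_pos hx]
  exact hx.coeFn_toLp

lemma ae_slice {p : Phase d → Prop} (h : ∀ᵐ z, p z) : ∀ᵐ x : Space d, ∀ᵐ v : Space d, p (x, v) :=
  Measure.ae_ae_of_ae_prod h

lemma lintegral_slice (f : L2 d) : ∫⁻ x, ‖slice f x‖ₑ ^ 2 = ‖f‖ₑ ^ 2 := by
  have h1 : ∫⁻ x : Space d, ∫⁻ v : Space d, ‖f (x, v)‖ₑ ^ 2 = ‖f‖ₑ ^ 2 := by
    rw [← lintegral_enorm_sq]
    exact (lintegral_prod _ ((Lp.stronglyMeasurable f).enorm.pow_const 2).aemeasurable).symm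
  rw [← h1]
  refine lintegral_congr_ae ?_
  filter_upwards [slice_coe f] with x hx
  rw [← lintegral_enorm_sq]
  refine lintegral_congr_ae ?_
  filter_upwards [hx] with v hv
  rw [hv]

/-- The squared norm agrees almost everywhere with a measurable inner integral, so measurability of
x ↦ `slice f x` as an L²-valued map is not needed. -/
lemma measurable_enorm_slice (f : L2 d) : AEMeasurable (fun x => ‖slice f x‖ₑ ^ 2) := by
  have h2 : Measurable fun x : Space d => ∫⁻ v : Space d, ‖f (x, v)‖ₑ ^ 2 :=
    ((Lp.stronglyMeasurable f).enorm.pow_const 2).lintegral_prod_right'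
  refine ⟨_, h2, ?_⟩
  filter_upwards [slice_coe f] with x hx
  rw [← lintegral_enorm_sq]
  refine lintegral_congr_ae ?_
  filter_upwards [hx] with v hv
  rw [hv]

lemma slice_sub (f g : L2 d) : ∀ᵐ x, slice (f - g) x = slice f x - slice g x := by
  filter_upwards [slice_coe f, slice_coe g, slice_coe (f - g), ae_slice (Lp.coeFn_sub f g)]
    with x h1 h2 h3 h4
  apply Lp.ext
  filter_upwards [h1, h2, h3, h4, Lp.coeFn_sub (slice f x) (slice g x)] with v e1 e2 e3 e4 e5
  rw [e3, e4, e5, Pi.sub_apply, Pi.sub_apply, e1, e2]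

lemma slice_add (f g : L2 d) : ∀ᵐ x, slice (f + g) x = slice f x + slice g x := by
  filter_upwards [slice_coe f, slice_coe g, slice_coe (f + g), ae_slice (Lp.coeFn_add f g)]
    with x h1 h2 h3 h4
  apply Lp.ext
  filter_upwards [h1, h2, h3, h4, Lp.coeFn_add (slice f x) (slice g x)] with v e1 e2 e3 e4 e5
  rw [e3, e4, e5, Pi.add_apply, Pi.add_apply, e1, e2]

lemma slice_smul (c : ℂ) (f : L2 d) : ∀ᵐ x, slice (c • f) x = c • slice f x := by
  filter_upwards [slice_coe f, slice_coe (c • f), ae_slice (Lp.coeFn_smul c f)]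
    with x h1 h3 h4
  apply Lp.ext
  filter_upwards [h1, h3, h4, Lp.coeFn_smul c (slice f x)] with v e1 e3 e4 e5
  rw [e3, e4, e5, Pi.smul_apply, Pi.smul_apply, e1]

/-! ### The dilation relating the two normalizations of the Fourier transform -/

/-- The factor `(2π)^{d/2}`. -/
def dilFactor (d : ℕ) : ℝ := (2 * Real.pi) ^ ((d : ℝ) / 2)

lemma dilFactor_sq : dilFactor d ^ 2 = (2 * Real.pi) ^ d := by
  rw [dilFactor, ← Real.rpow_natCast, ← Real.rpow_mul (by positivity)]
  rw [Nat.cast_ofNat, div_mul_cancel₀ _ (by norm_num), Real.rpow_natCast]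

lemma map_two_pi_smul : Measure.map (fun η : Space d => (2 * Real.pi) • η) volume
    = ENNReal.ofReal ((2 * Real.pi) ^ d)⁻¹ • (volume : Measure (Space d)) := by
  rw [Measure.map_addHaar_smul _ (by positivity)]
  rw [finrank_euclideanSpace, Fintype.card_fin, abs_of_pos (by positivity)]

lemma quasi_two_pi_smul : Measure.QuasiMeasurePreserving
    (fun η : Space d => (2 * Real.pi) • η) volume volume := by
  refine ⟨by fun_prop, ?_⟩
  rw [map_two_pi_smul]
  exact Measure.smul_absolutelyContinuous

/-- The square of `dilFactor` is exactly the Jacobian of η ↦ 2πη. -/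
lemma lintegral_dil {g : Space d → ℂ} (hg : StronglyMeasurable g) :
    ∫⁻ η, ‖(dilFactor d : ℂ) * g ((2 * Real.pi) • η)‖ₑ ^ 2 = ∫⁻ ξ, ‖g ξ‖ₑ ^ 2 := by
  have h0 : ‖(dilFactor d : ℂ)‖ₑ ^ 2 = ENNReal.ofReal ((2 * Real.pi) ^ d) := by
    rw [← dilFactor_sq, ← ofReal_norm, Complex.norm_real, ← ENNReal.ofReal_pow (norm_nonneg _),
      Real.norm_eq_abs, sq_abs]
  simp only [enorm_mul, mul_pow]
  rw [lintegral_const_mul _ (by fun_prop), ← lintegral_map (f := fun ξ => ‖g ξ‖ₑ ^ 2)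
    (g := fun η : Space d => (2 * Real.pi) • η) (by fun_prop) (by fun_prop), map_two_pi_smul,
    lintegral_smul_measure, h0, smul_eq_mul, ← mul_assoc,
    ← ENNReal.ofReal_mul (by positivity), mul_inv_cancel₀ (by positivity)]
  simp

lemma memLp_dil (w : SliceL2 d) :
    MemLp (fun η => (dilFactor d : ℂ) * w ((2 * Real.pi) • η)) 2 volume := by
  refine memLp_two_of_lintegral ?_ ?_
  · exact (((Lp.stronglyMeasurable w).comp_measurable
      (by fun_prop)).const_mul _).aestronglyMeasurable
  · rw [lintegral_dil (Lp.stronglyMeasurable w), lintegral_enorm_sq]; simp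

/-- `w ↦ (2π)^{d/2} w (2π ·)`. -/
def dil (w : SliceL2 d) : SliceL2 d := (memLp_dil w).toLp _

lemma dil_coe (w : SliceL2 d) :
    dil w =ᵐ[volume] fun η => (dilFactor d : ℂ) * w ((2 * Real.pi) • η) :=
  (memLp_dil w).coeFn_toLp

lemma enorm_dil (w : SliceL2 d) : ‖dil w‖ₑ = ‖w‖ₑ := by
  have h : ‖dil w‖ₑ ^ 2 = ‖w‖ₑ ^ 2 := by
    rw [← lintegral_enorm_sq, ← lintegral_enorm_sq, ← lintegral_dil (Lp.stronglyMeasurable w)]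
    refine lintegral_congr_ae ?_
    filter_upwards [dil_coe w] with v hv
    rw [hv]
  exact (ENNReal.pow_right_strictMono two_ne_zero).injective h

lemma dil_eq_of_ae {w : SliceL2 d} {g u : Space d → ℂ} (h : w =ᵐ[volume] g)
    (h' : ∀ᵐ η, u η = (dilFactor d : ℂ) * g ((2 * Real.pi) • η)) : dil w =ᵐ[volume] u := by
  filter_upwards [dil_coe w, quasi_two_pi_smul.ae h, h'] with η h1 h2 h3
  rw [h1, h2, h3]

lemma dil_sub (w w' : SliceL2 d) : dil (w - w') = dil w - dil w' := by
  apply Lp.ext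
  refine dil_eq_of_ae (Lp.coeFn_sub w w') ?_
  filter_upwards [dil_coe w, dil_coe w', Lp.coeFn_sub (dil w) (dil w')] with η h1 h2 h3
  rw [h3, Pi.sub_apply, h1, h2, Pi.sub_apply]; ring

lemma dil_add (w w' : SliceL2 d) : dil (w + w') = dil w + dil w' := by
  apply Lp.ext
  refine dil_eq_of_ae (Lp.coeFn_add w w') ?_
  filter_upwards [dil_coe w, dil_coe w', Lp.coeFn_add (dil w) (dil w')] with η h1 h2 h3
  rw [h3, Pi.add_apply, h1, h2, Pi.add_apply]; ring

lemma dil_smul (c : ℂ) (w : SliceL2 d) : dil (c • w) = c • dil w := by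
  apply Lp.ext
  refine dil_eq_of_ae (Lp.coeFn_smul c w) ?_
  filter_upwards [dil_coe w, Lp.coeFn_smul c (dil w)] with η h1 h3
  rw [h3, Pi.smul_apply, h1, Pi.smul_apply, smul_eq_mul, smul_eq_mul]; ring

/-! ### The velocity Fourier transform -/

lemma isVelocityFourier_iff {f a : L2 d} : IsVelocityFourier f a ↔
    ∀ᵐ x, (𝓕 (slice f x) : SliceL2 d) = dil (slice a x) := by
  unfold IsVelocityFourier
  constructor
  · intro h
    filter_upwards [h, slice_coe a] with x hx ha
    obtain ⟨hm, h1⟩ := hx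
    rw [slice, dif_pos hm]
    apply Lp.ext
    refine h1.trans (dil_eq_of_ae ha ?_).symm
    exact .of_forall fun η => rfl
  · intro h
    filter_upwards [h, slice_coe a, memLp_slice f] with x hx ha hm
    refine ⟨hm, ?_⟩
    rw [slice, dif_pos hm] at hx
    rw [hx]
    exact dil_eq_of_ae ha (.of_forall fun η => rfl)

lemma IsVelocityFourier.sub {f a g b : L2 d} (h : IsVelocityFourier f a)
    (h' : IsVelocityFourier g b) : IsVelocityFourier (f - g) (a - b) := by
  rw [isVelocityFourier_iff] at *
  filter_upwards [h, h', slice_sub f g, slice_sub a b] with x h1 h2 h3 h4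
  rw [h3, h4, dil_sub, ← h1, ← h2]
  exact map_sub (Lp.fourierTransformₗᵢ (Space d) ℂ) _ _

lemma IsVelocityFourier.add {f a g b : L2 d} (h : IsVelocityFourier f a)
    (h' : IsVelocityFourier g b) : IsVelocityFourier (f + g) (a + b) := by
  rw [isVelocityFourier_iff] at *
  filter_upwards [h, h', slice_add f g, slice_add a b] with x h1 h2 h3 h4
  rw [h3, h4, dil_add, ← h1, ← h2]
  exact map_add (Lp.fourierTransformₗᵢ (Space d) ℂ) _ _

lemma IsVelocityFourier.smul {f a : L2 d} (h : IsVelocityFourier f a) (c : ℂ) :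
    IsVelocityFourier (c • f) (c • a) := by
  rw [isVelocityFourier_iff] at *
  filter_upwards [h, slice_smul c f, slice_smul c a] with x h1 h3 h4
  rw [h3, h4, dil_smul, ← h1]
  exact map_smul (Lp.fourierTransformₗᵢ (Space d) ℂ) _ _

lemma enorm_fourier (w : SliceL2 d) : ‖(𝓕 w : SliceL2 d)‖ₑ = ‖w‖ₑ := by
  rw [← ofReal_norm, ← ofReal_norm, Lp.norm_fourier_eq]

/-- Plancherel's identity for the velocity Fourier transform. -/
lemma IsVelocityFourier.norm_eq {f a : L2 d} (h : IsVelocityFourier f a) : ‖a‖ = ‖f‖ := by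
  rw [isVelocityFourier_iff] at h
  have h1 : ‖a‖ₑ ^ 2 = ‖f‖ₑ ^ 2 := by
    rw [← lintegral_slice, ← lintegral_slice]
    refine lintegral_congr_ae ?_
    filter_upwards [h] with x hx
    rw [← enorm_dil, ← hx, enorm_fourier]
  have h2 := (ENNReal.pow_right_strictMono two_ne_zero).injective h1
  simpa using congrArg ENNReal.toReal h2

/-! ### Unimodular multipliers and translations -/

section Unimodular

variable {α : Type*} {m : MeasurableSpace α} {μ : Measure α}

lemma memLp_unimodular {e : α → ℂ} (he : Measurable e) (h : ∀ z, ‖e z‖ = 1) (a : Lp ℂ 2 μ) :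
    MemLp (fun z => e z * a z) 2 μ :=
  (Lp.memLp a).of_le (he.aestronglyMeasurable.mul (Lp.aestronglyMeasurable a))
    (.of_forall fun z => by rw [norm_mul, h, one_mul])

/-- Multiplication by a measurable unimodular function. -/
def phaseMul (e : α → ℂ) (he : Measurable e) (h : ∀ z, ‖e z‖ = 1) : Lp ℂ 2 μ →ₗᵢ[ℂ] Lp ℂ 2 μ where
  toFun a := (memLp_unimodular he h a).toLp _
  map_add' a b := by
    apply Lp.ext
    filter_upwards [(memLp_unimodular he h (a + b)).coeFn_toLp, Lp.coeFn_add a b,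
      (memLp_unimodular he h a).coeFn_toLp, (memLp_unimodular he h b).coeFn_toLp,
      Lp.coeFn_add ((memLp_unimodular he h a).toLp _) ((memLp_unimodular he h b).toLp _)]
      with z h1 h2 h3 h4 h5
    rw [h1, h2, h5, Pi.add_apply, Pi.add_apply, h3, h4, mul_add]
  map_smul' c a := by
    apply Lp.ext
    filter_upwards [(memLp_unimodular he h (c • a)).coeFn_toLp, Lp.coeFn_smul c a,
      (memLp_unimodular he h a).coeFn_toLp,
      Lp.coeFn_smul c ((memLp_unimodular he h a).toLp _)]
      with z h1 h2 h3 h5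
    rw [h1, h2]
    simp only [RingHom.id_apply]
    rw [h5, Pi.smul_apply, Pi.smul_apply, h3, smul_eq_mul, smul_eq_mul]; ring
  norm_map' a := by
    change ‖(memLp_unimodular he h a).toLp _‖ = ‖a‖
    have h1 := (memLp_unimodular he h a).coeFn_toLp
    apply le_antisymm <;> refine Lp.norm_le_norm_of_ae_le ?_ <;> filter_upwards [h1] with z hz <;>
      rw [hz, norm_mul, h, one_mul]

lemma phaseMul_coe {e : α → ℂ} (he : Measurable e) (h : ∀ z, ‖e z‖ = 1) (a : Lp ℂ 2 μ) :
    phaseMul e he h a =ᵐ[μ] fun z => e z * a z :=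
  (memLp_unimodular he h a).coeFn_toLp

end Unimodular

/-- Translation on slices. -/
def sliceTransl (u : Space d) : SliceL2 d →ₗᵢ[ℂ] SliceL2 d :=
  Lp.compMeasurePreservingₗᵢ ℂ (fun z => z + u) (measurePreserving_add_right volume u)

lemma sliceTransl_coe (u : Space d) (w : SliceL2 d) :
    sliceTransl u w =ᵐ[volume] fun v => w (v + u) :=
  Lp.coeFn_compMeasurePreserving w (measurePreserving_add_right volume u)

/-- The character `η ↦ e^{2π i u·η}`. -/
def sliceChar (u η : Space d) : ℂ := Complex.exp ((inner ℝ u ((2 * Real.pi) • η) : ℝ) * Complex.I)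

lemma measurable_sliceChar (u : Space d) : Measurable (sliceChar u) := by
  unfold sliceChar; fun_prop

lemma norm_sliceChar (u η : Space d) : ‖sliceChar u η‖ = 1 := Complex.norm_exp_ofReal_mul_I _

/-- The character `(x, ξ) ↦ e^{i u·ξ}`. -/
def phaseChar (u : Space d) (z : Phase d) : ℂ := Complex.exp ((inner ℝ u z.2 : ℝ) * Complex.I)

lemma measurable_phaseChar (u : Space d) : Measurable (phaseChar u) := by
  unfold phaseChar; fun_prop

lemma norm_phaseChar (u : Space d) (z : Phase d) : ‖phaseChar u z‖ = 1 :=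
  Complex.norm_exp_ofReal_mul_I _

/-- Multiplication by the character `e^{i u·ξ}`. -/
def modul (u : Space d) : L2 d →ₗᵢ[ℂ] L2 d :=
  phaseMul (phaseChar u) (measurable_phaseChar u) (norm_phaseChar u)

lemma modul_coe (u : Space d) (a : L2 d) : modul u a =ᵐ[volume] fun z => phaseChar u z * a z :=
  phaseMul_coe (measurable_phaseChar u) (norm_phaseChar u) a

/-- Both sides are continuous in w, so it suffices to treat smooth compactly supported functions,
where the integral formula for the transform of a translate applies. -/
lemma fourier_sliceTransl (u : Space d) (w : SliceL2 d) :
    (𝓕 (sliceTransl u w) : SliceL2 d)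
      = phaseMul (sliceChar u) (measurable_sliceChar u) (norm_sliceChar u) (𝓕 w : SliceL2 d) := by
  let F := Lp.fourierTransformₗᵢ (Space d) ℂ
  let P : SliceL2 d →ₗᵢ[ℂ] SliceL2 d :=
    phaseMul (sliceChar u) (measurable_sliceChar u) (norm_sliceChar u)
  refine (Lp.dense_hasCompactSupport_contDiff (F := ℂ) (μ := (volume : Measure (Space d)))
    (p := 2) (by simp)).induction (P := fun w => F (sliceTransl u w) = P (F w)) ?_
    (isClosed_eq (F.continuous.comp (sliceTransl u).continuous)
      (P.continuous.comp F.continuous)) w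
  rintro f ⟨g, hfg, hg1, hg2⟩
  let g' : SchwartzMap (Space d) ℂ := hg1.toSchwartzMap hg2
  have hs1 : HasCompactSupport (fun v => g (v + u)) := hg1.comp_homeomorph (Homeomorph.addRight u)
  let gu : SchwartzMap (Space d) ℂ :=
    hs1.toSchwartzMap (hg2.comp (contDiff_id.add contDiff_const))
  have e1 : f = g'.toLp 2 := by
    apply Lp.ext
    exact hfg.trans (g'.coeFn_toLp 2 volume).symm
  have e2 : sliceTransl u f = gu.toLp 2 := by
    apply Lp.ext
    filter_upwards [sliceTransl_coe u f, gu.coeFn_toLp 2 volume,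
      (measurePreserving_add_right volume u).quasiMeasurePreserving.ae hfg] with v h1 h2 h3
    rw [h1, h2, h3]; rfl
  have e3 : F (gu.toLp 2) = (𝓕 gu).toLp 2 := SchwartzMap.toLp_fourier_eq gu
  have e4 : F (g'.toLp 2) = (𝓕 g').toLp 2 := SchwartzMap.toLp_fourier_eq g'
  change F (sliceTransl u f) = P (F f)
  rw [e2, e1, e3, e4]
  apply Lp.ext
  filter_upwards [(𝓕 gu).coeFn_toLp 2 volume, (𝓕 g').coeFn_toLp 2 volume,
    phaseMul_coe (measurable_sliceChar u) (norm_sliceChar u) ((𝓕 g').toLp 2)] with η h1 h2 h3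
  rw [h1, h3, h2, SchwartzMap.fourier_coe, SchwartzMap.fourier_coe]
  have h5 := congrFun (VectorFourier.fourierIntegral_comp_add_right Real.fourierChar volume
    (innerₗ (Space d)) g u) η
  change 𝓕 (g ∘ fun v => v + u) η = _ at h5
  change 𝓕 (g ∘ fun v => v + u) η = sliceChar u η * 𝓕 g η
  rw [h5, Circle.smul_def, smul_eq_mul, Real.fourierChar_apply, sliceChar, inner_smul_right]
  rfl

lemma IsVelocityFourier.transl_fst {f a : L2 d} (h : IsVelocityFourier f a) (y : Space d) :
    IsVelocityFourier (transl (y, 0) f) (transl (y, 0) a) := by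
  rw [isVelocityFourier_iff] at *
  have key : ∀ g : L2 d, ∀ᵐ x : Space d, slice (transl (y, 0) g) x = slice g (x + y) := by
    intro g
    filter_upwards [slice_coe (transl (y, 0) g), ae_slice (transl_coe (y, 0) g),
      (measurePreserving_add_right volume y).quasiMeasurePreserving.ae (slice_coe g)]
      with x h1 h2 h3
    apply Lp.ext
    filter_upwards [h1, h2, h3] with v e1 e2 e3
    rw [e1, e2, e3]; simp
  filter_upwards [key f, key a,
    (measurePreserving_add_right volume y).quasiMeasurePreserving.ae h] with x h1 h2 h3
  rw [h1, h2, h3]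

/-- Velocity translations become multiplication by e^{iu·ξ}; this is how v-derivatives turn into
ξ-moments. The 2π in `sliceChar` is absorbed by the dilation. -/
lemma IsVelocityFourier.transl_snd {f a : L2 d} (h : IsVelocityFourier f a) (u : Space d) :
    IsVelocityFourier (transl (0, u) f) (modul u a) := by
  rw [isVelocityFourier_iff] at *
  filter_upwards [h, slice_coe f, slice_coe a, slice_coe (transl (0, u) f),
    slice_coe (modul u a), ae_slice (transl_coe (0, u) f), ae_slice (modul_coe u a)]
    with x h1 h2 h3 h4 h5 h6 h7
  have e1 : slice (transl (0, u) f) x = sliceTransl u (slice f x) := by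
    apply Lp.ext
    filter_upwards [h4, h6, sliceTransl_coe u (slice f x),
      (measurePreserving_add_right volume u).quasiMeasurePreserving.ae h2] with v e1 e2 e3 e4
    rw [e1, e2, e3, e4]; simp
  rw [e1, fourier_sliceTransl, h1]
  apply Lp.ext
  symm
  refine dil_eq_of_ae (g := fun ξ => phaseChar u (x, ξ) * slice a x ξ) ?_ ?_
  · filter_upwards [h5, h7, h3] with ξ e1 e2 e3
    rw [e1, e2, e3]
  · filter_upwards [phaseMul_coe (measurable_sliceChar u) (norm_sliceChar u) (dil (slice a x)),
      dil_coe (slice a x)] with η e1 e2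
    rw [e1, e2]
    simp only [sliceChar, phaseChar]
    ring

/-! ### Surjectivity of the velocity Fourier transform -/

/-- The relation is closed: Plancherel on each slice bounds the defect by `G n x` for every n, and
the integral of `G n` tends to zero. -/
lemma IsVelocityFourier.of_tendsto {f a : L2 d} {F A : ℕ → L2 d}
    (h : ∀ n, IsVelocityFourier (F n) (A n)) (hF : Tendsto F atTop (𝓝 f))
    (hA : Tendsto A atTop (𝓝 a)) : IsVelocityFourier f a := by
  rw [isVelocityFourier_iff]
  simp only [isVelocityFourier_iff] at h
  let G : ℕ → Space d → ℝ≥0∞ := fun n x => ‖slice (f - F n) x‖ₑ ^ 2 + ‖slice (a - A n) x‖ₑ ^ 2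
  have hG : ∀ n, AEMeasurable (G n) := fun n =>
    (measurable_enorm_slice _).add (measurable_enorm_slice _)
  have hG1 : ∀ n, ∫⁻ x, G n x = ‖f - F n‖ₑ ^ 2 + ‖a - A n‖ₑ ^ 2 := fun n => by
    rw [lintegral_add_left' (measurable_enorm_slice _), lintegral_slice, lintegral_slice]
  have hG2 : Tendsto (fun n => ‖f - F n‖ₑ ^ 2 + ‖a - A n‖ₑ ^ 2) atTop (𝓝 0) := by
    have h1 : Tendsto (fun n => ‖f - F n‖ₑ) atTop (𝓝 0) := by
      simpa using (tendsto_const_nhds.sub hF : Tendsto (fun n => f - F n) _ _).enorm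
    have h2 : Tendsto (fun n => ‖a - A n‖ₑ) atTop (𝓝 0) := by
      simpa using (tendsto_const_nhds.sub hA : Tendsto (fun n => a - A n) _ _).enorm
    simpa using (ENNReal.Tendsto.pow (n := 2) h1).add (ENNReal.Tendsto.pow (n := 2) h2)
  -- The infimum over n vanishes almost everywhere, which avoids passing to an almost everywhere
  -- convergent subsequence.
  have hG3 : ∫⁻ x, ⨅ n, G n x = 0 := by
    refine le_antisymm (ge_of_tendsto' hG2 fun n => ?_) zero_le
    rw [← hG1]
    exact lintegral_mono fun x => iInf_le _ n
  rw [lintegral_eq_zero_iff' (AEMeasurable.iInf hG)] at hG3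
  filter_upwards [hG3, ae_all_iff.2 h, ae_all_iff.2 fun n => slice_sub f (F n),
    ae_all_iff.2 fun n => slice_sub a (A n)] with x h1 h2 h3 h4
  rw [← sub_eq_zero, ← enorm_eq_zero]
  have h5 : ∀ n, ‖(𝓕 (slice f x) : SliceL2 d) - dil (slice a x)‖ₑ ^ 2 ≤ 2 * G n x := by
    intro n
    have e1 : (𝓕 (slice f x) : SliceL2 d) - dil (slice a x)
        = 𝓕 (slice (f - F n) x) - dil (slice (a - A n) x) := by
      have e2 : (𝓕 (slice f x - slice (F n) x) : SliceL2 d) = 𝓕 (slice f x) - 𝓕 (slice (F n) x) :=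
        map_sub (Lp.fourierTransformₗᵢ (Space d) ℂ) _ _
      rw [h3, h4, e2, dil_sub, h2]; abel
    rw [e1]
    calc _ ≤ (‖(𝓕 (slice (f - F n) x) : SliceL2 d)‖ₑ + ‖dil (slice (a - A n) x)‖ₑ) ^ 2 := by
          gcongr; exact enorm_sub_le
      _ ≤ 2 * G n x := by
          rw [enorm_fourier, enorm_dil]
          have := ENNReal.rpow_add_le_mul_rpow_add_rpow (‖slice (f - F n) x‖ₑ)
            (‖slice (a - A n) x‖ₑ) (p := 2) (by norm_num)
          norm_num at this
          exact this
  have h6 : ‖(𝓕 (slice f x) : SliceL2 d) - dil (slice a x)‖ₑ ^ 2 ≤ 2 * ⨅ n, G n x := by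
    rw [ENNReal.mul_iInf_of_ne (by simp) (by simp)]
    exact le_iInf h5
  rw [h1] at h6
  simpa using h6

/-- The function `1_A(x) w(ξ)`. -/
def tensorFun (A : Set (Space d)) (w : SliceL2 d) (z : Phase d) : ℂ :=
  A.indicator (fun _ => w z.2) z.1

lemma memLp_tensorFun {A : Set (Space d)} (hA : MeasurableSet A) (hA' : volume A ≠ ⊤)
    (w : SliceL2 d) : MemLp (tensorFun A w) 2 volume := by
  have e : ∀ z : Phase d, tensorFun A w z = A.indicator (fun _ => (1 : ℂ)) z.1 * w z.2 := by
    intro z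
    by_cases h : z.1 ∈ A <;> simp [tensorFun, h]
  have hm : StronglyMeasurable (tensorFun A w) := by
    rw [show tensorFun A w = _ from funext e]
    exact ((stronglyMeasurable_const.indicator hA).comp_measurable measurable_fst).mul
      ((Lp.stronglyMeasurable w).comp_measurable measurable_snd)
  refine memLp_two_of_lintegral hm.aestronglyMeasurable ?_
  have h1 : ∫⁻ z : Phase d, ‖tensorFun A w z‖ₑ ^ 2
      = (∫⁻ x, A.indicator (fun _ => 1) x) * ∫⁻ v, ‖w v‖ₑ ^ 2 := by
    rw [← lintegral_prod_mul (by fun_prop (disch := assumption))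
      ((Lp.stronglyMeasurable w).enorm.pow_const 2).aemeasurable]
    refine lintegral_congr fun z => ?_
    by_cases h : z.1 ∈ A <;> simp [tensorFun, h]
  rw [h1, lintegral_indicator_const hA, lintegral_enorm_sq]
  exact ENNReal.mul_lt_top (by simpa using hA'.lt_top) (by simp)

lemma slice_tensor {A : Set (Space d)} (hA : MeasurableSet A) (hA' : volume A ≠ ⊤)
    (w : SliceL2 d) :
    ∀ᵐ x, slice ((memLp_tensorFun hA hA' w).toLp _) x = A.indicator (fun _ => w) x := by
  filter_upwards [slice_coe ((memLp_tensorFun hA hA' w).toLp _),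
    ae_slice (memLp_tensorFun hA hA' w).coeFn_toLp] with x h1 h2
  apply Lp.ext
  by_cases h : x ∈ A
  · filter_upwards [h1, h2] with v e1 e2
    rw [e1, e2]; simp [tensorFun, h]
  · rw [indicator_of_notMem h]
    filter_upwards [h1, h2, Lp.coeFn_zero ℂ 2 (volume : Measure (Space d))] with v e1 e2 e3
    rw [e1, e2, e3]; simp [tensorFun, h]

/-- For a product 1_A(x) w(ξ) the transform can be inverted explicitly in the second factor. -/
lemma isVelocityFourier_tensor {A : Set (Space d)} (hA : MeasurableSet A) (hA' : volume A ≠ ⊤)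
    (w : SliceL2 d) : IsVelocityFourier
      ((memLp_tensorFun hA hA' (𝓕⁻ (dil w))).toLp _) ((memLp_tensorFun hA hA' w).toLp _) := by
  rw [isVelocityFourier_iff]
  filter_upwards [slice_tensor hA hA' w, slice_tensor hA hA' (𝓕⁻ (dil w))] with x h1 h2
  rw [h1, h2]
  by_cases h : x ∈ A
  · simp [h]
  · simp only [h, not_false_eq_true, indicator_of_notMem]
    have e1 : (𝓕 (0 : SliceL2 d) : SliceL2 d) = 0 := map_zero (Lp.fourierTransformₗᵢ (Space d) ℂ)
    have e2 : dil (0 : SliceL2 d) = 0 := by simpa using dil_sub (0 : SliceL2 d) 0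
    rw [e1, e2]

lemma integrable_conj_mul {α : Type*} {m : MeasurableSpace α} {μ : Measure α} (a b : Lp ℂ 2 μ) :
    Integrable (fun z => b z * starRingEnd ℂ (a z)) μ :=
  L2.integrable_inner a b

lemma inner_tensor {A : Set (Space d)} (hA : MeasurableSet A) (hA' : volume A ≠ ⊤)
    (w : SliceL2 d) (g : L2 d) : inner ℂ ((memLp_tensorFun hA hA' w).toLp _) g
      = ∫ x in A, inner ℂ w (slice g x) := by
  have h0 := integrable_conj_mul ((memLp_tensorFun hA hA' w).toLp _) g
  rw [inner_eq_integral]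
  refine (integral_prod _ h0).trans ?_
  rw [← integral_indicator hA]
  refine integral_congr_ae ?_
  filter_upwards [slice_coe g, ae_slice (memLp_tensorFun hA hA' w).coeFn_toLp] with x h1 h2
  by_cases h : x ∈ A
  · rw [indicator_of_mem h, L2.inner_def]
    refine integral_congr_ae ?_
    filter_upwards [h1, h2] with v e1 e2
    rw [e2, e1]; simp [tensorFun, h]
  · rw [indicator_of_notMem h, ← integral_zero (Space d) ℂ]
    refine integral_congr_ae ?_
    filter_upwards [h2] with v e2
    rw [e2]; simp [tensorFun, h]

lemma integrableOn_inner_slice {A : Set (Space d)} (hA : MeasurableSet A) (hA' : volume A ≠ ⊤)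
    (w : SliceL2 d) (g : L2 d) : IntegrableOn (fun x => inner ℂ w (slice g x)) A := by
  have h0 := integrable_conj_mul ((memLp_tensorFun hA hA' w).toLp _) g
  have h1 := (Integrable.integral_prod_left h0).integrableOn (s := A)
  refine h1.congr ?_
  filter_upwards [ae_restrict_of_ae (slice_coe g),
    ae_restrict_of_ae (ae_slice (memLp_tensorFun hA hA' w).coeFn_toLp), ae_restrict_mem hA]
    with x h1 h2 h
  rw [L2.inner_def]
  refine integral_congr_ae ?_
  filter_upwards [h1, h2] with v e1 e2
  rw [e2, e1]; simp [tensorFun, h]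

/-- Every square integrable function is a velocity Fourier transform. -/
lemma exists_isVelocityFourier (a : L2 d) : ∃ f, IsVelocityFourier f a := by
  let K : Submodule ℂ (L2 d) :=
    { carrier := {a | ∃ f, IsVelocityFourier f a}
      add_mem' := fun ⟨f, hf⟩ ⟨g, hg⟩ => ⟨f + g, hf.add hg⟩
      zero_mem' := by
        refine ⟨0, ?_⟩
        have := isVelocityFourier_tensor (d := d) (A := ∅) .empty (by simp) 0
        simpa using this.sub this
      smul_mem' := fun c a ⟨f, hf⟩ => ⟨c • f, hf.smul c⟩ }
  -- Density of the range: a function orthogonal to all products 1_A ⊗ w has slices that are almost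
  -- everywhere orthogonal to each w.
  have hK : K.topologicalClosure = ⊤ := by
    rw [Submodule.topologicalClosure_eq_top_iff, Submodule.eq_bot_iff]
    intro g hg
    rw [Submodule.mem_orthogonal] at hg
    have h1 : ∀ w : SliceL2 d, ∀ᵐ x, inner ℂ w (slice g x) = 0 := by
      intro w
      refine ae_eq_zero_of_forall_setIntegral_eq_of_sigmaFinite (fun A hA hA' => ?_)
        (fun A hA hA' => ?_)
      · exact integrableOn_inner_slice hA hA'.ne w g
      · rw [← inner_tensor hA hA'.ne]
        exact hg _ ⟨_, isVelocityFourier_tensor hA hA'.ne w⟩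
    have : Fact ((2 : ℝ≥0∞) ≠ ⊤) := ⟨by simp⟩
    have : SecondCountableTopology (SliceL2 d) := Lp.SecondCountableTopology
    -- The exceptional null set depends on w; a countable dense family makes it common to all w.
    obtain ⟨D, hDc, hD⟩ := TopologicalSpace.exists_countable_dense (SliceL2 d)
    have h2 : ∀ᵐ x, ∀ w ∈ D, inner ℂ w (slice g x) = 0 := (ae_ball_iff hDc).2 fun w _ => h1 w
    have h3 : ∀ᵐ x, slice g x = 0 := by
      filter_upwards [h2] with x hx
      exact eq_of_dense hD fun w hw => by rw [hx w hw, inner_zero_right]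
    have h4 : ‖g‖ₑ ^ 2 = 0 := by
      rw [← lintegral_slice]
      rw [lintegral_congr_ae (g := fun _ => 0) (by filter_upwards [h3] with x hx; simp [hx])]
      simp
    simpa using h4
  have ha : a ∈ closure (K : Set (L2 d)) := by
    have : a ∈ K.topologicalClosure := by rw [hK]; trivial
    exact this
  obtain ⟨A, hA1, hA2⟩ := mem_closure_iff_seq_limit.1 ha
  choose F hF using hA1
  -- The range is also closed, since by Plancherel the preimages of a convergent sequence form a
  -- Cauchy sequence.
  have hc : CauchySeq F := by
    rw [Metric.cauchySeq_iff']
    intro ε hε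
    obtain ⟨N, hN⟩ := Metric.cauchySeq_iff'.1 hA2.cauchySeq ε hε
    refine ⟨N, fun n hn => ?_⟩
    have := hN n hn
    rwa [dist_eq_norm, ((hF n).sub (hF N)).norm_eq, ← dist_eq_norm] at this
  obtain ⟨f, hf⟩ := cauchySeq_tendsto_of_complete hc
  exact ⟨f, .of_tendsto hF hf hA2⟩

/-! ### The space `M¹` in terms of translations and moments -/

/-- The coordinate `ξ_i`, truncated at height `R`. -/
def clampV (R : ℝ) (i : Fin d) (z : Phase d) : ℝ := max (-R) (min R (z.2 i))

lemma abs_clampV_le {R : ℝ} (hR : 0 ≤ R) (i : Fin d) (z : Phase d) : |clampV R i z| ≤ R := by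
  rw [abs_le, clampV]
  exact ⟨le_max_left _ _, max_le (by linarith) (min_le_left _ _)⟩

lemma isMult_clampV {R : ℝ} (hR : 0 ≤ R) (i : Fin d) : IsMult (clampV R i) := by
  refine ⟨?_, R, abs_clampV_le hR i⟩
  unfold clampV; fun_prop

lemma abs_clampV_le_abs {R : ℝ} (hR : 0 ≤ R) (i : Fin d) (z : Phase d) :
    |clampV R i z| ≤ |z.2 i| := by
  unfold clampV
  rcases abs_cases (max (-R) (min R (z.2 i))) with h | h <;>
  rcases abs_cases (z.2 i) with h' | h' <;>
  rcases max_cases (-R) (min R (z.2 i)) with h1 | h1 <;>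
  rcases min_cases R (z.2 i) with h2 | h2 <;> linarith

lemma clampV_of_le {R : ℝ} {i : Fin d} {z : Phase d} (h : |z.2 i| ≤ R) : clampV R i z = z.2 i := by
  rw [abs_le] at h
  rw [clampV, min_eq_right h.2, max_eq_right h.1]

/-- Quantitative regularity: `‖a‖`, `‖∂_{x_i} a‖` and `‖ξ_i a‖` are at most `C`. -/
structure Reg (C : ℝ) (a : L2 d) : Prop where
  norm_le : ‖a‖ ≤ C
  shift : ∀ (i : Fin d) (t : ℝ), ‖transl (t • dirX i) a - a‖ ≤ C * |t|
  moment : ∀ (i : Fin d) (R : ℝ), 0 ≤ R → ‖mulOp (clampV R i) a‖ ≤ C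

lemma Reg.nonneg {C : ℝ} {a : L2 d} (h : Reg C a) : 0 ≤ C := (norm_nonneg a).trans h.norm_le

lemma enorm_mulOp_sq {m : Phase d → ℝ} (hm : IsMult m) (a : L2 d) :
    ‖mulOp m a‖ₑ ^ 2 = ∫⁻ z, (‖m z‖ₑ * ‖a z‖ₑ) ^ 2 := by
  rw [← lintegral_enorm_sq]
  refine lintegral_congr_ae ?_
  filter_upwards [mulOp_coe hm a] with z hz
  rw [hz, enorm_mul]
  congr 2
  rw [← ofReal_norm, ← ofReal_norm, Complex.norm_real]

lemma norm_mulOp_clampV_le {i : Fin d} {a : L2 d} {C : ℝ} (hC : 0 ≤ C)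
    (h : ∫⁻ z : Phase d, (‖z.2 i‖ₑ * ‖a z‖ₑ) ^ 2 ≤ ENNReal.ofReal C ^ 2) {R : ℝ} (hR : 0 ≤ R) :
    ‖mulOp (clampV R i) a‖ ≤ C := by
  have h1 : ‖mulOp (clampV R i) a‖ₑ ^ 2 ≤ ENNReal.ofReal C ^ 2 := by
    rw [enorm_mulOp_sq (isMult_clampV hR i)]
    refine (lintegral_mono fun z => ?_).trans h
    gcongr
    rw [enorm_le_iff_norm_le]
    exact abs_clampV_le_abs hR i z
  rw [ENNReal.pow_le_pow_left_iff two_ne_zero, ← ofReal_norm,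
    ENNReal.ofReal_le_ofReal_iff hC] at h1
  exact h1

/-- Fatou's lemma removes the truncation, which is inactive at each point once n is large. -/
lemma Reg.lintegral_moment_le {C : ℝ} {a : L2 d} (h : Reg C a) (i : Fin d) :
    ∫⁻ z : Phase d, (‖z.2 i‖ₑ * ‖a z‖ₑ) ^ 2 ≤ ENNReal.ofReal C ^ 2 := by
  have h1 : ∀ n : ℕ, ∫⁻ z : Phase d, (‖clampV n i z‖ₑ * ‖a z‖ₑ) ^ 2 ≤ ENNReal.ofReal C ^ 2 := by
    intro n
    rw [← enorm_mulOp_sq (isMult_clampV n.cast_nonneg i), ← ofReal_norm]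
    gcongr
    exact h.moment i n n.cast_nonneg
  have h2 : ∀ z : Phase d, (‖z.2 i‖ₑ * ‖a z‖ₑ) ^ 2
      = liminf (fun n : ℕ => (‖clampV n i z‖ₑ * ‖a z‖ₑ) ^ 2) atTop := by
    intro z
    refine (Tendsto.liminf_eq ?_).symm
    refine tendsto_const_nhds.congr' ?_
    filter_upwards [eventually_ge_atTop ⌈|z.2 i|⌉₊] with n hn
    rw [clampV_of_le (Nat.ceil_le.1 hn)]
  simp only [h2]
  refine (lintegral_liminf_le' fun n => ?_).trans ?_
  · exact ((((isMult_clampV n.cast_nonneg i).1.enorm.aemeasurable).mul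
      (Lp.aestronglyMeasurable a).enorm).pow_const 2)
  · refine liminf_le_of_le (by isBoundedDefault) fun b hb => ?_
    obtain ⟨n, hn⟩ := hb.exists
    exact hn.trans (h1 n)

lemma smul_dirX (t : ℝ) (i : Fin d) :
    t • (dirX i : Phase d) = (t • EuclideanSpace.single i 1, 0) := by
  simp [dirX]

lemma smul_dirV (t : ℝ) (i : Fin d) :
    t • (dirV i : Phase d) = (0, t • EuclideanSpace.single i 1) := by
  simp [dirV]

lemma phaseChar_single (t : ℝ) (i : Fin d) (z : Phase d) :
    phaseChar (t • EuclideanSpace.single i 1) z = Complex.exp (Complex.I * (t * z.2 i : ℝ)) := by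
  rw [phaseChar, inner_smul_left, EuclideanSpace.inner_single_left, mul_comm]
  simp

lemma norm_modul_sub_le {a : L2 d} {C : ℝ} (hC : 0 ≤ C) {i : Fin d}
    (h : ∫⁻ z : Phase d, (‖z.2 i‖ₑ * ‖a z‖ₑ) ^ 2 ≤ ENNReal.ofReal C ^ 2) (t : ℝ) :
    ‖modul (t • EuclideanSpace.single i 1) a - a‖ ≤ C * |t| := by
  have h1 : ‖modul (t • EuclideanSpace.single i 1) a - a‖ₑ ^ 2 ≤ ENNReal.ofReal (C * |t|) ^ 2 := by
    rw [← lintegral_enorm_sq]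
    calc _ ≤ ∫⁻ z : Phase d, ‖t‖ₑ ^ 2 * (‖z.2 i‖ₑ * ‖a z‖ₑ) ^ 2 := by
          refine lintegral_mono_ae ?_
          filter_upwards [modul_coe (t • EuclideanSpace.single i 1) a,
            Lp.coeFn_sub (modul (t • EuclideanSpace.single i 1) a) a] with z h1 h2
          rw [h2, Pi.sub_apply, h1, phaseChar_single, ← mul_pow, ← mul_assoc, ← enorm_mul,
            ← sub_one_mul, enorm_mul]
          gcongr
          rw [enorm_le_iff_norm_le]
          exact Real.norm_exp_I_mul_ofReal_sub_one_le
      _ = ‖t‖ₑ ^ 2 * ∫⁻ z : Phase d, (‖z.2 i‖ₑ * ‖a z‖ₑ) ^ 2 :=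
          lintegral_const_mul' _ _ (by simp)
      _ ≤ ‖t‖ₑ ^ 2 * ENNReal.ofReal C ^ 2 := by gcongr
      _ = _ := by
          rw [ENNReal.ofReal_mul hC, mul_pow, mul_comm, ← Real.norm_eq_abs, ofReal_norm]
  rw [ENNReal.pow_le_pow_left_iff two_ne_zero, ← ofReal_norm,
    ENNReal.ofReal_le_ofReal_iff (by positivity)] at h1
  exact h1

/-- Fatou's lemma applied to the quotients (e^{itξ_i} - 1)/t, which converge pointwise to iξ_i. -/
lemma lintegral_moment_le_of_modul {a : L2 d} {C : ℝ} {i : Fin d}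
    (h : ∀ t : ℝ, ‖modul (t • EuclideanSpace.single i 1) a - a‖ ≤ |t| * C) :
    ∫⁻ z : Phase d, (‖z.2 i‖ₑ * ‖a z‖ₑ) ^ 2 ≤ ENNReal.ofReal C ^ 2 := by
  let t : ℕ → ℝ := fun n => ((n : ℝ) + 1)⁻¹
  have ht : ∀ n, 0 < t n := fun n => by positivity
  have ht0 : Tendsto t atTop (𝓝[≠] 0) := by
    rw [tendsto_nhdsWithin_iff]
    constructor
    · simpa using (tendsto_one_div_add_atTop_nhds_zero_nat (𝕜 := ℝ))
    · exact .of_forall fun n => by simpa using (ht n).ne'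
  let q : ℕ → Phase d → ℝ≥0∞ := fun n z =>
    (‖((t n)⁻¹ : ℂ) * (phaseChar (t n • EuclideanSpace.single i 1) z - 1)‖ₑ * ‖a z‖ₑ) ^ 2
  have h1 : ∀ n, ∫⁻ z, q n z ≤ ENNReal.ofReal C ^ 2 := by
    intro n
    have e1 : ∫⁻ z, q n z = ‖((t n)⁻¹ : ℂ) • (modul (t n • EuclideanSpace.single i 1) a - a)‖ₑ ^ 2 := by
      rw [← lintegral_enorm_sq]
      refine lintegral_congr_ae ?_
      filter_upwards [modul_coe (t n • EuclideanSpace.single i 1) a,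
        Lp.coeFn_sub (modul (t n • EuclideanSpace.single i 1) a) a,
        Lp.coeFn_smul ((t n)⁻¹ : ℂ) (modul (t n • EuclideanSpace.single i 1) a - a)] with z h1 h2 h3
      rw [h3, Pi.smul_apply, h2, Pi.sub_apply, h1, smul_eq_mul]
      simp only [q]
      rw [← enorm_mul]
      congr 2; ring
    rw [e1, ← ofReal_norm]
    gcongr
    rw [norm_smul, norm_inv, Complex.norm_real, Real.norm_eq_abs,
      inv_mul_le_iff₀ (abs_pos.2 (ht n).ne')]
    exact h _
  have h2 : ∀ z : Phase d, (‖z.2 i‖ₑ * ‖a z‖ₑ) ^ 2 = liminf (fun n => q n z) atTop := by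
    intro z
    refine (Tendsto.liminf_eq ?_).symm
    have e1 : HasDerivAt (fun s : ℝ => phaseChar (s • EuclideanSpace.single i 1) z)
        (Complex.I * z.2 i) 0 := by
      simp only [phaseChar_single]
      have e2 : HasDerivAt (fun s : ℝ => Complex.I * ((s * z.2 i : ℝ) : ℂ))
          (Complex.I * ((1 * z.2 i : ℝ) : ℂ)) 0 :=
        (((hasDerivAt_id (0 : ℝ)).mul_const (z.2 i)).ofReal_comp).const_mul _
      simpa using e2.cexp
    have e3 := e1.tendsto_slope.comp ht0
    have e4 : ‖z.2 i‖ₑ = ‖Complex.I * z.2 i‖ₑ := by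
      rw [← ofReal_norm, ← ofReal_norm]; simp
    rw [e4]
    have e5 : Tendsto (fun n => (‖(slope (fun s : ℝ => phaseChar (s • EuclideanSpace.single i 1) z)
        0 ∘ t) n‖ₑ * ‖a z‖ₑ) ^ 2) atTop (𝓝 ((‖Complex.I * (z.2 i : ℂ)‖ₑ * ‖a z‖ₑ) ^ 2)) :=
      ENNReal.Tendsto.pow (ENNReal.Tendsto.mul_const e3.enorm (.inr (by simp)))
    refine e5.congr fun n => ?_
    simp only [q, Function.comp, slope_def_module, sub_zero]
    congr 3
    rw [← Complex.ofReal_inv, Complex.real_smul, phaseChar_single (0 : ℝ)]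
    simp
  simp only [h2]
  refine (lintegral_liminf_le' fun n => ?_).trans ?_
  · exact (((((measurable_phaseChar _).sub_const 1).const_mul _).enorm.aemeasurable).mul
      (Lp.aestronglyMeasurable a).enorm).pow_const 2
  · refine liminf_le_of_le (by isBoundedDefault) fun b hb => ?_
    obtain ⟨n, hn⟩ := hb.exists
    exact hn.trans (h1 n)

lemma exists_of_sobolevNorm_lt {f : L2 d} {C : ℝ} (h : sobolevNorm f < ENNReal.ofReal C) :
    ∃ gx gv : Fin d → L2 d, (∀ i, HasWeakDeriv f (gx i) (dirX i)) ∧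
      (∀ i, HasWeakDeriv f (gv i) (dirV i)) ∧ ‖f‖ ≤ C ∧ (∀ i, ‖gx i‖ ≤ C) ∧ ∀ i, ‖gv i‖ ≤ C := by
  simp only [sobolevNorm, iInf_lt_iff] at h
  obtain ⟨gx, gv, hx, hv, h⟩ := h
  rw [ENNReal.ofReal_lt_ofReal_iff_of_nonneg (Real.sqrt_nonneg _)] at h
  have hC : 0 ≤ C := (Real.sqrt_nonneg _).trans h.le
  have h1 := (Real.sqrt_le_left hC).1 h.le
  have hs1 : ∀ i, ‖gx i‖ ^ 2 ≤ ∑ i, ‖gx i‖ ^ 2 := fun i =>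
    Finset.single_le_sum (f := fun i => ‖gx i‖ ^ 2) (fun j _ => sq_nonneg _) (Finset.mem_univ i)
  have hs2 : ∀ i, ‖gv i‖ ^ 2 ≤ ∑ i, ‖gv i‖ ^ 2 := fun i =>
    Finset.single_le_sum (f := fun i => ‖gv i‖ ^ 2) (fun j _ => sq_nonneg _) (Finset.mem_univ i)
  have hp1 : 0 ≤ ∑ i, ‖gx i‖ ^ 2 := Finset.sum_nonneg fun j _ => sq_nonneg _
  have hp2 : 0 ≤ ∑ i, ‖gv i‖ ^ 2 := Finset.sum_nonneg fun j _ => sq_nonneg _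
  refine ⟨gx, gv, hx, hv, ?_, fun i => ?_, fun i => ?_⟩ <;> refine abs_le_of_sq_le_sq' ?_ hC |>.2
  · linarith
  · have := hs1 i; nlinarith [sq_nonneg ‖f‖]
  · have := hs2 i; nlinarith [sq_nonneg ‖f‖]

/-- By Plancherel, x-increments and modulations of a have the same norms as the x- and v-increments
of its preimage, and weak derivatives control these. -/
lemma Reg.of_m1Norm_lt {a : L2 d} {C : ℝ} (h : m1Norm a < ENNReal.ofReal C) : Reg C a := by
  simp only [m1Norm, iInf_lt_iff] at h
  obtain ⟨f, hf, h⟩ := h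
  obtain ⟨gx, gv, hx, hv, h0, h1, h2⟩ := exists_of_sobolevNorm_lt h
  have hC : 0 ≤ C := (norm_nonneg _).trans h0
  refine ⟨hf.norm_eq ▸ h0, fun i t => ?_, fun i R hR => norm_mulOp_clampV_le hC ?_ hR⟩
  · rw [smul_dirX, ((hf.transl_fst _).sub hf).norm_eq, ← smul_dirX]
    refine ((hx i).norm_transl_sub_le t).trans ?_
    rw [mul_comm]; gcongr; exact h1 i
  · refine lintegral_moment_le_of_modul fun t => ?_
    rw [((hf.transl_snd _).sub hf).norm_eq, ← smul_dirV]
    refine ((hv i).norm_transl_sub_le t).trans ?_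
    gcongr; exact h2 i

/-- The preimage has bounded difference quotients in every coordinate direction, hence weak
derivatives with the same bounds. -/
lemma Reg.m1Norm_le {a : L2 d} {C : ℝ} (h : Reg C a) :
    m1Norm a ≤ ENNReal.ofReal ((2 * d + 1) * C) := by
  have hC := h.nonneg
  obtain ⟨f, hf⟩ := exists_isVelocityFourier a
  refine (iInf₂_le f hf).trans ?_
  have h1 : ∀ i, ∃ g, ‖g‖ ≤ C ∧ HasWeakDeriv f g (dirX i) := fun i =>
    exists_hasWeakDeriv fun t => by
      rw [smul_dirX, ← ((hf.transl_fst _).sub hf).norm_eq, ← smul_dirX]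
      exact h.shift i t
  have h2 : ∀ i, ∃ g, ‖g‖ ≤ C ∧ HasWeakDeriv f g (dirV i) := fun i =>
    exists_hasWeakDeriv fun t => by
      rw [smul_dirV, ← ((hf.transl_snd _).sub hf).norm_eq]
      exact norm_modul_sub_le hC (h.lintegral_moment_le i) t
  choose gx hgx hx using h1
  choose gv hgv hv using h2
  refine (iInf_le _ gx).trans ((iInf_le _ gv).trans ((iInf₂_le hx hv).trans ?_))
  apply ENNReal.ofReal_le_ofReal
  refine Real.sqrt_le_iff.2 ⟨by positivity, ?_⟩
  have e0 : ‖f‖ ≤ C := hf.norm_eq ▸ h.norm_le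
  have e1 : ∑ i, ‖gx i‖ ^ 2 ≤ d * C ^ 2 := by
    refine (Finset.sum_le_sum fun i _ => pow_le_pow_left₀ (norm_nonneg _) (hgx i) 2).trans ?_
    simp
  have e2 : ∑ i, ‖gv i‖ ^ 2 ≤ d * C ^ 2 := by
    refine (Finset.sum_le_sum fun i _ => pow_le_pow_left₀ (norm_nonneg _) (hgv i) 2).trans ?_
    simp
  have e3 : ‖f‖ ^ 2 ≤ C ^ 2 := pow_le_pow_left₀ (norm_nonneg _) e0 2
  have hd : (0 : ℝ) ≤ d := d.cast_nonneg
  -- There are 2d + 1 squares, each at most C², and 2d + 1 ≤ (2d + 1)².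
  nlinarith [mul_nonneg hd (sq_nonneg C), mul_nonneg (mul_nonneg hd hd) (sq_nonneg C)]

lemma enorm_le_m1Norm (a : L2 d) : ‖a‖ₑ ≤ m1Norm a := by
  refine le_iInf₂ fun f hf => ?_
  rw [← ofReal_norm, hf.norm_eq]
  refine le_iInf fun gx => le_iInf fun gv => le_iInf₂ fun _ _ => ?_
  refine ENNReal.ofReal_le_ofReal (Real.le_sqrt_of_sq_le ?_)
  have hp1 : 0 ≤ ∑ i, ‖gx i‖ ^ 2 := Finset.sum_nonneg fun j _ => sq_nonneg _
  have hp2 : 0 ≤ ∑ i, ‖gv i‖ ^ 2 := Finset.sum_nonneg fun j _ => sq_nonneg _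
  linarith

lemma mem_M1_iff {a : L2 d} : a ∈ M1 d ↔ m1Norm a < ⊤ := by
  simp only [m1Norm, iInf_lt_iff, M1, W12, Set.mem_ofPred_eq]
  exact ⟨fun ⟨f, h1, h2⟩ => ⟨f, h2, h1⟩, fun ⟨f, h1, h2⟩ => ⟨f, h2, h1⟩⟩

lemma exists_reg_of_mem_M1 {a : L2 d} (h : a ∈ M1 d) : ∃ C, Reg C a := by
  rw [mem_M1_iff] at h
  obtain ⟨C, hC⟩ := ENNReal.lt_iff_exists_nnreal_btwn.1 h
  exact ⟨C, .of_m1Norm_lt (by simpa using hC.1)⟩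

/-! ### Moments -/

lemma Reg.lintegral_norm_moment_le {C : ℝ} {a : L2 d} (h : Reg C a) :
    ∫⁻ z : Phase d, (‖z.2‖ₑ * ‖a z‖ₑ) ^ 2 ≤ ENNReal.ofReal ((d + 1) * C) ^ 2 := by
  have hC := h.nonneg
  have e1 : ∀ z : Phase d, (‖z.2‖ₑ * ‖a z‖ₑ) ^ 2 = ∑ i, (‖z.2 i‖ₑ * ‖a z‖ₑ) ^ 2 := by
    intro z
    simp only [mul_pow]
    rw [← Finset.sum_mul]
    congr 1
    simp only [← ofReal_norm]
    simp only [← ENNReal.ofReal_pow (norm_nonneg _)]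
    rw [← ENNReal.ofReal_sum_of_nonneg fun i _ => by positivity, EuclideanSpace.norm_sq_eq]
  simp only [e1]
  rw [lintegral_finsetSum' _ fun i _ => ?_]
  · calc _ ≤ ∑ _i : Fin d, ENNReal.ofReal C ^ 2 := Finset.sum_le_sum fun i _ =>
          h.lintegral_moment_le i
      _ = ENNReal.ofReal (d * C ^ 2) := by
          rw [Finset.sum_const, Finset.card_univ, Fintype.card_fin, nsmul_eq_mul,
            ENNReal.ofReal_mul d.cast_nonneg, ENNReal.ofReal_pow hC, ENNReal.ofReal_natCast]
      _ ≤ _ := by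
          rw [← ENNReal.ofReal_pow (by positivity)]
          apply ENNReal.ofReal_le_ofReal
          have hd : (0 : ℝ) ≤ d := d.cast_nonneg
          nlinarith [mul_nonneg hd (sq_nonneg C), mul_nonneg (mul_nonneg hd hd) (sq_nonneg C)]
  · have : Measurable fun z : Phase d => ‖z.2 i‖ₑ := by fun_prop
    exact (this.aemeasurable.mul (Lp.aestronglyMeasurable a).enorm).pow_const 2

lemma norm_toLp_le_of_lintegral {f : Phase d → ℂ} (hf : MemLp f 2 volume) {C : ℝ} (hC : 0 ≤ C)
    (h : ∫⁻ z, ‖f z‖ₑ ^ 2 ≤ ENNReal.ofReal C ^ 2) : ‖hf.toLp f‖ ≤ C := by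
  have h1 : ‖hf.toLp f‖ₑ ^ 2 ≤ ENNReal.ofReal C ^ 2 := by
    rw [← lintegral_enorm_sq]
    refine le_of_eq_of_le (lintegral_congr_ae ?_) h
    filter_upwards [hf.coeFn_toLp] with z hz
    rw [hz]
  rw [ENNReal.pow_le_pow_left_iff two_ne_zero, ← ofReal_norm,
    ENNReal.ofReal_le_ofReal_iff hC] at h1
  exact h1

lemma Reg.memLp_moment {C : ℝ} {a : L2 d} (h : Reg C a) :
    MemLp (fun z : Phase d => (‖z.2‖ : ℂ) * a z) 2 volume := by
  refine memLp_two_of_lintegral ?_ ?_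
  · have : Measurable fun z : Phase d => (‖z.2‖ : ℂ) := by fun_prop
    exact this.aestronglyMeasurable.mul (Lp.aestronglyMeasurable a)
  · refine lt_of_le_of_lt ?_ (ENNReal.pow_lt_top (ENNReal.ofReal_lt_top (r := (d + 1) * C)) (n := 2))
    refine le_trans (lintegral_mono fun z => ?_) h.lintegral_norm_moment_le
    rw [enorm_mul, ← ofReal_norm, ← ofReal_norm z.2]; simp

/-- The function `|ξ| a`. -/
def Reg.momentLp {C : ℝ} {a : L2 d} (h : Reg C a) : L2 d := h.memLp_moment.toLp _

lemma Reg.momentLp_coe {C : ℝ} {a : L2 d} (h : Reg C a) :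
    h.momentLp =ᵐ[volume] fun z : Phase d => (‖z.2‖ : ℂ) * a z := h.memLp_moment.coeFn_toLp

lemma Reg.norm_momentLp_le {C : ℝ} {a : L2 d} (h : Reg C a) : ‖h.momentLp‖ ≤ (d + 1) * C := by
  have hC := h.nonneg
  refine norm_toLp_le_of_lintegral _ (by positivity) ?_
  refine le_trans (lintegral_mono fun z => ?_) h.lintegral_norm_moment_le
  rw [enorm_mul, ← ofReal_norm, ← ofReal_norm z.2]; simp

lemma integrable_norm_mul_norm (a b : L2 d) : Integrable (fun z => ‖a z‖ * ‖b z‖) :=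
  (Lp.memLp a).norm.integrable_mul (Lp.memLp b).norm

lemma integral_norm_mul_norm_le (a b : L2 d) : ∫ z, ‖a z‖ * ‖b z‖ ≤ ‖a‖ * ‖b‖ := by
  let a' : Lp ℝ 2 (volume : Measure (Phase d)) := (Lp.memLp a).norm.toLp _
  let b' : Lp ℝ 2 (volume : Measure (Phase d)) := (Lp.memLp b).norm.toLp _
  have e1 : inner ℝ b' a' = ∫ z, ‖a z‖ * ‖b z‖ := by
    rw [L2.inner_def]
    refine integral_congr_ae ?_
    filter_upwards [(Lp.memLp a).norm.coeFn_toLp, (Lp.memLp b).norm.coeFn_toLp] with z h1 h2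
    rw [h1, h2]; simp
  have e2 : ‖a'‖ = ‖a‖ := by rw [Lp.norm_toLp, eLpNorm_norm]; rfl
  have e3 : ‖b'‖ = ‖b‖ := by rw [Lp.norm_toLp, eLpNorm_norm]; rfl
  rw [← e1, ← e2, ← e3, mul_comm]
  exact (real_inner_le_norm _ _)

lemma Reg.integrable_moment {C : ℝ} {a : L2 d} (h : Reg C a) (b : L2 d) :
    Integrable (fun z : Phase d => ‖z.2‖ * ‖a z‖ * ‖b z‖) := by
  refine (integrable_norm_mul_norm h.momentLp b).congr ?_
  filter_upwards [h.momentLp_coe] with z hz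
  rw [hz, norm_mul]; simp

lemma Reg.integral_moment_le {C : ℝ} {a : L2 d} (h : Reg C a) (b : L2 d) :
    ∫ z : Phase d, ‖z.2‖ * ‖a z‖ * ‖b z‖ ≤ (d + 1) * C * ‖b‖ := by
  calc _ = ∫ z : Phase d, ‖h.momentLp z‖ * ‖b z‖ := by
        refine integral_congr_ae ?_
        filter_upwards [h.momentLp_coe] with z hz
        rw [hz, norm_mul]; simp
    _ ≤ _ := integral_norm_mul_norm_le _ _
    _ ≤ _ := by gcongr; exact h.norm_momentLp_le

lemma integrable_norm_sq (a : L2 d) : Integrable (fun z => ‖a z‖ ^ 2) := by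
  simpa [sq] using integrable_norm_mul_norm a a

lemma integral_norm_sq_le (a : L2 d) : ∫ z, ‖a z‖ ^ 2 ≤ ‖a‖ ^ 2 := by
  simpa [sq] using integral_norm_mul_norm_le a a

/-! ### The mean field -/

lemma IsPotential.exists_bound {Γ : Space d → ℝ} (h : IsPotential Γ) : ∃ K : ℝ, 0 ≤ K ∧
    (∀ x, ‖gradient Γ x‖ ≤ K) ∧ ∀ x y, ‖gradient Γ x - gradient Γ y‖ ≤ K * ‖x - y‖ := by
  obtain ⟨-, h1, K, hK⟩ := h
  have e1 : ∀ x, ‖fderiv ℝ Γ x‖ ≤ K := fun x => by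
    rw [← norm_iteratedFDeriv_one]; exact hK 1 (by simp) x
  have e2 : ∀ x, ‖fderiv ℝ (fderiv ℝ Γ) x‖ ≤ K := fun x => by
    rw [← norm_iteratedFDeriv_one, norm_iteratedFDeriv_fderiv]; exact hK 2 (by simp) x
  have e3 : Differentiable ℝ (fderiv ℝ Γ) :=
    (h1.fderiv_right (m := 2) (by norm_num)).differentiable (by norm_num)
  refine ⟨K, (norm_nonneg _).trans (e1 0), fun x => ?_, fun x y => ?_⟩
  · rw [gradient, LinearIsometryEquiv.norm_map]; exact e1 x
  · rw [gradient, gradient, ← map_sub, LinearIsometryEquiv.norm_map]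
    exact Convex.norm_image_sub_le_of_norm_fderiv_le (fun x _ => e3 x) (fun x _ => e2 x)
      convex_univ (mem_univ y) (mem_univ x)

/-- The gradient of `Γ` is bounded and Lipschitz with constant `K`. -/
structure GradBound (Γ : Space d → ℝ) (K : ℝ) : Prop where
  nonneg : 0 ≤ K
  bound : ∀ x, ‖gradient Γ x‖ ≤ K
  lip : ∀ x y, ‖gradient Γ x - gradient Γ y‖ ≤ K * ‖x - y‖

namespace GradBound

variable {Γ : Space d → ℝ} {K : ℝ}

lemma continuous (h : GradBound Γ K) : Continuous (gradient Γ) :=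
  (LipschitzWith.of_dist_le_mul (K := ⟨K, h.nonneg⟩) fun x y => by
    rw [dist_eq_norm, dist_eq_norm]; exact h.lip x y).continuous

lemma continuous_pair (h : GradBound Γ K) : Continuous (pairPotential Γ) := by
  unfold pairPotential
  exact ((h.continuous.comp continuous_fst).inner continuous_snd).neg

lemma abs_pair_le (h : GradBound Γ K) (z w : Phase d) :
    |pairPotential Γ (z - w)| ≤ K * (‖z.2‖ + ‖w.2‖) := by
  rw [pairPotential, abs_neg]
  calc _ ≤ ‖gradient Γ (z - w).1‖ * ‖(z - w).2‖ := abs_real_inner_le_norm _ _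
    _ ≤ K * (‖z.2‖ + ‖w.2‖) := by
      gcongr
      · exact h.nonneg
      · exact h.bound _
      · exact norm_sub_le _ _

lemma abs_pair_sub_le (h : GradBound Γ K) (y : Space d) (z w : Phase d) :
    |pairPotential Γ (z + (y, 0) - w) - pairPotential Γ (z - w)|
      ≤ K * ‖y‖ * (‖z.2‖ + ‖w.2‖) := by
  have e : pairPotential Γ (z + (y, 0) - w) - pairPotential Γ (z - w)
      = - inner ℝ (gradient Γ (z.1 + y - w.1) - gradient Γ (z.1 - w.1)) (z.2 - w.2) := by
    simp [pairPotential, inner_sub_left]; ring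
  rw [e, abs_neg]
  calc _ ≤ ‖gradient Γ (z.1 + y - w.1) - gradient Γ (z.1 - w.1)‖ * ‖z.2 - w.2‖ :=
        abs_real_inner_le_norm _ _
    _ ≤ K * ‖y‖ * (‖z.2‖ + ‖w.2‖) := by
      have h1 := h.lip (z.1 + y - w.1) (z.1 - w.1)
      rw [show z.1 + y - w.1 - (z.1 - w.1) = y by abel] at h1
      have := h.nonneg
      gcongr
      exact norm_sub_le _ _

lemma integrable (h : GradBound Γ K) {C : ℝ} {a : L2 d} (ha : Reg C a) (z : Phase d) :
    Integrable fun w => pairPotential Γ (z - w) * ‖a w‖ ^ 2 := by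
  have h1 : Integrable fun w : Phase d => K * (‖z.2‖ * ‖a w‖ ^ 2 + ‖w.2‖ * ‖a w‖ * ‖a w‖) :=
    (((integrable_norm_sq a).const_mul _).add (ha.integrable_moment a)).const_mul K
  refine h1.mono' ?_ (.of_forall fun w => ?_)
  · exact (h.continuous_pair.comp (by fun_prop)).aestronglyMeasurable.mul
      (integrable_norm_sq a).aestronglyMeasurable
  · rw [norm_mul, Real.norm_eq_abs, Real.norm_eq_abs, abs_of_nonneg (sq_nonneg ‖a w‖)]
    calc _ ≤ K * (‖z.2‖ + ‖w.2‖) * ‖a w‖ ^ 2 := by gcongr; exact h.abs_pair_le z w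
      _ = _ := by ring

lemma measurable_meanField (h : GradBound Γ K) (a : L2 d) : Measurable (meanField Γ a) := by
  unfold meanField
  refine (StronglyMeasurable.integral_prod_right (ν := (volume : Measure (Phase d)))
    (f := fun z w : Phase d => pairPotential Γ (z - w) * ‖a w‖ ^ 2) ?_).measurable
  have h1 : StronglyMeasurable fun p : Phase d × Phase d => pairPotential Γ (p.1 - p.2) :=
    (h.continuous_pair.comp (by fun_prop)).stronglyMeasurable
  exact h1.mul (((Lp.stronglyMeasurable a).comp_measurable measurable_snd).norm.pow 2)

/-- The bound |V̂(z - w)| ≤ K(|ξ| + |ξ'|) is integrated against |a|²; the part in ξ' costs one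
moment of a. -/
lemma abs_meanField_le (h : GradBound Γ K) {C : ℝ} {a : L2 d} (ha : Reg C a) (z : Phase d) :
    |meanField Γ a z| ≤ K * (d + 1) * C ^ 2 * (1 + ‖z.2‖) := by
  have hC := ha.nonneg
  have h0 := h.nonneg
  have h1 : Integrable fun w : Phase d => K * (‖z.2‖ * ‖a w‖ ^ 2 + ‖w.2‖ * ‖a w‖ * ‖a w‖) :=
    (((integrable_norm_sq a).const_mul _).add (ha.integrable_moment a)).const_mul K
  have h2 : |meanField Γ a z| ≤ ∫ w, K * (‖z.2‖ * ‖a w‖ ^ 2 + ‖w.2‖ * ‖a w‖ * ‖a w‖) := by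
    rw [← Real.norm_eq_abs]
    refine norm_integral_le_of_norm_le h1 (.of_forall fun w => ?_)
    rw [norm_mul, Real.norm_eq_abs, Real.norm_eq_abs, abs_of_nonneg (sq_nonneg ‖a w‖)]
    calc _ ≤ K * (‖z.2‖ + ‖w.2‖) * ‖a w‖ ^ 2 := by gcongr; exact h.abs_pair_le z w
      _ = _ := by ring
  rw [integral_const_mul, integral_add ((integrable_norm_sq a).const_mul _)
    (ha.integrable_moment a), integral_const_mul] at h2
  refine h2.trans ?_
  have h3 := ha.norm_le
  calc _ ≤ K * (‖z.2‖ * ‖a‖ ^ 2 + (d + 1) * C * ‖a‖) := by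
        gcongr
        · exact integral_norm_sq_le a
        · exact ha.integral_moment_le a
    _ ≤ K * (‖z.2‖ * C ^ 2 + (d + 1) * C * C) := by gcongr
    -- The factor d + 1 is inserted in the first summand only to pull out 1 + |ξ|.
    _ ≤ K * ((d + 1) * (‖z.2‖ * C ^ 2) + (d + 1) * C * C) := by
        have : (0 : ℝ) ≤ d * (‖z.2‖ * C ^ 2) := by positivity
        refine mul_le_mul_of_nonneg_left ?_ h0
        linarith
    _ = _ := by ring

/-- The Lipschitz bound for ∇Γ produces ‖y‖. The coefficient of |ξ| involves ‖a‖ alone, while C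
appears, linearly, only in the term without ξ; the global bounds rest on this separation. -/
lemma abs_meanField_shift_le (h : GradBound Γ K) {C : ℝ} {a : L2 d} (ha : Reg C a)
    (y : Space d) (z : Phase d) : |meanField Γ a (z + (y, 0)) - meanField Γ a z|
      ≤ ‖y‖ * (K * ‖a‖ ^ 2 * ‖z.2‖ + K * (d + 1) * C * ‖a‖) := by
  have h0 := h.nonneg
  have h1 : Integrable fun w : Phase d =>
      K * ‖y‖ * (‖z.2‖ * ‖a w‖ ^ 2 + ‖w.2‖ * ‖a w‖ * ‖a w‖) :=
    (((integrable_norm_sq a).const_mul _).add (ha.integrable_moment a)).const_mul _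
  have h2 : |meanField Γ a (z + (y, 0)) - meanField Γ a z|
      ≤ ∫ w, K * ‖y‖ * (‖z.2‖ * ‖a w‖ ^ 2 + ‖w.2‖ * ‖a w‖ * ‖a w‖) := by
    unfold meanField
    rw [← integral_sub (h.integrable ha _) (h.integrable ha _)]
    rw [← Real.norm_eq_abs]
    refine norm_integral_le_of_norm_le h1 (.of_forall fun w => ?_)
    rw [← sub_mul, norm_mul, Real.norm_eq_abs, Real.norm_eq_abs, abs_of_nonneg (sq_nonneg ‖a w‖)]
    calc _ ≤ K * ‖y‖ * (‖z.2‖ + ‖w.2‖) * ‖a w‖ ^ 2 := by gcongr; exact h.abs_pair_sub_le y z w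
      _ = _ := by ring
  rw [integral_const_mul, integral_add ((integrable_norm_sq a).const_mul _)
    (ha.integrable_moment a), integral_const_mul] at h2
  refine h2.trans ?_
  calc _ ≤ K * ‖y‖ * (‖z.2‖ * ‖a‖ ^ 2 + (d + 1) * C * ‖a‖) := by
        gcongr
        · exact integral_norm_sq_le a
        · exact ha.integral_moment_le a
    _ = _ := by ring

/-- From ||a|² - |b|²| ≤ (|a| + |b|)|a - b|, the weight |ξ'| is placed on a and b, so that only the
L² norm of the difference is needed. -/
lemma abs_meanField_sub_le (h : GradBound Γ K) {C : ℝ} {a b : L2 d} (ha : Reg C a)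
    (hb : Reg C b) (z : Phase d) : |meanField Γ a z - meanField Γ b z|
      ≤ 2 * K * (d + 1) * C * ‖a - b‖ * (1 + ‖z.2‖) := by
  have hC := ha.nonneg
  have h0 := h.nonneg
  have i1 := (integrable_norm_mul_norm a (a - b)).add (integrable_norm_mul_norm b (a - b))
  have i2 := (ha.integrable_moment (a - b)).add (hb.integrable_moment (a - b))
  have h1 := ((i1.const_mul ‖z.2‖).add i2).const_mul K
  have h2 : |meanField Γ a z - meanField Γ b z|
      ≤ ∫ w, K * (‖z.2‖ * (‖a w‖ * ‖(a - b) w‖ + ‖b w‖ * ‖(a - b) w‖)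
        + (‖w.2‖ * ‖a w‖ * ‖(a - b) w‖ + ‖w.2‖ * ‖b w‖ * ‖(a - b) w‖)) := by
    unfold meanField
    rw [← integral_sub (h.integrable ha _) (h.integrable hb _)]
    rw [← Real.norm_eq_abs]
    refine norm_integral_le_of_norm_le h1 ?_
    filter_upwards [Lp.coeFn_sub a b] with w hw
    rw [← mul_sub, norm_mul, Real.norm_eq_abs, Real.norm_eq_abs]
    have e1 : |‖a w‖ ^ 2 - ‖b w‖ ^ 2| ≤ (‖a w‖ + ‖b w‖) * ‖(a - b) w‖ := by
      rw [sq_sub_sq, abs_mul, abs_of_nonneg (by positivity), hw, Pi.sub_apply]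
      gcongr
      exact abs_norm_sub_norm_le _ _
    calc _ ≤ K * (‖z.2‖ + ‖w.2‖) * ((‖a w‖ + ‖b w‖) * ‖(a - b) w‖) := by
          gcongr
          exact h.abs_pair_le z w
      _ = _ := by ring
  rw [integral_const_mul] at h2
  erw [integral_add (i1.const_mul ‖z.2‖) i2] at h2
  rw [integral_const_mul] at h2
  erw [integral_add (integrable_norm_mul_norm a (a - b)) (integrable_norm_mul_norm b (a - b)),
    integral_add (ha.integrable_moment (a - b)) (hb.integrable_moment (a - b))] at h2
  refine h2.trans ?_
  have h3 := ha.norm_le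
  have h4 := hb.norm_le
  calc _ ≤ K * (‖z.2‖ * (‖a‖ * ‖a - b‖ + ‖b‖ * ‖a - b‖)
        + ((d + 1) * C * ‖a - b‖ + (d + 1) * C * ‖a - b‖)) := by
        gcongr
        · exact integral_norm_mul_norm_le _ _
        · exact integral_norm_mul_norm_le _ _
        · exact ha.integral_moment_le _
        · exact hb.integral_moment_le _
    _ ≤ K * (‖z.2‖ * (C * ‖a - b‖ + C * ‖a - b‖)
        + ((d + 1) * C * ‖a - b‖ + (d + 1) * C * ‖a - b‖)) := by gcongr
    _ ≤ K * (‖z.2‖ * (C * ‖a - b‖ + C * ‖a - b‖)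
        + ((d + 1) * C * ‖a - b‖ + (d + 1) * C * ‖a - b‖))
        + K * (‖z.2‖ * (d * (C * ‖a - b‖ + C * ‖a - b‖))) :=
          le_add_of_nonneg_right (by positivity)
    _ = _ := by ring

end GradBound

/-! ### Multiplication by potentials of linear growth -/

/-- The product `V a`, if it is square integrable. -/
def potMul (V : Phase d → ℝ) (a : L2 d) : L2 d :=
  open scoped Classical in
  if h : MemLp (fun z => (V z : ℂ) * a z) 2 volume then h.toLp _ else 0

section potMul

variable {V : Phase d → ℝ} {M C : ℝ} {a : L2 d}

lemma memLp_potMul (hV : Measurable V) (hM : ∀ z, |V z| ≤ M * (1 + ‖z.2‖)) (ha : Reg C a) :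
    MemLp (fun z => (V z : ℂ) * a z) 2 volume := by
  have h1 : MemLp (fun z => (M : ℂ) * (a z + (‖z.2‖ : ℂ) * a z)) 2 volume :=
    ((Lp.memLp a).add ha.memLp_moment).const_mul _
  refine h1.of_le ((Complex.measurable_ofReal.comp hV).aestronglyMeasurable.mul
    (Lp.aestronglyMeasurable a)) (.of_forall fun z => ?_)
  rw [← one_add_mul, ← mul_assoc, norm_mul, norm_mul, Complex.norm_real]
  gcongr
  rw [← Complex.ofReal_one, ← Complex.ofReal_add, ← Complex.ofReal_mul, Complex.norm_real]
  exact (hM z).trans (le_abs_self _)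

lemma potMul_coe (hV : Measurable V) (hM : ∀ z, |V z| ≤ M * (1 + ‖z.2‖)) (ha : Reg C a) :
    potMul V a =ᵐ[volume] fun z => (V z : ℂ) * a z := by
  rw [potMul, dif_pos (memLp_potMul hV hM ha)]
  exact (memLp_potMul hV hM ha).coeFn_toLp

lemma norm_potMul_le (hV : Measurable V) (hM0 : 0 ≤ M) (hM : ∀ z, |V z| ≤ M * (1 + ‖z.2‖))
    (ha : Reg C a) : ‖potMul V a‖ ≤ M * ((d + 2) * C) := by
  have h1 : ‖potMul V a‖ ≤ ‖(M : ℂ) • (a + ha.momentLp)‖ := by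
    refine Lp.norm_le_norm_of_ae_le ?_
    filter_upwards [potMul_coe hV hM ha, Lp.coeFn_smul (M : ℂ) (a + ha.momentLp),
      Lp.coeFn_add a ha.momentLp, ha.momentLp_coe] with z h1 h2 h3 h4
    rw [h1, h2, Pi.smul_apply, h3, Pi.add_apply, h4, smul_eq_mul, ← one_add_mul, ← mul_assoc,
      norm_mul, norm_mul, Complex.norm_real]
    gcongr
    rw [← Complex.ofReal_one, ← Complex.ofReal_add, ← Complex.ofReal_mul, Complex.norm_real]
    exact (hM z).trans (le_abs_self _)
  refine h1.trans ?_
  rw [norm_smul, Complex.norm_real, Real.norm_eq_abs, abs_of_nonneg hM0]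
  gcongr
  calc _ ≤ ‖a‖ + ‖ha.momentLp‖ := norm_add_le _ _
    _ ≤ C + (d + 1) * C := add_le_add ha.norm_le ha.norm_momentLp_le
    _ = _ := by ring

/-- A real potential does not contribute to the L² energy. -/
lemma inner_potMul_self (hV : Measurable V) (hM : ∀ z, |V z| ≤ M * (1 + ‖z.2‖)) (ha : Reg C a) :
    (inner ℂ a (potMul V a)).im = 0 := by
  have h1 : inner ℂ a (potMul V a) = ((∫ z, V z * ‖a z‖ ^ 2 : ℝ) : ℂ) := by
    rw [inner_eq_integral, ← integral_complex_ofReal]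
    refine integral_congr_ae ?_
    filter_upwards [potMul_coe hV hM ha] with z hz
    rw [hz, mul_assoc, Complex.mul_conj']
    push_cast; rfl
  rw [h1, Complex.ofReal_im]

end potMul

lemma Reg.sub {C C' : ℝ} {a b : L2 d} (ha : Reg C a) (hb : Reg C' b) : Reg (C + C') (a - b) := by
  refine ⟨(norm_sub_le _ _).trans (add_le_add ha.norm_le hb.norm_le), fun i t => ?_,
    fun i R hR => ?_⟩
  · rw [map_sub, show transl (t • dirX i) a - transl (t • dirX i) b - (a - b)
      = (transl (t • dirX i) a - a) - (transl (t • dirX i) b - b) by abel, add_mul]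
    exact (norm_sub_le _ _).trans (add_le_add (ha.shift i t) (hb.shift i t))
  · rw [map_sub]
    exact (norm_sub_le _ _).trans (add_le_add (ha.moment i R hR) (hb.moment i R hR))

lemma Reg.mono {C C' : ℝ} {a : L2 d} (ha : Reg C a) (h : C ≤ C') : Reg C' a :=
  ⟨ha.norm_le.trans h, fun i t => (ha.shift i t).trans (by gcongr),
    fun i R hR => (ha.moment i R hR).trans h⟩

lemma Reg.add {C C' : ℝ} {a b : L2 d} (ha : Reg C a) (hb : Reg C' b) : Reg (C + C') (a + b) := by
  refine ⟨(norm_add_le _ _).trans (add_le_add ha.norm_le hb.norm_le), fun i t => ?_,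
    fun i R hR => ?_⟩
  · rw [map_add, show transl (t • dirX i) a + transl (t • dirX i) b - (a + b)
      = (transl (t • dirX i) a - a) + (transl (t • dirX i) b - b) by abel, add_mul]
    exact (norm_add_le _ _).trans (add_le_add (ha.shift i t) (hb.shift i t))
  · rw [map_add]
    exact (norm_add_le _ _).trans (add_le_add (ha.moment i R hR) (hb.moment i R hR))

instance instIsNegInvariantPhase : (volume : Measure (Phase d)).IsNegInvariant where
  neg_eq_self := ((Measure.measurePreserving_neg (volume : Measure (Space d))).prod
    (Measure.measurePreserving_neg (volume : Measure (Space d)))).map_eq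

/-! ### Mollification -/

lemma integrable_smul_transl {χ : Phase d → ℂ} (h : IsTest χ) (a : L2 d) :
    Integrable fun y => χ y • transl (-y) a :=
  (h.continuous.smul (continuous_transl continuous_neg continuous_const)).integrable_of_hasCompactSupport
    h.2.smul_right

/-- Convolution with a test function, as an operator on `L²`. -/
def moll (χ : Phase d → ℂ) (h : IsTest χ) : L2 d →L[ℂ] L2 d :=
  LinearMap.mkContinuous
    { toFun := fun a => ∫ y, χ y • transl (-y) a
      map_add' := fun a b => by
        rw [← integral_add (integrable_smul_transl h a) (integrable_smul_transl h b)]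
        simp only [map_add, smul_add]
      map_smul' := fun c a => by
        simp only [map_smul, RingHom.id_apply]
        rw [← integral_smul]
        simp only [smul_comm c] }
    (∫ y, ‖χ y‖) (fun a => by
      refine (norm_integral_le_integral_norm _).trans (le_of_eq ?_)
      simp only [norm_smul, norm_transl]
      rw [integral_mul_const])

lemma moll_apply {χ : Phase d → ℂ} (h : IsTest χ) (a : L2 d) :
    moll χ h a = ∫ y, χ y • transl (-y) a := rfl

lemma inner_moll_right {χ : Phase d → ℂ} (h : IsTest χ) (a b : L2 d) :
    inner ℂ b (moll χ h a) = ∫ y, χ y * inner ℂ b (transl (-y) a) := by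
  rw [moll_apply, ← integral_inner (integrable_smul_transl h a)]
  simp only [inner_smul_right]

/-- The adjoint of convolution with χ is convolution with the conjugate of χ(-·), here χ itself; the
proof substitutes y ↦ -y. -/
lemma inner_moll_left {χ : Phase d → ℂ} (h : IsTest χ)
    (hs : ∀ y, starRingEnd ℂ (χ (-y)) = χ y) (a b : L2 d) :
    inner ℂ (moll χ h a) b = inner ℂ a (moll χ h b) := by
  rw [← inner_conj_symm, inner_moll_right, inner_moll_right, ← integral_conj,
    ← integral_neg_eq_self]
  refine integral_congr_ae (.of_forall fun y => ?_)
  simp only [map_mul, inner_conj_symm, neg_neg]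
  rw [hs, inner_transl_left]

lemma moll_transl {χ : Phase d → ℂ} (h : IsTest χ) (y : Phase d) (a : L2 d) :
    moll χ h (transl y a) = transl y (moll χ h a) := by
  rw [moll_apply, moll_apply, ← LinearIsometry.coe_toContinuousLinearMap,
    ← ContinuousLinearMap.integral_comp_comm _ (integrable_smul_transl h a)]
  refine integral_congr_ae (.of_forall fun t => ?_)
  simp only [LinearIsometry.coe_toContinuousLinearMap, map_smul]
  rw [transl_comm]

/-- Convolution is an average of translations, and it commutes with each translation. -/
lemma moll_comm {χ η : Phase d → ℂ} (h : IsTest χ) (h' : IsTest η) (a : L2 d) :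
    moll χ h (moll η h' a) = moll η h' (moll χ h a) := by
  rw [moll_apply h' a, ← ContinuousLinearMap.integral_comp_comm _ (integrable_smul_transl h' a),
    moll_apply h']
  refine integral_congr_ae (.of_forall fun t => ?_)
  simp only [map_smul]
  rw [moll_transl]

/-- Convolution of test functions. -/
def conv (χ φ : Phase d → ℂ) (z : Phase d) : ℂ := ∫ t, χ t * φ (z - t)

lemma conv_eq (χ φ : Phase d → ℂ) :
    conv χ φ = convolution φ χ (ContinuousLinearMap.mul ℝ ℂ) volume := by
  have h : (ContinuousLinearMap.mul ℝ ℂ).flip = ContinuousLinearMap.mul ℝ ℂ := by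
    ext x; simp
  rw [← h, convolution_flip]; rfl

lemma IsTest.conv {χ φ : Phase d → ℂ} (h : IsTest χ) (h' : IsTest φ) : IsTest (conv χ φ) := by
  rw [conv_eq]
  exact ⟨h.2.contDiff_convolution_right _ h'.continuous.locallyIntegrable h.1,
    h'.2.convolution _ h.2⟩

lemma fderiv_conv {χ φ : Phase d → ℂ} (h : IsTest χ) (h' : IsTest φ) (z w : Phase d) :
    _root_.fderiv ℝ (HamiltonHartree.conv χ φ) z w
      = HamiltonHartree.conv (fun y => _root_.fderiv ℝ χ y w) φ z := by
  have hL : LocallyIntegrable φ (volume : Measure (Phase d)) := h'.continuous.locallyIntegrable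
  rw [conv_eq, conv_eq, (h.2.hasFDerivAt_convolution_right (ContinuousLinearMap.mul ℝ ℂ)
    hL (h.1.of_le (by simp)) z).fderiv]
  exact convolution_precompR_apply _ hL (h.2.fderiv ℝ) (h.1.continuous_fderiv (by simp)) z w

lemma kinetic_conv {χ φ : Phase d → ℂ} (h : IsTest χ) (h' : IsTest φ) (z : Phase d) :
    kinetic (HamiltonHartree.conv χ φ) z = HamiltonHartree.conv (kinetic χ) φ z := by
  have e1 : ∀ i, _root_.fderiv ℝ (fun w => _root_.fderiv ℝ (HamiltonHartree.conv χ φ) w (dirV i)) z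
      (dirX i) = HamiltonHartree.conv (fun y => _root_.fderiv ℝ
        (fun w => _root_.fderiv ℝ χ w (dirV i)) y (dirX i)) φ z := by
    intro i
    simp only [fderiv_conv h h']
    rw [fderiv_conv (h.fderiv (dirV i)) h']
  unfold kinetic
  simp only [e1]
  unfold HamiltonHartree.conv
  rw [← integral_finsetSum]
  · simp only [Finset.sum_mul]
  · intro i _
    have h2 := ((h.fderiv (dirV i)).fderiv (dirX i))
    exact (h2.continuous.mul (h'.continuous.comp (by fun_prop))).integrable_of_hasCompactSupport
      h2.2.mul_right

/-- Fubini identifies the L²-valued average with pointwise convolution, so mollified test functions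
are again test functions. -/
lemma moll_testLp {χ φ : Phase d → ℂ} (h : IsTest χ) (h' : IsTest φ) :
    moll χ h (testLp φ h') = testLp _ (h.conv h') := by
  refine eq_of_dense dense_testLp ?_
  rintro _ ⟨ψ, hψ, rfl⟩
  have e1 : ∀ y, χ y * inner ℂ (testLp ψ hψ) (transl (-y) (testLp φ h'))
      = ∫ z, χ y * φ (z - y) * starRingEnd ℂ (ψ z) := by
    intro y
    rw [transl_testLp, inner_testLp, ← integral_const_mul]
    refine integral_congr_ae ?_
    filter_upwards [testLp_coe (h'.shift (-y))] with z hz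
    rw [hz, ← sub_eq_add_neg, mul_assoc]
  have e2 : inner ℂ (testLp ψ hψ) (testLp _ (h.conv h'))
      = ∫ z, ∫ y, χ y * φ (z - y) * starRingEnd ℂ (ψ z) := by
    rw [inner_testLp]
    refine integral_congr_ae ?_
    filter_upwards [testLp_coe (h.conv h')] with z hz
    rw [hz, integral_mul_const]; rfl
  rw [inner_moll_right, e2]
  simp only [e1]
  refine integral_integral_swap ?_
  have hc : Continuous fun p : Phase d × Phase d =>
      χ p.1 * φ (p.2 - p.1) * starRingEnd ℂ (ψ p.2) :=
    ((h.continuous.comp continuous_fst).mul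
      (h'.continuous.comp (continuous_snd.sub continuous_fst))).mul
      (hψ.conj.continuous.comp continuous_snd)
  refine hc.integrable_of_hasCompactSupport ?_
  refine HasCompactSupport.intro (h.2.isCompact.prod hψ.2.isCompact) fun p hp => ?_
  rw [Set.mem_prod, not_and_or] at hp
  rcases hp with hp | hp
  · rw [image_eq_zero_of_notMem_tsupport hp]; simp
  · rw [image_eq_zero_of_notMem_tsupport hp]; simp

lemma fderiv_even {χ : Phase d → ℂ} (h : IsTest χ) (he : ∀ y, χ (-y) = χ y) (y w : Phase d) :
    _root_.fderiv ℝ χ (-y) w = - _root_.fderiv ℝ χ y w := by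
  have h1 : HasFDerivAt χ (_root_.fderiv ℝ χ (-y)) (-y) :=
    (h.1.differentiable (by simp) _).hasFDerivAt
  have h2 : HasFDerivAt (fun z => χ (-z)) _ y := h1.comp y (hasFDerivAt_id y).neg
  simp only [he] at h2
  rw [h2.fderiv]; simp

lemma fderiv_odd {χ : Phase d → ℂ} (h : IsTest χ) (he : ∀ y, χ (-y) = - χ y) (y w : Phase d) :
    _root_.fderiv ℝ χ (-y) w = _root_.fderiv ℝ χ y w := by
  have h1 : HasFDerivAt χ (_root_.fderiv ℝ χ (-y)) (-y) :=
    (h.1.differentiable (by simp) _).hasFDerivAt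
  have h2 : HasFDerivAt (fun z => - χ (-z)) _ y := (h1.comp y (hasFDerivAt_id y).neg).neg
  simp only [he, neg_neg] at h2
  rw [h2.fderiv]; simp

lemma kinetic_even {χ : Phase d → ℂ} (h : IsTest χ) (he : ∀ y, χ (-y) = χ y) (y : Phase d) :
    kinetic χ (-y) = kinetic χ y := by
  unfold kinetic
  refine Finset.sum_congr rfl fun i _ => ?_
  exact fderiv_odd (h.fderiv _) (fun y => fderiv_even h he y _) y _

/-- A smooth, even, nonnegative kernel of integral one supported in the ball of radius `r`. -/
structure IsKernel (r : ℝ) (χ : Phase d → ℂ) : Prop where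
  test : IsTest χ
  herm : ∀ y, starRingEnd ℂ (χ y) = χ y
  even : ∀ y, χ (-y) = χ y
  norm_integral : ∫ y, ‖χ y‖ = 1
  integral : ∫ y, χ y = 1
  supp : ∀ y, χ y ≠ 0 → ‖y‖ < r

lemma exists_isKernel {r : ℝ} (hr : 0 < r) : ∃ χ : Phase d → ℂ, IsKernel r χ := by
  let b : ContDiffBump (0 : Phase d) := ⟨r / 2, r, by positivity, by linarith⟩
  refine ⟨fun y => (b.normed volume y : ℂ), ⟨?_, ?_⟩, fun y => Complex.conj_ofReal _,
    fun y => by rw [b.normed_neg], ?_, ?_, ?_⟩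
  · exact Complex.ofRealCLM.contDiff.comp b.contDiff_normed
  · exact b.hasCompactSupport_normed.comp_left (g := ((↑) : ℝ → ℂ)) Complex.ofReal_zero
  · simp only [Complex.norm_real, Real.norm_eq_abs, abs_of_nonneg (b.nonneg_normed _)]
    exact b.integral_normed
  · rw [integral_complex_ofReal, b.integral_normed]; simp
  · intro y hy
    have h1 : y ∈ Function.support (b.normed volume) := by
      intro h; apply hy; simp [h]
    rw [b.support_normed_eq] at h1
    simpa using h1

namespace IsKernel

variable {r : ℝ} {χ : Phase d → ℂ}

lemma norm_moll_le (h : IsKernel r χ) (a : L2 d) : ‖moll χ h.test a‖ ≤ ‖a‖ := by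
  have := (moll χ h.test).le_of_opNorm_le (LinearMap.mkContinuous_norm_le _
    (integral_nonneg fun y => norm_nonneg _) _) a
  rwa [h.norm_integral, one_mul] at this

lemma norm_moll_sub_le (h : IsKernel r χ) {a : L2 d} {δ : ℝ}
    (hδ : ∀ y, ‖y‖ < r → ‖transl (-y) a - a‖ ≤ δ) : ‖moll χ h.test a - a‖ ≤ δ := by
  have i1 : Integrable fun y => χ y • a :=
    (h.test.continuous.integrable_of_hasCompactSupport h.test.2).smul_const a
  have e1 : moll χ h.test a - a = ∫ y, χ y • (transl (-y) a - a) := by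
    simp only [smul_sub]
    rw [integral_sub (integrable_smul_transl h.test a) i1, integral_smul_const, h.integral,
      one_smul, moll_apply]
  have i2 : Integrable fun y => ‖χ y‖ * δ :=
    (h.test.continuous.integrable_of_hasCompactSupport h.test.2).norm.mul_const δ
  rw [e1]
  refine (norm_integral_le_of_norm_le i2 (.of_forall fun y => ?_)).trans (le_of_eq ?_)
  · rw [norm_smul]
    by_cases hy : χ y = 0
    · simp [hy]
    · exact mul_le_mul_of_nonneg_left (hδ y (h.supp y hy)) (norm_nonneg _)
  · rw [integral_mul_const, h.norm_integral, one_mul]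

lemma inner_moll (h : IsKernel r χ) (a b : L2 d) :
    inner ℂ (moll χ h.test a) b = inner ℂ a (moll χ h.test b) :=
  inner_moll_left h.test (fun y => by rw [h.herm, h.even]) a b

lemma inner_moll_kinetic (h : IsKernel r χ) (a b : L2 d) :
    inner ℂ (moll _ h.test.kinetic a) b = inner ℂ a (moll _ h.test.kinetic b) := by
  refine inner_moll_left _ (fun y => ?_) a b
  rw [kinetic_even h.test h.even, ← kinetic_conj h.test]
  simp only [h.herm]

/-- Convolutions with χ and with `kinetic χ` are commuting symmetric operators, so their product is
symmetric. Thus the kinetic term drops out of the mollified energy identity. -/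
lemma im_inner_kinetic (h : IsKernel r χ) (a : L2 d) :
    (inner ℂ (moll χ h.test a) (moll _ h.test.kinetic a)).im = 0 := by
  rw [← Complex.conj_eq_iff_im, inner_conj_symm, h.inner_moll_kinetic, moll_comm, h.inner_moll]

end IsKernel

/-- Joint continuity of translations and compactness of [0, T] give one mollification scale for all
times. -/
lemma exists_uniform_moll {w : ℝ → L2 d} {T : ℝ} (hw : ContinuousOn w (Icc 0 T)) {η : ℝ}
    (hη : 0 < η) : ∃ r > 0, ∀ t ∈ Icc 0 T, ∀ y : Phase d, ‖y‖ < r →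
      ‖transl (-y) (w t) - w t‖ ≤ η := by
  rcases lt_or_ge T 0 with hT | hT
  · exact ⟨1, one_pos, fun t ht => absurd (ht.1.trans ht.2) (not_le.2 hT)⟩
  let w' : ℝ → L2 d := IccExtend hT fun x => w x
  have hw' : Continuous w' := (continuousOn_iff_continuous_domRestrict.1 hw).Icc_extend'
  have hc : Continuous (fun p : Phase d × ℝ => ‖transl (-p.1) (w' p.2) - w' p.2‖) :=
    ((continuous_transl (by fun_prop) (hw'.comp continuous_snd)).sub
      (hw'.comp continuous_snd)).norm
  have hev : ∀ᶠ y in 𝓝 (0 : Phase d), ∀ t ∈ Icc 0 T, ‖transl (-y) (w' t) - w' t‖ ≤ η := by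
    refine isCompact_Icc.eventually_forall_of_forall_eventually fun t ht => ?_
    exact (hc.tendsto (0, t)).eventually_le_const (by simpa using hη)
  obtain ⟨r, hr, h⟩ := Metric.eventually_nhds_iff.1 hev
  refine ⟨r, hr, fun t ht y hy => ?_⟩
  have := h (y := y) (by simpa using hy) t ht
  simpa only [w', IccExtend_of_mem hT _ ht] using this

/-! ### A comparison lemma -/

/-- Gronwall with a prescribed majorant: b e^{κt} solves y' = ky + (κ - k) b e^{κt}, so the
difference g = f - b e^{κt} satisfies g' ≤ kg + δ. The term δ accommodates mollification errors. -/
lemma le_exp_of_deriv_le {f f' : ℝ → ℝ} {T k κ b δ : ℝ} (hk : 0 ≤ k) (hδ : 0 ≤ δ)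
    (hf : ∀ t ∈ Icc 0 T, HasDerivWithinAt f (f' t) (Icc 0 T) t)
    (hf' : ∀ t ∈ Icc 0 T, f' t ≤ k * f t + (κ - k) * (b * Real.exp (κ * t)) + δ)
    (h0 : f 0 ≤ b) {t : ℝ} (ht : t ∈ Icc 0 T) :
    f t ≤ b * Real.exp (κ * t) + δ * t * Real.exp (k * t) := by
  let g : ℝ → ℝ := fun s => (f s - b * Real.exp (κ * s)) * Real.exp (-(k * s)) - δ * s
  let g' : ℝ → ℝ := fun s => (f' s - b * (Real.exp (κ * s) * κ)) * Real.exp (-(k * s))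
    + (f s - b * Real.exp (κ * s)) * (Real.exp (-(k * s)) * -k) - δ
  have hg : ∀ s ∈ Icc 0 T, HasDerivWithinAt g (g' s) (Icc 0 T) s := by
    intro s hs
    have e1 : HasDerivAt (fun s : ℝ => Real.exp (κ * s)) (Real.exp (κ * s) * κ) s := by
      simpa using ((hasDerivAt_id s).const_mul κ).exp
    have e2 : HasDerivAt (fun s : ℝ => Real.exp (-(k * s))) (Real.exp (-(k * s)) * -k) s := by
      simpa using ((hasDerivAt_id s).const_mul k).neg.exp
    have e3 : HasDerivAt (fun s : ℝ => δ * s) δ s := by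
      simpa using (hasDerivAt_id s).const_mul δ
    exact (((hf s hs).sub (e1.const_mul b).hasDerivWithinAt).mul e2.hasDerivWithinAt).sub
      e3.hasDerivWithinAt
  have hg' : ∀ s ∈ Icc 0 T, g' s ≤ 0 := by
    intro s hs
    have e1 : g' s = (f' s - (k * f s + (κ - k) * (b * Real.exp (κ * s)))) * Real.exp (-(k * s))
        - δ := by simp only [g']; ring
    have e2 : Real.exp (-(k * s)) ≤ 1 := by
      rw [Real.exp_le_one_iff]; nlinarith [hs.1]
    have e3 := hf' s hs
    have e4 := Real.exp_pos (-(k * s))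
    rw [e1]
    nlinarith
  have h1 : AntitoneOn g (Icc 0 T) := by
    refine antitoneOn_of_deriv_nonpos (convex_Icc 0 T)
      (fun s hs => (hg s hs).continuousWithinAt) (fun s hs => ?_) (fun s hs => ?_)
    · rw [interior_Icc] at hs ⊢
      exact ((hg s (Ioo_subset_Icc_self hs)).mono Ioo_subset_Icc_self).differentiableWithinAt
    · rw [interior_Icc] at hs
      have := (hg s (Ioo_subset_Icc_self hs)).hasDerivAt (Icc_mem_nhds hs.1 hs.2)
      rw [this.deriv]
      exact hg' s (Ioo_subset_Icc_self hs)
  have h2 := h1 (left_mem_Icc.2 (ht.1.trans ht.2)) ht ht.1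
  have h3 : g 0 ≤ 0 := by simp only [g]; simp; linarith
  have h4 : (f t - b * Real.exp (κ * t)) * Real.exp (-(k * t)) ≤ δ * t := by
    have := h2.trans h3; simp only [g] at this; linarith
  rw [Real.exp_neg, ← div_eq_mul_inv, div_le_iff₀ (Real.exp_pos _)] at h4
  linarith

/-! ### Weakly differentiable curves -/

section Hilbert

variable {H : Type*} [NormedAddCommGroup H] [InnerProductSpace ℂ H] {S : Set H} {A A' : ℝ → H}
  {T M : ℝ}

lemma norm_sub_le_of_weak_deriv (hS : Dense S)
    (h : ∀ φ ∈ S, ∀ t ∈ Icc 0 T,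
      HasDerivWithinAt (fun s => inner ℂ φ (A s)) (inner ℂ φ (A' t)) (Icc 0 T) t)
    (hM : ∀ t ∈ Icc 0 T, ‖A' t‖ ≤ M) {s t : ℝ} (hs : s ∈ Icc 0 T) (ht : t ∈ Icc 0 T) :
    ‖A s - A t‖ ≤ M * |s - t| := by
  have hM0 : 0 ≤ M := (norm_nonneg _).trans (hM s hs)
  refine norm_le_of_dense hS (by positivity) fun φ hφ => ?_
  have := Convex.norm_image_sub_le_of_norm_hasDerivWithin_le (C := ‖φ‖ * M) (h φ hφ)
    (fun t ht => (norm_inner_le_norm _ _).trans (by gcongr; exact hM t ht)) (convex_Icc 0 T) ht hs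
  rw [inner_sub_right]
  rw [Real.norm_eq_abs] at this
  linarith

/-- The curve is Lipschitz in norm, so replacing ψ by a nearby element of the dense set costs an
error proportional to |s - t|. -/
lemma hasDerivWithinAt_inner_of_weak (hS : Dense S)
    (h : ∀ φ ∈ S, ∀ t ∈ Icc 0 T,
      HasDerivWithinAt (fun s => inner ℂ φ (A s)) (inner ℂ φ (A' t)) (Icc 0 T) t)
    (hM : ∀ t ∈ Icc 0 T, ‖A' t‖ ≤ M) (ψ : H) {t : ℝ} (ht : t ∈ Icc 0 T) :
    HasDerivWithinAt (fun s => inner ℂ ψ (A s)) (inner ℂ ψ (A' t)) (Icc 0 T) t := by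
  have hM0 : 0 ≤ M := (norm_nonneg _).trans (hM t ht)
  rw [hasDerivWithinAt_iff_isLittleO, Asymptotics.isLittleO_iff]
  intro c hc
  -- The remainder of the curve is at most (2M + 1)|s - t|, so this radius leaves an error of
  -- (c/2)|s - t|; the added 1 keeps the denominator positive.
  obtain ⟨φ, hφψ, hφ⟩ := Metric.dense_iff.1 hS ψ (c / (2 * (2 * M + 1))) (by positivity)
  have h1 := h φ hφ t ht
  rw [hasDerivWithinAt_iff_isLittleO, Asymptotics.isLittleO_iff] at h1
  filter_upwards [h1 (half_pos hc), self_mem_nhdsWithin] with s hs hs'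
  have h2 : ‖A s - A t‖ ≤ M * ‖s - t‖ := norm_sub_le_of_weak_deriv hS h hM hs' ht
  have h3 : ‖A s - A t - (s - t) • A' t‖ ≤ (2 * M + 1) * ‖s - t‖ := by
    refine (norm_sub_le _ _).trans ?_
    rw [norm_smul]
    nlinarith [hM t ht, norm_nonneg (s - t)]
  have e1 : inner ℂ ψ (A s) - inner ℂ ψ (A t) - (s - t) • inner ℂ ψ (A' t)
      = (inner ℂ φ (A s) - inner ℂ φ (A t) - (s - t) • inner ℂ φ (A' t))
        - inner ℂ (φ - ψ) (A s - A t - (s - t) • A' t) := by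
    have e2 : ∀ x y : H, inner ℂ x ((s - t) • y) = (s - t) • inner ℂ x y := fun x y => by
      rw [RCLike.real_smul_eq_coe_smul (K := ℂ), inner_smul_right]; rfl
    rw [inner_sub_left, inner_sub_right, inner_sub_right, inner_sub_right, inner_sub_right, e2, e2]
    ring
  rw [e1]
  have h4 : ‖φ - ψ‖ ≤ c / (2 * (2 * M + 1)) := by
    rw [← dist_eq_norm]; exact (Metric.mem_ball.1 hφψ).le
  calc _ ≤ c / 2 * ‖s - t‖ + ‖φ - ψ‖ * ‖A s - A t - (s - t) • A' t‖ :=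
        (norm_sub_le _ _).trans (add_le_add hs (norm_inner_le_norm _ _))
    _ ≤ c / 2 * ‖s - t‖ + c / (2 * (2 * M + 1)) * ((2 * M + 1) * ‖s - t‖) := by gcongr
    _ = c * ‖s - t‖ := by field_simp; ring

/-- In ‖A s‖² = 2 Re⟨A t, A s⟩ - ‖A t‖² + ‖A s - A t‖² the first term needs only weak
differentiability, and the last is quadratic in s - t by the Lipschitz bound. -/
lemma hasDerivWithinAt_norm_sq_of_weak (hS : Dense S)
    (h : ∀ φ ∈ S, ∀ t ∈ Icc 0 T,
      HasDerivWithinAt (fun s => inner ℂ φ (A s)) (inner ℂ φ (A' t)) (Icc 0 T) t)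
    (hM : ∀ t ∈ Icc 0 T, ‖A' t‖ ≤ M) {t : ℝ} (ht : t ∈ Icc 0 T) :
    HasDerivWithinAt (fun s => ‖A s‖ ^ 2) (2 * (inner ℂ (A t) (A' t)).re) (Icc 0 T) t := by
  have hM0 : 0 ≤ M := (norm_nonneg _).trans (hM t ht)
  have h1 := hasDerivWithinAt_inner_of_weak hS h hM (A t) ht
  have h2 : HasDerivWithinAt (fun s => 2 * (inner ℂ (A t) (A s)).re)
      (2 * (inner ℂ (A t) (A' t)).re) (Icc 0 T) t :=
    (Complex.reCLM.hasFDerivAt.comp_hasDerivWithinAt t h1).const_mul 2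
  have h3 : HasDerivWithinAt (fun s => ‖A s - A t‖ ^ 2) 0 (Icc 0 T) t := by
    rw [hasDerivWithinAt_iff_isLittleO, Asymptotics.isLittleO_iff]
    intro c hc
    have h4 : ∀ᶠ s in 𝓝[Icc 0 T] t, |s - t| < c / (M ^ 2 + 1) := by
      refine eventually_nhdsWithin_of_eventually_nhds ?_
      exact Metric.ball_mem_nhds t (by positivity)
    filter_upwards [h4, self_mem_nhdsWithin] with s hs hs'
    have h2 : ‖A s - A t‖ ≤ M * |s - t| := norm_sub_le_of_weak_deriv hS h hM hs' ht
    simp only [sub_self, norm_zero, ne_eq, OfNat.ofNat_ne_zero, not_false_eq_true, zero_pow,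
      sub_zero, smul_zero, Real.norm_eq_abs]
    rw [abs_of_nonneg (sq_nonneg _)]
    rw [lt_div_iff₀ (by positivity)] at hs
    calc ‖A s - A t‖ ^ 2 ≤ (M * |s - t|) ^ 2 := by gcongr
      _ = |s - t| * M ^ 2 * |s - t| := by ring
      _ ≤ c * |s - t| := by
        gcongr
        nlinarith [abs_nonneg (s - t)]
  have h5 := (h2.add h3).sub_const (‖A t‖ ^ 2)
  rw [add_zero] at h5
  refine h5.congr_of_mem (fun s _ => ?_) ht
  have e1 : ‖A s‖ ^ 2 = ‖A t + (A s - A t)‖ ^ 2 := by congr 2; abel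
  have e2 := norm_add_sq (𝕜 := ℂ) (A t) (A s - A t)
  have e3 : (inner ℂ (A t) (A t)).re = ‖A t‖ ^ 2 := by
    rw [inner_self_eq_norm_sq_to_K]; norm_cast
  simp only [Pi.add_apply]
  rw [e1, e2, inner_sub_right, map_sub]
  simp only [RCLike.re_to_complex]
  rw [e3]; ring

end Hilbert

/-! ### Weak solutions with forcing and their energy -/

/-- `w` is a weak solution of `i ∂ₜ w = ∇_x·∇_ξ w + N`. -/
def WeakSol (w N : ℝ → L2 d) : Prop := ∀ φ (h : IsTest φ), ∀ t : ℝ, 0 ≤ t →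
  HasDerivWithinAt (fun s => inner ℂ (testLp φ h) (w s))
    (-Complex.I * (inner ℂ (testLp _ h.kinetic) (w t) + inner ℂ (testLp φ h) (N t))) (Ici 0) t

lemma WeakSol.sub {w N w' N' : ℝ → L2 d} (h : WeakSol w N) (h' : WeakSol w' N') :
    WeakSol (fun t => w t - w' t) (fun t => N t - N' t) := by
  intro φ hφ t ht
  have := (h φ hφ t ht).sub (h' φ hφ t ht)
  simp only [inner_sub_right]
  refine this.congr_deriv ?_
  ring

section Energy

variable {w N : ℝ → L2 d} {T M M' : ℝ}

/-- The equation is tested with χ * φ, and the convolutions are moved onto the solution by symmetry.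
The kinetic term is now a bounded operator applied to `w t`. -/
lemma WeakSol.moll {r : ℝ} {χ : Phase d → ℂ} (hw : WeakSol w N) (hχ : IsKernel r χ) :
    ∀ φ ∈ {f : L2 d | ∃ φ, ∃ h : IsTest φ, f = testLp φ h}, ∀ t ∈ Icc 0 T,
      HasDerivWithinAt (fun s => inner ℂ φ (HamiltonHartree.moll χ hχ.test (w s)))
        (inner ℂ φ (-Complex.I • (HamiltonHartree.moll _ hχ.test.kinetic (w t)
          + HamiltonHartree.moll χ hχ.test (N t)))) (Icc 0 T) t := by
  rintro _ ⟨φ, hφ, rfl⟩ t ht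
  have h1 := (hw _ (hχ.test.conv hφ) t ht.1).mono (Icc_subset_Ici_self : Icc 0 T ⊆ Ici 0)
  have e1 : testLp _ (hχ.test.conv hφ).kinetic
      = HamiltonHartree.moll _ hχ.test.kinetic (testLp φ hφ) := by
    rw [moll_testLp]
    exact testLp_congr _ _ fun z => kinetic_conv hχ.test hφ z
  simp only [e1, (moll_testLp hχ.test hφ).symm, hχ.inner_moll, hχ.inner_moll_kinetic] at h1
  rw [inner_smul_right, inner_add_right]
  exact h1

lemma WeakSol.exists_bound {r : ℝ} {χ : Phase d → ℂ} (hχ : IsKernel r χ)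
    (hM : ∀ t ∈ Icc 0 T, ‖w t‖ ≤ M) (hM' : ∀ t ∈ Icc 0 T, ‖N t‖ ≤ M') :
    ∀ t ∈ Icc 0 T, ‖-Complex.I • (HamiltonHartree.moll _ hχ.test.kinetic (w t)
      + HamiltonHartree.moll χ hχ.test (N t))‖
        ≤ ‖HamiltonHartree.moll _ hχ.test.kinetic‖ * M + M' := by
  intro t ht
  rw [norm_smul, norm_neg, Complex.norm_I, one_mul]
  refine (norm_add_le _ _).trans (add_le_add ?_ ((hχ.norm_moll_le _).trans (hM' t ht)))
  exact ((HamiltonHartree.moll _ hχ.test.kinetic).le_opNorm _).trans (by gcongr; exact hM t ht)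

/-- The kinetic contribution vanishes by `IsKernel.im_inner_kinetic`; what remains is Re(-iz) = Im z
for the forcing. -/
lemma WeakSol.hasDerivWithinAt_norm_sq {r : ℝ} {χ : Phase d → ℂ} (hw : WeakSol w N)
    (hχ : IsKernel r χ) (hM : ∀ t ∈ Icc 0 T, ‖w t‖ ≤ M) (hM' : ∀ t ∈ Icc 0 T, ‖N t‖ ≤ M')
    {t : ℝ} (ht : t ∈ Icc 0 T) :
    HasDerivWithinAt (fun s => ‖HamiltonHartree.moll χ hχ.test (w s)‖ ^ 2)
      (2 * (inner ℂ (HamiltonHartree.moll χ hχ.test (w t))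
        (HamiltonHartree.moll χ hχ.test (N t))).im) (Icc 0 T) t := by
  refine (hasDerivWithinAt_norm_sq_of_weak dense_testLp (hw.moll hχ)
    (WeakSol.exists_bound hχ hM hM') ht).congr_deriv ?_
  rw [inner_smul_right, inner_add_right]
  have := hχ.im_inner_kinetic (w t)
  simp [Complex.mul_re, this]

lemma tendsto_moll_of_isKernel {χ : ℕ → Phase d → ℂ} {r : ℕ → ℝ}
    (hχ : ∀ n, IsKernel (r n) (χ n)) (hr : Tendsto r atTop (𝓝 0)) (a : L2 d) :
    Tendsto (fun n => HamiltonHartree.moll (χ n) (hχ n).test a) atTop (𝓝 a) := by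
  rw [Metric.tendsto_atTop]
  intro ε hε
  obtain ⟨ρ, hρ, h⟩ := exists_uniform_moll (w := fun _ => a) (T := 0) continuousOn_const
    (half_pos hε)
  obtain ⟨n0, hn0⟩ := eventually_atTop.1 (hr.eventually_lt_const hρ)
  refine ⟨n0, fun n hn => ?_⟩
  rw [dist_eq_norm]
  refine ((hχ n).norm_moll_sub_le (δ := ε / 2) fun y hy => ?_).trans_lt (half_lt_self hε)
  exact h 0 (by simp) y (hy.trans (hn0 n hn))

/-- The `L²` norm of a weak solution is Lipschitz in time. -/
lemma WeakSol.abs_norm_sq_sub_le (hw : WeakSol w N) (hM : ∀ t ∈ Icc 0 T, ‖w t‖ ≤ M)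
    (hM' : ∀ t ∈ Icc 0 T, ‖N t‖ ≤ M') {s t : ℝ} (hs : s ∈ Icc 0 T) (ht : t ∈ Icc 0 T) :
    |‖w s‖ ^ 2 - ‖w t‖ ^ 2| ≤ 2 * M * M' * |s - t| := by
  have hr : ∀ n : ℕ, (0 : ℝ) < 1 / ((n : ℝ) + 1) := fun n => by positivity
  choose χ hχ using fun n => exists_isKernel (d := d) (hr n)
  have hc : ∀ a : L2 d, Tendsto (fun n => ‖HamiltonHartree.moll (χ n) (hχ n).test a‖ ^ 2) atTop
      (𝓝 (‖a‖ ^ 2)) := fun a =>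
    ((tendsto_moll_of_isKernel hχ tendsto_one_div_add_atTop_nhds_zero_nat a).norm).pow 2
  refine le_of_tendsto ((hc (w s)).sub (hc (w t))).abs (.of_forall fun n => ?_)
  have := Convex.norm_image_sub_le_of_norm_hasDerivWithin_le (C := 2 * M * M')
    (fun t ht => hw.hasDerivWithinAt_norm_sq (hχ n) hM hM' ht)
    (fun t ht => ?_) (convex_Icc 0 T) ht hs
  · simpa [Real.norm_eq_abs] using this
  · rw [norm_mul, Real.norm_eq_abs, Real.norm_eq_abs, abs_two, mul_assoc]
    gcongr
    refine (Complex.abs_im_le_norm _).trans ((norm_inner_le_norm _ _).trans ?_)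
    have h1 := ((hχ n).norm_moll_le (w t)).trans (hM t ht)
    have h2 := ((hχ n).norm_moll_le (N t)).trans (hM' t ht)
    exact mul_le_mul h1 h2 (norm_nonneg _) ((norm_nonneg _).trans h1)

/-- Bounded weak solutions with bounded forcing are strongly continuous. -/
lemma WeakSol.continuousOn (hw : WeakSol w N) (hM : ∀ t ∈ Icc 0 T, ‖w t‖ ≤ M)
    (hM' : ∀ t ∈ Icc 0 T, ‖N t‖ ≤ M') : ContinuousOn w (Icc 0 T) := by
  intro t ht
  have hM0 : 0 ≤ M := (norm_nonneg _).trans (hM t ht)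
  -- Continuity of the norm together with weak continuity gives strong continuity.
  have h1 : Tendsto (fun s => ‖w s‖ ^ 2) (𝓝[Icc 0 T] t) (𝓝 (‖w t‖ ^ 2)) := by
    rw [tendsto_iff_dist_tendsto_zero]
    have h2 : Tendsto (fun s => 2 * M * M' * |s - t|) (𝓝[Icc 0 T] t) (𝓝 0) := by
      have : Continuous fun s => 2 * M * M' * |s - t| := by fun_prop
      simpa using (this.tendsto t).mono_left nhdsWithin_le_nhds
    refine squeeze_zero' (.of_forall fun s => dist_nonneg) ?_ h2
    filter_upwards [self_mem_nhdsWithin] with s hs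
    exact hw.abs_norm_sq_sub_le hM hM' hs ht
  have h2 : Tendsto (fun s => inner ℂ (w t) (w s)) (𝓝[Icc 0 T] t) (𝓝 (inner ℂ (w t) (w t))) := by
    rw [Metric.tendsto_nhds]
    intro ε hε
    -- Since ‖w s - w t‖ ≤ 2M, replacing `w t` by φ in the pairing costs at most ε/2.
    obtain ⟨φ, hφ, hφ1, hφ2, hφ3⟩ := Metric.dense_iff.1 dense_testLp (w t) (ε / (4 * (M + 1)))
      (by positivity)
    have h3 := ((hw hφ1 hφ2 t ht.1).continuousWithinAt.mono
      (Icc_subset_Ici_self : Icc 0 T ⊆ Ici 0)).tendsto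
    rw [← hφ3] at h3
    filter_upwards [Metric.tendsto_nhds.1 h3 (ε / 2) (by positivity), self_mem_nhdsWithin]
      with s hs hs'
    rw [dist_eq_norm] at *
    have e1 : inner ℂ (w t) (w s) - inner ℂ (w t) (w t)
        = (inner ℂ φ (w s) - inner ℂ φ (w t)) - inner ℂ (φ - w t) (w s - w t) := by
      simp only [inner_sub_left, inner_sub_right]; ring
    have h5 : ‖w s - w t‖ ≤ 2 * M :=
      (norm_sub_le _ _).trans (by linarith [hM s hs', hM t ht])
    have h6 : ‖φ - w t‖ ≤ ε / (4 * (M + 1)) := by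
      rw [← dist_eq_norm]; exact (Metric.mem_ball.1 hφ).le
    have h7 : ‖φ - w t‖ * ‖w s - w t‖ ≤ ε / 2 := by
      calc _ ≤ ε / (4 * (M + 1)) * (2 * M) := by gcongr
        _ ≤ ε / (4 * (M + 1)) * (2 * (M + 1)) := by gcongr; linarith
        _ = ε / 2 := by field_simp; ring
    rw [e1]
    calc _ ≤ _ := norm_sub_le _ _
      _ ≤ ‖inner ℂ φ (w s) - inner ℂ φ (w t)‖ + ‖φ - w t‖ * ‖w s - w t‖ := by
        gcongr; exact norm_inner_le_norm _ _
      _ < ε / 2 + ε / 2 := by linarith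
      _ = ε := by ring
  have h3 : Tendsto (fun s => ‖w s - w t‖ ^ 2) (𝓝[Icc 0 T] t) (𝓝 0) := by
    have h4 : Tendsto (fun s => ‖w s‖ ^ 2 - 2 * (inner ℂ (w t) (w s)).re + ‖w t‖ ^ 2)
        (𝓝[Icc 0 T] t) (𝓝 (‖w t‖ ^ 2 - 2 * (inner ℂ (w t) (w t)).re + ‖w t‖ ^ 2)) :=
      (h1.sub (((Complex.continuous_re.tendsto _).comp h2).const_mul 2)).add_const _
    have e3 : (inner ℂ (w t) (w t)).re = ‖w t‖ ^ 2 := by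
      rw [inner_self_eq_norm_sq_to_K]; norm_cast
    rw [e3, show ‖w t‖ ^ 2 - 2 * ‖w t‖ ^ 2 + ‖w t‖ ^ 2 = 0 by ring] at h4
    refine h4.congr fun s => ?_
    rw [norm_sub_sq (𝕜 := ℂ), ← inner_re_symm]; rfl
  rw [ContinuousWithinAt, tendsto_iff_norm_sub_tendsto_zero]
  have h5 := (Real.continuous_sqrt.tendsto 0).comp h3
  rw [Real.sqrt_zero] at h5
  refine h5.congr fun s => ?_
  simp [Real.sqrt_sq (norm_nonneg _)]

/-- The energy estimate for weak solutions. -/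
lemma WeakSol.norm_sq_le (hw : WeakSol w N) (hc : ContinuousOn w (Icc 0 T))
    (hM' : ∀ t ∈ Icc 0 T, ‖N t‖ ≤ M') {k κ b : ℝ} (hk : 0 ≤ k)
    (hN : ∀ t ∈ Icc 0 T,
      2 * (inner ℂ (w t) (N t)).im ≤ k * ‖w t‖ ^ 2 + (κ - k) * (b * Real.exp (κ * t)))
    (h0 : ‖w 0‖ ^ 2 ≤ b) {t : ℝ} (ht : t ∈ Icc 0 T) : ‖w t‖ ^ 2 ≤ b * Real.exp (κ * t) := by
  obtain ⟨M, hM⟩ := isCompact_Icc.exists_bound_of_continuousOn hc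
  have hM0 : 0 ≤ M := (norm_nonneg _).trans (hM t ht)
  have hM0' : 0 ≤ M' := (norm_nonneg _).trans (hM' t ht)
  -- At mollification error η, moving both mollifiers off the forcing costs 4M'η, and comparing ‖w‖²
  -- with its mollified version costs 2Mη, once with the factor k in the inequality and once at the
  -- end. Then η tends to zero.
  have key : ∀ η : ℝ, 0 < η → ‖w t‖ ^ 2 ≤ b * Real.exp (κ * t)
      + η * ((4 * M' + 2 * M * k) * t * Real.exp (k * t) + 2 * M) := by
    intro η hη
    obtain ⟨r, hr, h⟩ := exists_uniform_moll hc hη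
    obtain ⟨χ, hχ⟩ := exists_isKernel (d := d) hr
    have h1 : ∀ s ∈ Icc 0 T, ‖HamiltonHartree.moll χ hχ.test (w s) - w s‖ ≤ η := fun s hs =>
      hχ.norm_moll_sub_le (h s hs)
    have h2 : ∀ s ∈ Icc 0 T, ‖w s‖ ^ 2
        ≤ ‖HamiltonHartree.moll χ hχ.test (w s)‖ ^ 2 + 2 * M * η := by
      intro s hs
      have e1 := hχ.norm_moll_le (w s)
      have e2 := h1 s hs
      have e3 := norm_sub_norm_le (w s) (HamiltonHartree.moll χ hχ.test (w s))
      rw [norm_sub_rev] at e3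
      have e4 := hM s hs
      nlinarith [norm_nonneg (HamiltonHartree.moll χ hχ.test (w s)), norm_nonneg (w s)]
    have h3 : ∀ s ∈ Icc 0 T, 2 * (inner ℂ (HamiltonHartree.moll χ hχ.test (w s))
        (HamiltonHartree.moll χ hχ.test (N s))).im
        ≤ k * ‖HamiltonHartree.moll χ hχ.test (w s)‖ ^ 2 + (κ - k) * (b * Real.exp (κ * s))
          + η * (4 * M' + 2 * M * k) := by
      intro s hs
      rw [← hχ.inner_moll]
      have e1 : ‖HamiltonHartree.moll χ hχ.test (HamiltonHartree.moll χ hχ.test (w s)) - w s‖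
          ≤ 2 * η := by
        have e2 : HamiltonHartree.moll χ hχ.test (HamiltonHartree.moll χ hχ.test (w s)) - w s
            = HamiltonHartree.moll χ hχ.test (HamiltonHartree.moll χ hχ.test (w s) - w s)
              + (HamiltonHartree.moll χ hχ.test (w s) - w s) := by
          rw [map_sub]; abel
        rw [e2]
        refine (norm_add_le _ _).trans ?_
        have := (hχ.norm_moll_le (HamiltonHartree.moll χ hχ.test (w s) - w s)).trans (h1 s hs)
        linarith [h1 s hs]
      have e3 : (inner ℂ (HamiltonHartree.moll χ hχ.test (HamiltonHartree.moll χ hχ.test (w s)))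
          (N s)).im ≤ (inner ℂ (w s) (N s)).im + 2 * η * M' := by
        have e4 : (inner ℂ (HamiltonHartree.moll χ hχ.test (HamiltonHartree.moll χ hχ.test (w s))
            - w s) (N s)).im ≤ 2 * η * M' :=
          (le_abs_self _).trans ((Complex.abs_im_le_norm _).trans
            ((norm_inner_le_norm _ _).trans (mul_le_mul e1 (hM' s hs) (norm_nonneg _)
              (by positivity))))
        rw [inner_sub_left, Complex.sub_im] at e4
        linarith
      have e5 := hN s hs
      have e6 := mul_le_mul_of_nonneg_left (h2 s hs) hk
      linarith
    have h4 := le_exp_of_deriv_le hk (by positivity)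
      (fun s hs => hw.hasDerivWithinAt_norm_sq hχ hM hM' hs) h3
      ((pow_le_pow_left₀ (norm_nonneg _) (hχ.norm_moll_le _) 2).trans h0) ht
    have h5 := h2 t ht
    linarith
  refine le_of_forall_pos_le_add fun ε hε => ?_
  set Q := (4 * M' + 2 * M * k) * t * Real.exp (k * t) + 2 * M with hQ
  have hQ0 : 0 ≤ Q := by have := ht.1; positivity
  refine (key (ε / (Q + 1)) (by positivity)).trans ?_
  gcongr
  rw [div_mul_eq_mul_div, div_le_iff₀ (by positivity)]
  nlinarith

end Energy

/-! ### Linear equations with bounded generators -/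

section Dyson

variable {E : Type*} [NormedAddCommGroup E] [NormedSpace ℂ E]

/-- The terms of the Dyson series of `u' = B u`, `u 0 = x`. -/
def dyson (B : ℝ → E →L[ℂ] E) (x : E) : ℕ → ℝ → E
  | 0 => fun _ => x
  | n + 1 => fun t => ∫ s in (0 : ℝ)..t, B s (dyson B x n s)

lemma continuous_dyson {B : ℝ → E →L[ℂ] E} (hB : Continuous B) (x : E) (n : ℕ) :
    Continuous (dyson B x n) := by
  induction n with
  | zero => exact continuous_const
  | succ n ih =>
    have : Continuous fun s => B s (dyson B x n s) := hB.clm_apply ih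
    exact intervalIntegral.continuous_primitive (fun a b => this.intervalIntegrable a b) 0

lemma hasDerivAt_dyson [CompleteSpace E] {B : ℝ → E →L[ℂ] E} (hB : Continuous B) (x : E) (n : ℕ) (t : ℝ) :
    HasDerivAt (dyson B x (n + 1)) (B t (dyson B x n t)) t := by
  have h : Continuous fun s => B s (dyson B x n s) := hB.clm_apply (continuous_dyson hB x n)
  exact intervalIntegral.integral_hasDerivAt_right (h.intervalIntegrable _ _)
    h.aestronglyMeasurable.stronglyMeasurableAtFilter h.continuousAt

lemma norm_dyson_le {B : ℝ → E →L[ℂ] E} (hB : Continuous B) {M : ℝ} (hM : ∀ t, ‖B t‖ ≤ M) (x : E)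
    (n : ℕ) (t : ℝ) : ‖dyson B x n t‖ ≤ ‖x‖ * ((M * |t|) ^ n / n.factorial) := by
  have hM0 : 0 ≤ M := (norm_nonneg _).trans (hM 0)
  induction n generalizing t with
  | zero => simp [dyson]
  | succ n ih =>
    rw [dyson]
    refine (intervalIntegral.norm_integral_le_integral_norm_uIoc).trans ?_
    have h : Continuous fun s => B s (dyson B x n s) := hB.clm_apply (continuous_dyson hB x n)
    have h1 : ∀ s : ℝ, ‖B s (dyson B x n s)‖
        ≤ (M * ‖x‖ * M ^ n / n.factorial) * |s - 0| ^ n := by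
      intro s
      refine ((B s).le_opNorm _).trans ((mul_le_mul (hM s) (ih s) (norm_nonneg _) hM0).trans
        (le_of_eq ?_))
      rw [sub_zero, mul_pow]; ring
    have h2 : IntegrableOn (fun s => ‖B s (dyson B x n s)‖) (uIoc 0 t) :=
      (intervalIntegrable_iff.1 (h.norm.intervalIntegrable 0 t))
    have h3 : IntegrableOn (fun s : ℝ => (M * ‖x‖ * M ^ n / n.factorial) * |s - 0| ^ n) (uIoc 0 t) :=
      intervalIntegrable_iff.1 (Continuous.intervalIntegrable
        (u := fun s : ℝ => (M * ‖x‖ * M ^ n / n.factorial) * |s - 0| ^ n) (by fun_prop) 0 t)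
    refine (integral_mono h2 h3 h1).trans (le_of_eq ?_)
    rw [integral_const_mul, integral_pow_abs_sub_uIoc, sub_zero, Nat.factorial_succ]
    have := Nat.factorial_ne_zero n
    push_cast
    field_simp
    ring

/-- Global solvability of `u' = B u` with bounded continuous `B`. -/
lemma exists_linear_ode [CompleteSpace E] {B : ℝ → E →L[ℂ] E} (hB : Continuous B) {M : ℝ} (hM : ∀ t, ‖B t‖ ≤ M)
    (x : E) : ∃ u : ℝ → E, u 0 = x ∧ ∀ t, HasDerivAt u (B t (u t)) t := by
  have hM0 : 0 ≤ M := (norm_nonneg _).trans (hM 0)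
  have hsum : ∀ t, Summable fun n => dyson B x n t := fun t =>
    Summable.of_norm_bounded ((Real.summable_pow_div_factorial (M * |t|)).mul_left ‖x‖)
      fun n => norm_dyson_le hB hM x n t
  have hsum' : ∀ t, Summable fun n => dyson B x (n + 1) t := fun t =>
    (summable_nat_add_iff 1).2 (hsum t)
  have h0 : ∀ t, x + ∑' n, dyson B x (n + 1) t = ∑' n, dyson B x n t := fun t =>
    ((hsum t).tsum_eq_zero_add).symm
  -- With the constant term split off, the differentiated series is exactly the sum of the B_t
  -- applied to all Dyson terms.
  refine ⟨fun t => x + ∑' n, dyson B x (n + 1) t, ?_, fun t => ?_⟩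
  · simp [dyson]
  beta_reduce
  rw [h0 t, (B t).map_tsum (hsum t)]
  refine HasDerivAt.const_add x ?_
  refine hasDerivAt_tsum_of_isPreconnected (t := Metric.ball (0 : ℝ) (|t| + 1)) (y₀ := 0)
    (u := fun n => M * (‖x‖ * ((M * (|t| + 1)) ^ n / n.factorial)))
    (g := fun n => dyson B x (n + 1)) (g' := fun n s => B s (dyson B x n s))
    (((Real.summable_pow_div_factorial _).mul_left _).mul_left _) Metric.isOpen_ball
    (convex_ball _ _).isPreconnected (fun n s _ => hasDerivAt_dyson hB x n s) ?_ ?_ (hsum' 0) ?_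
  · intro n s hs
    refine ((B s).le_opNorm _).trans (mul_le_mul (hM s) ((norm_dyson_le hB hM x n s).trans ?_)
      (norm_nonneg _) hM0)
    rw [mem_ball_zero_iff, Real.norm_eq_abs] at hs
    gcongr
  · simp; positivity
  · simp

end Dyson

section Symmetric

variable {H : Type*} [NormedAddCommGroup H] [InnerProductSpace ℂ H]

/-- As ⟨Su, GSu⟩ is real, it can be subtracted freely, so only the commutator [S, G] drives the
growth of ‖Su‖. Each a priori bound below arises from a choice of S. -/
lemma hasDerivAt_norm_sq_of_symm {u : ℝ → H} {G S : H →L[ℂ] H} {t : ℝ}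
    (hG : ∀ x y, inner ℂ (G x) y = inner ℂ x (G y)) (hu : HasDerivAt u (-Complex.I • G (u t)) t) :
    HasDerivAt (fun s => ‖S (u s)‖ ^ 2)
      (2 * (inner ℂ (S (u t)) (S (G (u t)) - G (S (u t)))).im) t := by
  have h1 : HasDerivAt (fun s => S (u s)) (S (-Complex.I • G (u t))) t :=
    (S.restrictScalars ℝ).hasFDerivAt.comp_hasDerivAt t hu
  have h4 : HasDerivAt (fun s => ‖S (u s)‖ ^ 2)
      (inner ℂ (S (u t)) (S (-Complex.I • G (u t)))
        + inner ℂ (S (-Complex.I • G (u t))) (S (u t))).re t := by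
    refine (Complex.reCLM.hasFDerivAt.comp_hasDerivAt t (h1.inner ℂ h1)).congr_of_eventuallyEq
      (.of_forall fun s => ?_)
    exact norm_sq_eq_re_inner (𝕜 := ℂ) _
  refine h4.congr_deriv ?_
  have h2 : (inner ℂ (S (u t)) (G (S (u t)))).im = 0 := by
    rw [← Complex.conj_eq_iff_im, inner_conj_symm, hG]
  have h3 : (inner ℂ (S (-Complex.I • G (u t))) (S (u t))).re
      = (inner ℂ (S (u t)) (S (-Complex.I • G (u t)))).re := inner_re_symm (𝕜 := ℂ) _ _
  rw [Complex.add_re, h3, map_smul, inner_smul_right, inner_sub_right, Complex.sub_im, h2]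
  simp [Complex.mul_re, two_mul]

end Symmetric

/-! ### The discretized kinetic operator -/

/-- The centered difference quotient in the direction `w`. -/
def diffQ (h : ℝ) (w : Phase d) : L2 d →L[ℂ] L2 d :=
  ((2 * h : ℝ) : ℂ)⁻¹ • ((transl (h • w)).toContinuousLinearMap
    - (transl (-(h • w))).toContinuousLinearMap)

lemma diffQ_apply (h : ℝ) (w : Phase d) (a : L2 d) :
    diffQ h w a = ((2 * h : ℝ) : ℂ)⁻¹ • (transl (h • w) a - transl (-(h • w)) a) := rfl

lemma transl_diffQ (y : Phase d) (h : ℝ) (w : Phase d) (a : L2 d) :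
    transl y (diffQ h w a) = diffQ h w (transl y a) := by
  rw [diffQ_apply, diffQ_apply, map_smul, map_sub, transl_comm y, transl_comm y]

lemma diffQ_comm (h h' : ℝ) (w w' : Phase d) (a : L2 d) :
    diffQ h w (diffQ h' w' a) = diffQ h' w' (diffQ h w a) := by
  rw [diffQ_apply h, transl_diffQ, transl_diffQ, ← map_sub, ← map_smul, ← diffQ_apply]

lemma inner_diffQ (h : ℝ) (w : Phase d) (a b : L2 d) :
    inner ℂ (diffQ h w a) b = - inner ℂ a (diffQ h w b) := by
  rw [diffQ_apply, diffQ_apply, inner_smul_left, inner_smul_right, inner_sub_left, inner_sub_right,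
    inner_transl_left, inner_transl_left, neg_neg, map_inv₀, Complex.conj_ofReal]
  ring

/-- The centered quotient is a translate of the forward quotient of step 2h, hence controlled by
`Reg.shift`. -/
lemma norm_diffQ {h : ℝ} (hh : 0 < h) (w : Phase d) (a : L2 d) :
    ‖diffQ h w a‖ = ‖transl ((2 * h) • w) a - a‖ / (2 * h) := by
  have e : transl (h • w) a - transl (-(h • w)) a
      = transl (-(h • w)) (transl ((2 * h) • w) a - a) := by
    rw [map_sub, transl_transl]; congr 3; module
  rw [diffQ_apply, e, norm_smul, norm_transl, norm_inv, Complex.norm_real, Real.norm_eq_abs,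
    abs_of_pos (by positivity), inv_mul_eq_div]

/-- The discretization of `∇_x · ∇_ξ`. -/
def kinQ (h : ℝ) : L2 d →L[ℂ] L2 d := ∑ i, (diffQ h (dirX i)).comp (diffQ h (dirV i))

lemma kinQ_apply (h : ℝ) (a : L2 d) : kinQ h a = ∑ i, diffQ h (dirX i) (diffQ h (dirV i) a) := by
  simp [kinQ]

/-- Centered differences are antisymmetric and commute, so their products are symmetric. -/
lemma inner_kinQ (h : ℝ) (a b : L2 d) : inner ℂ (kinQ h a) b = inner ℂ a (kinQ h b) := by
  rw [kinQ_apply, kinQ_apply, sum_inner, inner_sum]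
  refine Finset.sum_congr rfl fun i _ => ?_
  rw [inner_diffQ, inner_diffQ, neg_neg, diffQ_comm]

lemma transl_kinQ (y : Phase d) (h : ℝ) (a : L2 d) :
    transl y (kinQ h a) = kinQ h (transl y a) := by
  rw [kinQ_apply, kinQ_apply, map_sum]
  simp only [transl_diffQ]

/-- Discrete Leibniz rule: the commutator sees only increments of m, and is bounded uniformly in h.
-/
lemma mulOp_diffQ {m : Phase d → ℝ} (hm : IsMult m) {h : ℝ} {w : Phase d} (hh : 0 < h) {L : ℝ}
    (hL : ∀ z (s : ℝ), |m (z + s • w) - m z| ≤ L * |s|) (a : L2 d) :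
    ‖mulOp m (diffQ h w a) - diffQ h w (mulOp m a)‖ ≤ L * ‖a‖ := by
  have key : ∀ s : ℝ, |s| = h →
      ‖mulOp m (transl (s • w) a) - transl (s • w) (mulOp m a)‖ ≤ L * h * ‖a‖ := by
    intro s hs
    rw [transl_mulOp hm, ← mulOp_sub hm (hm.shift _)]
    refine (norm_mulOp_le (hm.sub (hm.shift _)) (C := L * h) (fun z => ?_) _).trans_eq
      (by rw [norm_transl])
    rw [abs_sub_comm, ← hs]; exact hL z s
  have h1 := key h (abs_of_pos hh)
  have h2 := key (-h) (by rw [abs_neg, abs_of_pos hh])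
  rw [neg_smul] at h2
  have e : mulOp m (diffQ h w a) - diffQ h w (mulOp m a)
      = ((2 * h : ℝ) : ℂ)⁻¹ • ((mulOp m (transl (h • w) a) - transl (h • w) (mulOp m a))
        - (mulOp m (transl (-(h • w)) a) - transl (-(h • w)) (mulOp m a))) := by
    rw [diffQ_apply, diffQ_apply, map_smul, map_sub, ← smul_sub]; congr 1; abel
  rw [e, norm_smul, norm_inv, Complex.norm_real, Real.norm_eq_abs, abs_of_pos (by positivity),
    inv_mul_le_iff₀ (by positivity)]
  refine (norm_sub_le _ _).trans ?_
  linarith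

lemma abs_clampV_sub_le (R : ℝ) (i : Fin d) (z z' : Phase d) :
    |clampV R i z - clampV R i z'| ≤ |z.2 i - z'.2 i| := by
  unfold clampV
  refine (abs_max_sub_max_le_max _ _ _ _).trans ?_
  rw [sub_self, abs_zero, max_eq_right (abs_nonneg _)]
  refine (abs_min_sub_min_le_max _ _ _ _).trans ?_
  rw [sub_self, abs_zero, max_eq_right (abs_nonneg _)]

/-- Discrete form of [ξ_i, ∇_x·∇_ξ] = -∂_{x_i}: the truncated coordinate commutes with all
differences except the one along ξ_i, where it is 1-Lipschitz. -/
lemma norm_clampV_kinQ_le {R : ℝ} (hR : 0 ≤ R) (i : Fin d) {h : ℝ} (hh : 0 < h) (a : L2 d) :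
    ‖mulOp (clampV R i) (kinQ h a) - kinQ h (mulOp (clampV R i) a)‖ ≤ ‖diffQ h (dirX i) a‖ := by
  have hm := isMult_clampV hR i (d := d)
  have hx : ∀ j, ∀ b : L2 d, mulOp (clampV R i) (diffQ h (dirX j) b)
      = diffQ h (dirX j) (mulOp (clampV R i) b) := by
    intro j b
    rw [← sub_eq_zero, ← norm_le_zero_iff]
    refine (mulOp_diffQ hm hh (L := 0) (fun z s => ?_) b).trans_eq (zero_mul _)
    refine (abs_clampV_sub_le R i _ _).trans ?_
    simp [dirX]
  have hv : ∀ j, j ≠ i → ∀ b : L2 d, mulOp (clampV R i) (diffQ h (dirV j) b)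
      = diffQ h (dirV j) (mulOp (clampV R i) b) := by
    intro j hj b
    rw [← sub_eq_zero, ← norm_le_zero_iff]
    refine (mulOp_diffQ hm hh (L := 0) (fun z s => ?_) b).trans_eq (zero_mul _)
    refine (abs_clampV_sub_le R i _ _).trans ?_
    simp [dirV, hj.symm]
  have e : mulOp (clampV R i) (kinQ h a) - kinQ h (mulOp (clampV R i) a)
      = mulOp (clampV R i) (diffQ h (dirV i) (diffQ h (dirX i) a))
        - diffQ h (dirV i) (mulOp (clampV R i) (diffQ h (dirX i) a)) := by
    rw [kinQ_apply, kinQ_apply, map_sum, ← Finset.sum_sub_distrib, Finset.sum_eq_single i]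
    · rw [diffQ_comm h h (dirX i), diffQ_comm h h (dirX i), hx]
    · intro j _ hj
      rw [hx, hv j hj, sub_self]
    · simp
  rw [e]
  refine (mulOp_diffQ hm hh (L := 1) (fun z s => ?_) _).trans_eq (one_mul _)
  refine (abs_clampV_sub_le R i _ _).trans ?_
  simp [dirV]

/-! ### Consistency of the discretization -/

/-- The second quotient is an average over |s| ≤ h of translated derivatives; the mean value
inequality applies after subtraction of s • g, and moving the translation off g costs h ‖∂_{w'} g‖.
-/
lemma norm_diffQ_comp_sub_le {φ : Phase d → ℂ} (hφ : IsTest φ) (w w' : Phase d) {h : ℝ}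
    (hh : 0 < h) :
    ‖diffQ h w (diffQ h w' (testLp φ hφ)) - testLp _ ((hφ.fderiv w').fderiv w)‖
      ≤ ‖diffQ h w (testLp _ (hφ.fderiv w')) - testLp _ ((hφ.fderiv w').fderiv w)‖
        + h * ‖testLp _ (((hφ.fderiv w').fderiv w).fderiv w')‖ := by
  set g := testLp _ ((hφ.fderiv w').fderiv w) with hg
  set c := ‖diffQ h w (testLp _ (hφ.fderiv w')) - g‖
    + h * ‖testLp _ (((hφ.fderiv w').fderiv w).fderiv w')‖ with hc
  have hD : ∀ s, HasDerivAt (fun s : ℝ => diffQ h w (transl (s • w') (testLp φ hφ)) - s • g)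
      (diffQ h w (transl (s • w') (testLp _ (hφ.fderiv w'))) - g) s := by
    intro s
    have h1 := ((diffQ h w).restrictScalars ℝ).hasFDerivAt.comp_hasDerivAt s
      (hasDerivAt_transl_test hφ w' s)
    have h2 := (hasDerivAt_id s).smul_const g
    rw [one_smul] at h2
    exact h1.sub h2
  have hB : ∀ s ∈ Icc (-h) h, ‖diffQ h w (transl (s • w') (testLp _ (hφ.fderiv w'))) - g‖ ≤ c := by
    intro s hs
    have e : diffQ h w (transl (s • w') (testLp _ (hφ.fderiv w'))) - g
        = transl (s • w') (diffQ h w (testLp _ (hφ.fderiv w')) - g)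
          + (transl (s • w') g - g) := by
      rw [map_sub, transl_diffQ]; abel
    rw [e]
    refine (norm_add_le _ _).trans (add_le_add (norm_transl _ _).le ?_)
    refine (norm_transl_test_sub_le _ w' s).trans ?_
    gcongr
    exact abs_le.2 hs
  have h1 := Convex.norm_image_sub_le_of_norm_hasDerivWithin_le
    (fun s _ => (hD s).hasDerivWithinAt) hB (convex_Icc (-h) h)
    (left_mem_Icc.2 (by linarith)) (right_mem_Icc.2 (by linarith))
  have e : diffQ h w (diffQ h w' (testLp φ hφ)) - g
      = ((2 * h : ℝ) : ℂ)⁻¹ • ((diffQ h w (transl (h • w') (testLp φ hφ)) - h • g)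
        - (diffQ h w (transl ((-h) • w') (testLp φ hφ)) - (-h) • g)) := by
    rw [diffQ_apply h w', map_smul, map_sub]
    have e2 : g = ((2 * h : ℝ) : ℂ)⁻¹ • ((2 * h : ℝ) • g) := by
      rw [RCLike.real_smul_eq_coe_smul (K := ℂ), smul_smul]
      have e3 : ((2 * h : ℝ) : ℂ) ≠ 0 := by exact_mod_cast (show (2 * h : ℝ) ≠ 0 by positivity)
      exact (show (((2 * h : ℝ) : ℂ)⁻¹ * ((2 * h : ℝ) : ℂ)) • g = g by
        rw [inv_mul_cancel₀ e3, one_smul]).symm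
    conv_lhs => rw [e2]
    rw [← smul_sub]
    congr 1
    rw [neg_smul, neg_smul, two_mul, add_smul]; abel
  rw [e, norm_smul, norm_inv, Complex.norm_real, Real.norm_eq_abs, abs_of_pos (by positivity),
    inv_mul_le_iff₀ (by positivity)]
  refine h1.trans_eq ?_
  rw [Real.norm_eq_abs, abs_of_pos (by linarith)]
  ring

lemma tendsto_diffQ {φ : Phase d → ℂ} (hφ : IsTest φ) (w : Phase d) :
    Tendsto (fun h : ℝ => diffQ h w (testLp φ hφ)) (𝓝[>] 0) (𝓝 (testLp _ (hφ.fderiv w))) := by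
  have h0 := hasDerivAt_transl_test hφ w 0
  rw [zero_smul, transl_zero] at h0
  have hn : HasDerivAt (fun s : ℝ => transl ((-s) • w) (testLp φ hφ))
      (- testLp _ (hφ.fderiv w)) 0 := by
    have h1 : HasDerivAt (fun s : ℝ => transl (s • w) (testLp φ hφ))
      (testLp _ (hφ.fderiv w)) (-0) := by rw [neg_zero]; exact h0
    have := h1.scomp (0 : ℝ) (hasDerivAt_neg' 0)
    rw [neg_one_smul] at this
    exact this
  have h1 := (h0.sub hn).tendsto_slope_zero_right
  have h2 := h1.const_smul ((2 : ℝ)⁻¹)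
  have e : (2 : ℝ)⁻¹ • (testLp _ (hφ.fderiv w) - -testLp _ (hφ.fderiv w))
      = testLp _ (hφ.fderiv w) := by module
  rw [e] at h2
  refine h2.congr fun h => ?_
  rw [diffQ_apply]
  simp only [Pi.sub_apply, zero_add, zero_smul, neg_zero, transl_zero, sub_self, sub_zero,
    neg_smul]
  rw [smul_smul, ← mul_inv, RCLike.real_smul_eq_coe_smul (K := ℂ)]
  push_cast; rfl

lemma tendsto_kinQ {φ : Phase d → ℂ} (hφ : IsTest φ) :
    Tendsto (fun h : ℝ => kinQ h (testLp φ hφ)) (𝓝[>] 0) (𝓝 (testLp _ hφ.kinetic)) := by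
  rw [testLp_kinetic hφ]
  simp only [kinQ_apply]
  refine tendsto_finsetSum _ fun i _ => ?_
  rw [tendsto_iff_norm_sub_tendsto_zero]
  have h1 : Tendsto (fun h : ℝ => ‖diffQ h (dirX i) (testLp _ (hφ.fderiv (dirV i)))
        - testLp _ ((hφ.fderiv (dirV i)).fderiv (dirX i))‖
      + h * ‖testLp _ (((hφ.fderiv (dirV i)).fderiv (dirX i)).fderiv (dirV i))‖)
      (𝓝[>] 0) (𝓝 (0 + 0 * _)) :=
    (tendsto_iff_norm_sub_tendsto_zero.1 (tendsto_diffQ (hφ.fderiv (dirV i)) (dirX i))).add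
      ((tendsto_nhdsWithin_of_tendsto_nhds tendsto_id).mul_const _)
  rw [zero_mul, add_zero] at h1
  refine squeeze_zero' (.of_forall fun _ => norm_nonneg _) ?_ h1
  filter_upwards [self_mem_nhdsWithin] with h hh
  exact norm_diffQ_comp_sub_le hφ _ _ hh

/-! ### Sums of multipliers -/

lemma IsMult.const (c : ℝ) : IsMult (fun _ : Phase d => c) := ⟨measurable_const, |c|, fun _ => le_rfl⟩

lemma IsMult.abs {m : Phase d → ℝ} (hm : IsMult m) : IsMult (fun z => |m z|) :=
  ⟨hm.1.abs, hm.2.imp fun C h z => by rw [abs_abs]; exact h z⟩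

lemma IsMult.const_mul {m : Phase d → ℝ} (hm : IsMult m) (c : ℝ) : IsMult (fun z => c * m z) := by
  obtain ⟨h1, C, hC⟩ := hm
  refine ⟨h1.const_mul c, |c| * C, fun z => ?_⟩
  rw [abs_mul]
  exact mul_le_mul_of_nonneg_left (hC z) (abs_nonneg c)

lemma IsMult.sum {ι : Type*} (s : Finset ι) {n : ι → Phase d → ℝ} (hn : ∀ i, IsMult (n i)) :
    IsMult (fun z => ∑ i ∈ s, n i z) := by
  refine ⟨Finset.measurable_sum _ fun i _ => (hn i).1, ?_⟩
  choose C hC using fun i => (hn i).2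
  exact ⟨∑ i ∈ s, C i, fun z => (Finset.abs_sum_le_sum_abs _ _).trans
    (Finset.sum_le_sum fun i _ => hC i z)⟩

lemma norm_mulOp_le_add {m n n' : Phase d → ℝ} (hm : IsMult m) (hn : IsMult n) (hn' : IsMult n')
    (h : ∀ z, |m z| ≤ |n z| + |n' z|) (a : L2 d) :
    ‖mulOp m a‖ ≤ ‖mulOp n a‖ + ‖mulOp n' a‖ := by
  have h1 : ‖mulOp m a‖ ≤ ‖mulOp (fun z => |n z|) a + mulOp (fun z => |n' z|) a‖ := by
    refine Lp.norm_le_norm_of_ae_le ?_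
    filter_upwards [mulOp_coe hm a, mulOp_coe hn.abs a, mulOp_coe hn'.abs a,
      Lp.coeFn_add (mulOp (fun z => |n z|) a) (mulOp (fun z => |n' z|) a)] with z h1 h2 h3 h4
    rw [h1, h4, Pi.add_apply, h2, h3, ← add_mul, norm_mul, norm_mul, ← Complex.ofReal_add,
      Complex.norm_real, Complex.norm_real, Real.norm_eq_abs, Real.norm_eq_abs,
      abs_of_nonneg (a := |n z| + |n' z|) (by positivity)]
    exact mul_le_mul_of_nonneg_right (h z) (norm_nonneg _)
  refine h1.trans ((norm_add_le _ _).trans (add_le_add ?_ ?_))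
  · exact norm_mulOp_le_mulOp hn.abs hn (fun z => (abs_abs _).le) a
  · exact norm_mulOp_le_mulOp hn'.abs hn' (fun z => (abs_abs _).le) a

lemma norm_mulOp_le_sum {ι : Type*} (s : Finset ι) {n : ι → Phase d → ℝ} (hn : ∀ i, IsMult (n i))
    {m : Phase d → ℝ} (hm : IsMult m) (h : ∀ z, |m z| ≤ ∑ i ∈ s, |n i z|) (a : L2 d) :
    ‖mulOp m a‖ ≤ ∑ i ∈ s, ‖mulOp (n i) a‖ := by
  classical
  induction s using Finset.induction_on generalizing m with
  | empty =>
    simp only [Finset.sum_empty] at h ⊢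
    exact (norm_mulOp_le hm h a).trans_eq (zero_mul _)
  | insert i s his ih =>
    simp only [Finset.sum_insert his] at h ⊢
    have hs : IsMult (fun z => ∑ i ∈ s, |n i z|) := IsMult.sum s fun i => (hn i).abs
    have hs0 : ∀ z, |(∑ i ∈ s, |n i z|)| = ∑ i ∈ s, |n i z| := fun z =>
      abs_of_nonneg (Finset.sum_nonneg fun i _ => abs_nonneg _)
    refine (norm_mulOp_le_add hm (hn i) hs (fun z => ?_) a).trans (by
      gcongr; exact ih hs fun z => (hs0 z).le)
    rw [hs0]; exact h z

lemma norm_mulOp_const_mul_le {m : Phase d → ℝ} (hm : IsMult m) {c : ℝ} (hc : 0 ≤ c) (a : L2 d) :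
    ‖mulOp (fun z => c * m z) a‖ ≤ c * ‖mulOp m a‖ := by
  refine Lp.norm_le_mul_norm_of_ae_le_mul ?_
  filter_upwards [mulOp_coe hm a, mulOp_coe (hm.const_mul c) a] with z h1 h2
  rw [h1, h2, Complex.ofReal_mul, mul_assoc, norm_mul, Complex.norm_real, Real.norm_eq_abs,
    abs_of_nonneg hc]

lemma norm_mulOp_le_moments {m : Phase d → ℝ} (hm : IsMult m) {A B R : ℝ} (hA : 0 ≤ A) (hB : 0 ≤ B)
    (hR : 0 ≤ R) (h : ∀ z, |m z| ≤ A * ∑ j, |clampV R j z| + B) (a : L2 d) :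
    ‖mulOp m a‖ ≤ A * ∑ j, ‖mulOp (clampV R j) a‖ + B * ‖a‖ := by
  have hs : IsMult (fun z : Phase d => ∑ j, |A * clampV R j z|) :=
    IsMult.sum _ fun j => ((isMult_clampV hR j).const_mul A).abs
  have hs0 : ∀ z : Phase d, |(∑ j, |A * clampV R j z|)| = ∑ j, |A * clampV R j z| := fun z =>
    abs_of_nonneg (Finset.sum_nonneg fun i _ => abs_nonneg _)
  refine (norm_mulOp_le_add hm hs (IsMult.const B) (fun z => ?_) a).trans (add_le_add ?_ ?_)
  · rw [hs0, abs_of_nonneg hB]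
    simp only [abs_mul, abs_of_nonneg hA, ← Finset.mul_sum]
    exact h z
  · rw [Finset.mul_sum]
    refine (norm_mulOp_le_sum _ (fun j => (isMult_clampV hR j).const_mul A) hs
      (fun z => (hs0 z).le) a).trans (Finset.sum_le_sum fun j _ => ?_)
    exact norm_mulOp_const_mul_le (isMult_clampV hR j) hA a
  · exact norm_mulOp_le (IsMult.const B) (fun z => (abs_of_nonneg hB).le) a

lemma norm_le_sum_abs (x : Space d) : ‖x‖ ≤ ∑ j, |x j| := by
  rw [EuclideanSpace.norm_eq, Real.sqrt_le_iff]
  refine ⟨Finset.sum_nonneg fun _ _ => abs_nonneg _, ?_⟩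
  exact Finset.sum_sq_le_sq_sum_of_nonneg fun _ _ => abs_nonneg _

/-! ### Admissible time dependent potentials -/

/-- Time dependent potentials of linear growth in `ξ`, Lipschitz in `x`, continuous in time. -/
structure AdmPot (V : ℝ → Phase d → ℝ) (A β μ : ℝ) : Prop where
  measurable : ∀ t, 0 ≤ t → Measurable (V t)
  growth : ∀ T, ∃ M, 0 ≤ M ∧ ∀ t ∈ Icc 0 T, ∀ z, |V t z| ≤ M * (1 + ‖z.2‖)
  shift : ∀ t, 0 ≤ t → ∀ (i : Fin d) (s : ℝ) z,
    |V t (z + s • dirX i) - V t z| ≤ |s| * (A * ‖z.2‖ + β * Real.exp (μ * t))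
  cont : ∀ t, 0 ≤ t → ∀ ε > 0, ∃ δ > 0, ∀ s, 0 ≤ s → |s - t| < δ →
    ∀ z, |V s z - V t z| ≤ ε * (1 + ‖z.2‖)

/-- The potential `V` cut off to `|ξ| ≤ R` and frozen outside the time interval `[0, T]`. -/
def cutPot (V : ℝ → Phase d → ℝ) (R T t : ℝ) (z : Phase d) : ℝ :=
  {z : Phase d | ‖z.2‖ ≤ R}.indicator (V (max 0 (min t T))) z

section Cut

variable {V : ℝ → Phase d → ℝ} {A β μ R T t h : ℝ}

lemma measurableSet_cut (R : ℝ) : MeasurableSet {z : Phase d | ‖z.2‖ ≤ R} :=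
  measurableSet_le (by fun_prop) measurable_const

lemma abs_cutPot_le (hT : 0 ≤ T) {M : ℝ} (hM0 : 0 ≤ M) (hR : 0 ≤ R)
    (hM : ∀ t ∈ Icc 0 T, ∀ z, |V t z| ≤ M * (1 + ‖z.2‖)) (z : Phase d) :
    |cutPot V R T t z| ≤ M * (1 + R) := by
  rw [cutPot, indicator]
  split_ifs with hz
  · refine (hM _ ⟨le_max_left _ _, max_le hT (min_le_right _ _)⟩ z).trans ?_
    have : ‖z.2‖ ≤ R := hz
    gcongr
  · rw [abs_zero]; positivity

lemma AdmPot.isMult_cutPot (hV : AdmPot V A β μ) (hT : 0 ≤ T) (hR : 0 ≤ R) (t : ℝ) :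
    IsMult (cutPot V R T t) := by
  obtain ⟨M, hM0, hM⟩ := hV.growth T
  exact ⟨(hV.measurable _ (le_max_left _ _)).indicator (measurableSet_cut R), M * (1 + R),
    abs_cutPot_le hT hM0 hR hM⟩

lemma AdmPot.continuous_cutPot (hV : AdmPot V A β μ) (hT : 0 ≤ T) (hR : 0 ≤ R) :
    Continuous fun t => mulOp (cutPot V R T t) := by
  rw [continuous_iff_continuousAt]
  intro t
  have h0 : Continuous fun t : ℝ => max 0 (min t T) := by fun_prop
  rw [ContinuousAt, Metric.tendsto_nhds]
  intro ε hε
  obtain ⟨δ, hδ, h1⟩ := hV.cont (max 0 (min t T)) (le_max_left _ _) (ε / (2 * (1 + R)))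
    (by positivity)
  filter_upwards [h0.continuousAt.eventually (Metric.ball_mem_nhds _ hδ)] with s hs
  rw [dist_eq_norm]
  refine lt_of_le_of_lt (ContinuousLinearMap.opNorm_le_bound _ (half_pos hε).le fun a => ?_)
    (half_lt_self hε)
  have hs' := hV.isMult_cutPot hT hR s
  have ht' := hV.isMult_cutPot hT hR t
  rw [sub_apply, ← mulOp_sub hs' ht']
  refine norm_mulOp_le (hs'.sub ht') (fun z => ?_) a
  rw [cutPot, cutPot, indicator, indicator]
  split_ifs with hz
  · refine (h1 _ (le_max_left _ _) hs z).trans ?_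
    have : ‖z.2‖ ≤ R := hz
    calc _ ≤ ε / (2 * (1 + R)) * (1 + R) := by gcongr
      _ = ε / 2 := by field_simp
  · rw [sub_zero, abs_zero]; positivity

/-- A shift in x does not affect the cutoff. Truncating V and the coordinates at the same R makes
|ξ| ≤ ∑ |`clampV R j`| wherever the cut potential is nonzero, so the estimate closes on the
truncated moments. -/
lemma AdmPot.abs_cutPot_shift_le (hV : AdmPot V A β μ) (hA : 0 ≤ A) (hβ : 0 ≤ β)
    (ht : t ∈ Icc 0 T) (i : Fin d) (s : ℝ) (z : Phase d) :
    |cutPot V R T t (z + s • dirX i) - cutPot V R T t z|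
      ≤ |s| * A * ∑ j, |clampV R j z| + |s| * (β * Real.exp (μ * t)) := by
  have e : max 0 (min t T) = t := by rw [min_eq_left ht.2, max_eq_right ht.1]
  have e2 : (z + s • dirX i).2 = z.2 := by simp [dirX]
  rw [cutPot, cutPot, indicator, indicator, e]
  simp only [mem_ofPred_eq, e2]
  split_ifs with hz
  · refine (hV.shift t ht.1 i s z).trans ?_
    have h1 : ‖z.2‖ ≤ ∑ j, |clampV R j z| := by
      refine (norm_le_sum_abs z.2).trans_eq (Finset.sum_congr rfl fun j _ => ?_)
      rw [clampV_of_le]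
      have := PiLp.norm_apply_le z.2 j
      rw [Real.norm_eq_abs] at this
      exact this.trans hz
    rw [mul_assoc, ← mul_add]
    gcongr
  · rw [sub_zero, abs_zero]
    have : 0 ≤ ∑ j, |clampV R j z| := Finset.sum_nonneg fun _ _ => abs_nonneg _
    positivity

/-! ### The regularized linear equation and its uniform bounds -/

/-- The generator of the regularized linear equation. -/
def genQ (V : ℝ → Phase d → ℝ) (h R T t : ℝ) : L2 d →L[ℂ] L2 d := kinQ h + mulOp (cutPot V R T t)

lemma AdmPot.inner_genQ (hV : AdmPot V A β μ) (hT : 0 ≤ T) (hR : 0 ≤ R) (a b : L2 d) :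
    inner ℂ (genQ V h R T t a) b = inner ℂ a (genQ V h R T t b) := by
  rw [genQ, add_apply, add_apply, inner_add_left,
    inner_add_right, inner_kinQ, inner_mulOp (hV.isMult_cutPot hT hR t)]

/-- `u` solves the regularized linear equation. -/
def IsApprox (V : ℝ → Phase d → ℝ) (h R T : ℝ) (u : ℝ → L2 d) : Prop :=
  ∀ t, HasDerivAt u (-Complex.I • genQ V h R T t (u t)) t

lemma AdmPot.exists_isApprox (hV : AdmPot V A β μ) (hT : 0 ≤ T) (hR : 0 ≤ R) (h : ℝ) (a₀ : L2 d) :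
    ∃ u, u 0 = a₀ ∧ IsApprox V h R T u := by
  obtain ⟨M, hM0, hM⟩ := hV.growth T
  have h1 : ∀ t, ‖-Complex.I • genQ V h R T t‖ ≤ ‖(kinQ h : L2 d →L[ℂ] L2 d)‖ + M * (1 + R) := by
    intro t
    rw [norm_smul, norm_neg, Complex.norm_I, one_mul]
    refine (norm_add_le _ _).trans (add_le_add le_rfl ?_)
    exact ContinuousLinearMap.opNorm_le_bound _ (by positivity) fun a =>
      norm_mulOp_le (hV.isMult_cutPot hT hR t) (abs_cutPot_le hT hM0 hR hM) a
  exact exists_linear_ode (B := fun t => -Complex.I • genQ V h R T t)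
    ((continuous_const.add (hV.continuous_cutPot hT hR)).const_smul (-Complex.I)) h1 a₀

variable {u : ℝ → L2 d}

lemma IsApprox.norm_eq (hu : IsApprox V h R T u) (hV : AdmPot V A β μ) (hT : 0 ≤ T) (hR : 0 ≤ R)
    (t : ℝ) : ‖u t‖ = ‖u 0‖ := by
  have h1 : ∀ t, HasDerivAt (fun s => ‖u s‖ ^ 2) 0 t := by
    intro t
    refine (hasDerivAt_norm_sq_of_symm (S := ContinuousLinearMap.id ℂ (L2 d))
      (hV.inner_genQ hT hR) (hu t)).congr_deriv ?_
    simp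
  have h2 := is_const_of_deriv_eq_zero (fun t => (h1 t).differentiableAt) (fun t => (h1 t).deriv)
    t 0
  exact (pow_left_inj₀ (norm_nonneg _) (norm_nonneg _) two_ne_zero).1 h2

/-- Multiplication by the truncated coordinate commutes with the potential, so only the kinetic
commutator contributes. -/
lemma IsApprox.moment_deriv (hu : IsApprox V h R T u) (hV : AdmPot V A β μ) (hT : 0 ≤ T)
    (hR : 0 ≤ R) (hh : 0 < h) (i : Fin d) (t : ℝ) :
    ∃ f', HasDerivAt (fun s => ‖mulOp (clampV R i) (u s)‖ ^ 2) f' t ∧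
      f' ≤ 2 * ‖mulOp (clampV R i) (u t)‖ * ‖diffQ h (dirX i) (u t)‖ := by
  refine ⟨_, hasDerivAt_norm_sq_of_symm (S := mulOp (clampV R i)) (hV.inner_genQ hT hR) (hu t), ?_⟩
  rw [mul_assoc]
  refine mul_le_mul_of_nonneg_left ?_ zero_le_two
  refine (le_abs_self _).trans ((Complex.abs_im_le_norm _).trans ((norm_inner_le_norm _ _).trans ?_))
  refine mul_le_mul_of_nonneg_left ?_ (norm_nonneg _)
  have e : mulOp (clampV R i) (genQ V h R T t (u t)) - genQ V h R T t (mulOp (clampV R i) (u t))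
      = mulOp (clampV R i) (kinQ h (u t)) - kinQ h (mulOp (clampV R i) (u t)) := by
    rw [genQ, add_apply, add_apply, map_add,
      mulOp_mulOp_comm (isMult_clampV hR i) (hV.isMult_cutPot hT hR t)]
    abel
  rw [e]
  exact norm_clampV_kinQ_le hR i hh _

/-- Translations commute with `kinQ`, so only the x-increment of the potential contributes; it is
estimated by the moments and the norm of u, the latter being conserved. -/
lemma IsApprox.shift_deriv (hu : IsApprox V h R T u) (hV : AdmPot V A β μ) (hR : 0 ≤ R)
    (hA : 0 ≤ A) (hβ : 0 ≤ β) (i : Fin d) (s : ℝ) (ht : t ∈ Icc 0 T) :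
    ∃ f', HasDerivAt (fun r => ‖transl (s • dirX i) (u r) - u r‖ ^ 2) f' t ∧
      f' ≤ 2 * ‖transl (s • dirX i) (u t) - u t‖ * (|s| *
        (A * ∑ j, ‖mulOp (clampV R j) (u t)‖ + β * ‖u 0‖ * Real.exp (μ * t))) := by
  have hT : 0 ≤ T := ht.1.trans ht.2
  let S : L2 d →L[ℂ] L2 d :=
    (transl (s • dirX i)).toContinuousLinearMap - ContinuousLinearMap.id ℂ _
  have hS : ∀ a, S a = transl (s • dirX i) a - a := fun a => rfl
  have h1 := hasDerivAt_norm_sq_of_symm (S := S) (hV.inner_genQ hT hR) (hu t)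
  simp only [hS] at h1
  refine ⟨_, h1, ?_⟩
  rw [mul_assoc]
  refine mul_le_mul_of_nonneg_left ?_ zero_le_two
  refine (le_abs_self _).trans ((Complex.abs_im_le_norm _).trans ((norm_inner_le_norm _ _).trans ?_))
  refine mul_le_mul_of_nonneg_left ?_ (norm_nonneg _)
  have hm := hV.isMult_cutPot hT hR t
  have e : transl (s • dirX i) (genQ V h R T t (u t)) - genQ V h R T t (u t)
      - genQ V h R T t (transl (s • dirX i) (u t) - u t)
      = mulOp (fun z => cutPot V R T t (z + s • dirX i) - cutPot V R T t z)
        (transl (s • dirX i) (u t)) := by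
    rw [mulOp_sub (hm.shift _) hm, ← transl_mulOp hm, map_sub, genQ, add_apply,
      add_apply, map_add, transl_kinQ]
    abel
  rw [e]
  refine (norm_mulOp_le_moments ((hm.shift _).sub hm) (by positivity) (by positivity) hR
    (hV.abs_cutPot_shift_le hA hβ ht i s) _).trans (le_of_eq ?_)
  have e2 : ∀ j, ‖mulOp (clampV R j) (transl (s • dirX i) (u t))‖ = ‖mulOp (clampV R j) (u t)‖ := by
    intro j
    have e3 : (fun z : Phase d => clampV R j (z + s • dirX i)) = clampV R j := by
      funext z; simp [clampV, dirX]
    have e4 := transl_mulOp (isMult_clampV hR j) (s • dirX i) (u t)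
    rw [e3] at e4
    rw [← e4, norm_transl]
  simp only [e2, norm_transl, hu.norm_eq hV hT hR t]
  ring

/-- The a priori bounds for the regularized equation, uniform in the regularization. -/
lemma IsApprox.reg (hu : IsApprox V h R T u) (hV : AdmPot V A β μ) (hR : 0 ≤ R) (hh : 0 < h)
    (hA : 0 ≤ A) (hβ : 0 ≤ β) {Y C₀ : ℝ} (h0 : Reg C₀ (u 0)) (hY : (2 * d + 1) * C₀ ≤ Y)
    (hβY : β * ‖u 0‖ ≤ A * Y) (hμ : 1 + A * (2 * d + 1) ≤ μ) (ht : t ∈ Icc 0 T) :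
    (∀ (i : Fin d) (s : ℝ), ‖transl (s • dirX i) (u t) - u t‖ ≤ Y * Real.exp (μ * t) * |s|) ∧
      ∀ i, ‖mulOp (clampV R i) (u t)‖ ≤ Y * Real.exp (μ * t) := by
  have hT : 0 ≤ T := ht.1.trans ht.2
  have hC := h0.nonneg
  have hd : (0 : ℝ) ≤ d := d.cast_nonneg
  have hCY : C₀ ≤ Y := by nlinarith
  have hY0 : 0 ≤ Y := hC.trans hCY
  have hexp : ∀ t : ℝ, Real.exp (2 * μ * t) = Real.exp (μ * t) ^ 2 := fun t => by
    rw [← Real.exp_nat_mul]; congr 1; push_cast; ring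
  choose p hp hp' using fun i => hu.moment_deriv hV hT hR hh i
  choose! q hq hq' using fun i s t => hu.shift_deriv (t := t) hV hR hA hβ i s
  -- The moment estimate involves the difference quotient of step h, which is the increment with s =
  -- 2h; this choice closes the system.
  have hX : ∀ i t, ‖diffQ h (dirX i) (u t)‖ ^ 2
      = ((2 * h) ^ 2)⁻¹ * ‖transl ((2 * h) • dirX i) (u t) - u t‖ ^ 2 := fun i t => by
    rw [norm_diffQ hh, div_pow]; ring
  have hZ : ∀ t ∈ Icc 0 T, ∑ i, (‖mulOp (clampV R i) (u t)‖ ^ 2 + ‖diffQ h (dirX i) (u t)‖ ^ 2)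
      ≤ Y ^ 2 * Real.exp (2 * μ * t) := by
    intro t ht
    -- By 2xy ≤ x² + y², the sum over i has coefficient 1 + A(d + 1) on the squared quotients and 1
    -- + dA on the squared moments. The source is dA Y² e^{2μt}.
    have := le_exp_of_deriv_le (k := 1 + A * (d + 1)) (κ := 2 * μ) (b := Y ^ 2) (δ := 0) (T := T)
      (f := fun t => ∑ i, (‖mulOp (clampV R i) (u t)‖ ^ 2 + ‖diffQ h (dirX i) (u t)‖ ^ 2))
      (f' := fun t => ∑ i, (p i t + ((2 * h) ^ 2)⁻¹ * q i (2 * h) t))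
      (by positivity) le_rfl ?_ ?_ ?_ ht
    · simpa using this
    · intro t ht
      simp only [hX]
      exact HasDerivWithinAt.fun_sum fun i _ =>
        ((hp i t).add ((hq i (2 * h) t ht).const_mul _)).hasDerivWithinAt
    · intro t ht
      set E := Real.exp (μ * t) with hE
      set P := fun i => ‖mulOp (clampV R i) (u t)‖ with hP
      set X := fun i => ‖diffQ h (dirX i) (u t)‖ with hXd
      have hE0 : 0 < E := Real.exp_pos _
      have h1 : ∀ i, p i t + ((2 * h) ^ 2)⁻¹ * q i (2 * h) t
          ≤ (1 + A * (d + 1)) * X i ^ 2 + P i ^ 2 + A * ∑ j, P j ^ 2 + A * (Y ^ 2 * E ^ 2) := by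
        intro i
        have e1 := hp' i t
        have e2 := hq' i (2 * h) t ht
        have e3 : ((2 * h) ^ 2)⁻¹ * q i (2 * h) t
            ≤ 2 * X i * (A * ∑ j, P j + β * ‖u 0‖ * E) := by
          refine (mul_le_mul_of_nonneg_left e2 (by positivity)).trans (le_of_eq ?_)
          simp only [hXd, norm_diffQ hh]
          rw [abs_of_pos (by positivity : 0 < 2 * h)]
          field_simp
          rfl
        have hP0 : 0 ≤ P i := norm_nonneg _
        have hX0 : 0 ≤ X i := norm_nonneg _
        have e4 : 2 * X i * (A * ∑ j, P j) ≤ A * ∑ j, (X i ^ 2 + P j ^ 2) := by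
          have : 2 * X i * (A * ∑ j, P j) = A * ∑ j, 2 * X i * P j := by
            rw [← Finset.mul_sum]; ring
          rw [this]
          gcongr with j
          nlinarith [sq_nonneg (X i - P j)]
        rw [Finset.sum_add_distrib, Finset.sum_const, Finset.card_univ, Fintype.card_fin,
          nsmul_eq_mul] at e4
        have e5 : 2 * X i * (β * ‖u 0‖ * E) ≤ A * (X i ^ 2 + Y ^ 2 * E ^ 2) := by
          calc 2 * X i * (β * ‖u 0‖ * E) ≤ 2 * X i * (A * Y * E) := by gcongr
            _ = A * (2 * X i * (Y * E)) := by ring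
            _ ≤ A * (X i ^ 2 + Y ^ 2 * E ^ 2) := by
              gcongr; nlinarith [sq_nonneg (X i - Y * E)]
        have e6 : 2 * P i * X i ≤ P i ^ 2 + X i ^ 2 := by nlinarith [sq_nonneg (X i - P i)]
        have e1' : p i t ≤ 2 * P i * X i := e1
        nlinarith
      refine (Finset.sum_le_sum fun i _ => h1 i).trans ?_
      simp only [Finset.sum_add_distrib, Finset.sum_const, Finset.card_univ, Fintype.card_fin,
        nsmul_eq_mul, ← Finset.mul_sum]
      rw [hexp, ← hE]
      have hSX : 0 ≤ ∑ i, X i ^ 2 := Finset.sum_nonneg fun _ _ => sq_nonneg _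
      have hSP : 0 ≤ ∑ i, P i ^ 2 := Finset.sum_nonneg fun _ _ => sq_nonneg _
      -- This is where the lower bound on μ enters: 2μ - k ≥ dA.
      have h2 : d * A * (Y ^ 2 * E ^ 2) ≤ (2 * μ - (1 + A * (d + 1))) * (Y ^ 2 * E ^ 2) := by
        gcongr
        nlinarith [mul_nonneg hA hd]
      nlinarith [mul_nonneg hA hSP]
    · refine (Finset.sum_le_sum (g := fun _ => C₀ ^ 2 + C₀ ^ 2) fun i _ => add_le_add ?_ ?_).trans ?_
      · exact pow_le_pow_left₀ (norm_nonneg _) (h0.moment i R hR) 2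
      · refine pow_le_pow_left₀ (norm_nonneg _) ?_ 2
        rw [norm_diffQ hh, div_le_iff₀ (by positivity)]
        refine (h0.shift i (2 * h)).trans_eq ?_
        rw [abs_of_pos (by positivity : 0 < 2 * h)]
      · simp only [Finset.sum_const, Finset.card_univ, Fintype.card_fin, nsmul_eq_mul]
        have h1 : ((2 * d + 1) * C₀) ^ 2 ≤ Y ^ 2 := pow_le_pow_left₀ (by positivity) hY 2
        nlinarith [mul_nonneg hd (sq_nonneg C₀), mul_nonneg (mul_nonneg hd hd) (sq_nonneg C₀),
          sq_nonneg C₀]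
  have hP : ∀ t ∈ Icc 0 T, ∀ i, ‖mulOp (clampV R i) (u t)‖ ≤ Y * Real.exp (μ * t) := by
    intro t ht i
    refine le_of_sq_le_sq ?_ (by positivity)
    rw [mul_pow, ← hexp]
    refine le_trans ?_ (hZ t ht)
    refine le_trans ?_ (Finset.single_le_sum (fun j _ => by positivity) (Finset.mem_univ i))
    exact le_add_of_nonneg_right (sq_nonneg _)
  refine ⟨fun i s => ?_, hP t ht⟩
  -- With the moments bounded, an increment of arbitrary size s satisfies its own Gronwall
  -- inequality, whose source is proportional to s².
  have := le_exp_of_deriv_le (k := A * (d + 1)) (κ := 2 * μ) (b := s ^ 2 * Y ^ 2) (δ := 0) (T := T)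
    (f := fun t => ‖transl (s • dirX i) (u t) - u t‖ ^ 2) (f' := fun t => q i s t)
    (by positivity) le_rfl (fun t ht => (hq i s t ht).hasDerivWithinAt) ?_ ?_ ht
  · refine le_of_sq_le_sq ?_ (by positivity)
    refine this.trans_eq ?_
    rw [hexp, mul_pow, mul_pow, sq_abs]; ring
  · intro t ht
    refine (hq' i s t ht).trans ?_
    set E := Real.exp (μ * t) with hE
    set D := ‖transl (s • dirX i) (u t) - u t‖ with hD
    have hD0 : 0 ≤ D := norm_nonneg _
    have hE0 : 0 < E := Real.exp_pos _
    have h1 : ∑ j, ‖mulOp (clampV R j) (u t)‖ ≤ d * (Y * E) := by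
      refine (Finset.sum_le_sum fun j _ => hP t ht j).trans_eq ?_
      rw [Finset.sum_const, Finset.card_univ, Fintype.card_fin, nsmul_eq_mul]
    have h2 : A * ∑ j, ‖mulOp (clampV R j) (u t)‖ + β * ‖u 0‖ * E ≤ A * (d + 1) * (Y * E) := by
      have e1 := mul_le_mul_of_nonneg_left h1 hA
      have e2 := mul_le_mul_of_nonneg_right hβY hE0.le
      nlinarith
    rw [hexp, ← hE]
    have h3 : 2 * D * (|s| * (A * (d + 1) * (Y * E)))
        ≤ A * (d + 1) * D ^ 2 + A * (d + 1) * (s ^ 2 * Y ^ 2 * E ^ 2) := by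
      have e1 : 2 * D * (|s| * (Y * E)) ≤ D ^ 2 + s ^ 2 * Y ^ 2 * E ^ 2 := by
        have e0 : (D - |s| * (Y * E)) ^ 2 = D ^ 2 - 2 * D * (|s| * (Y * E)) + s ^ 2 * Y ^ 2 * E ^ 2 := by
          rw [← sq_abs s]; ring
        linarith [sq_nonneg (D - |s| * (Y * E))]
      have e2 := mul_le_mul_of_nonneg_left e1 (show 0 ≤ A * (d + 1) by positivity)
      calc _ = A * (d + 1) * (2 * D * (|s| * (Y * E))) := by ring
        _ ≤ _ := e2
        _ = _ := by ring
    have h4 : A * (d + 1) * (s ^ 2 * Y ^ 2 * E ^ 2)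
        ≤ (2 * μ - A * (d + 1)) * (s ^ 2 * Y ^ 2 * E ^ 2) := by
      gcongr
      nlinarith [mul_nonneg hA hd]
    have h5 : 2 * D * (|s| * (A * ∑ j, ‖mulOp (clampV R j) (u t)‖ + β * ‖u 0‖ * E))
        ≤ 2 * D * (|s| * (A * (d + 1) * (Y * E))) := by gcongr
    linarith
  · refine (pow_le_pow_left₀ (norm_nonneg _) (h0.shift i s) 2).trans ?_
    rw [mul_pow, sq_abs, mul_comm]
    gcongr

end Cut

/-! ### Potentials acting on test functions -/

lemma IsTest.exists_support {φ : Phase d → ℂ} (h : IsTest φ) :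
    ∃ ρ : ℝ, 0 ≤ ρ ∧ ∀ z, ρ < ‖z.2‖ → φ z = 0 := by
  obtain ⟨ρ, hρ0, hρ⟩ := h.2.isBounded.exists_pos_norm_le
  refine ⟨ρ, hρ0.le, fun z hz => ?_⟩
  by_contra hne
  have h1 := hρ z (subset_tsupport _ hne)
  exact absurd ((norm_snd_le z).trans h1) (not_le.2 hz)

lemma IsTest.exists_reg {φ : Phase d → ℂ} (h : IsTest φ) : ∃ C, Reg C (testLp φ h) := by
  obtain ⟨ρ, hρ0, hρ⟩ := h.exists_support
  have hs : ∀ i : Fin d, ‖testLp _ (h.fderiv (dirX i))‖ ≤ ∑ i, ‖testLp _ (h.fderiv (dirX i))‖ :=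
    fun i => Finset.single_le_sum (f := fun i => ‖testLp _ (h.fderiv (dirX i))‖)
      (fun _ _ => norm_nonneg _) (Finset.mem_univ i)
  have hs0 : 0 ≤ ∑ i : Fin d, ‖testLp _ (h.fderiv (dirX i))‖ :=
    Finset.sum_nonneg fun _ _ => norm_nonneg _
  have hn := norm_nonneg (testLp φ h)
  refine ⟨‖testLp φ h‖ + ρ * ‖testLp φ h‖ + ∑ i, ‖testLp _ (h.fderiv (dirX i))‖, ?_, ?_, ?_⟩
  · nlinarith
  · intro i t
    refine (norm_transl_test_sub_le h _ t).trans ?_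
    rw [mul_comm]
    gcongr
    nlinarith [hs i]
  · intro i R hR
    have h1 : ‖mulOp (clampV R i) (testLp φ h)‖ ≤ ρ * ‖testLp φ h‖ := by
      refine Lp.norm_le_mul_norm_of_ae_le_mul ?_
      filter_upwards [mulOp_coe (isMult_clampV hR i) (testLp φ h), testLp_coe h] with z h1 h2
      rw [h1, norm_mul, Complex.norm_real]
      by_cases hz : ρ < ‖z.2‖
      · rw [h2, hρ z hz]; simp
      · refine mul_le_mul_of_nonneg_right ?_ (norm_nonneg _)
        exact (abs_clampV_le_abs hR i z).trans ((PiLp.norm_apply_le z.2 i).trans (not_lt.1 hz))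
    nlinarith

section potMul

variable {V W : Phase d → ℝ} {M M' C C' : ℝ} {a b : L2 d}

lemma inner_potMul (hV : Measurable V) (hM : ∀ z, |V z| ≤ M * (1 + ‖z.2‖)) (ha : Reg C a)
    (hb : Reg C' b) : inner ℂ (potMul V a) b = inner ℂ a (potMul V b) := by
  rw [inner_eq_integral, inner_eq_integral]
  refine integral_congr_ae ?_
  filter_upwards [potMul_coe hV hM ha, potMul_coe hV hM hb] with z h1 h2
  rw [h1, h2, map_mul, Complex.conj_ofReal]; ring

lemma potMul_sub_left (hV : Measurable V) (hM : ∀ z, |V z| ≤ M * (1 + ‖z.2‖)) (hW : Measurable W)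
    (hM' : ∀ z, |W z| ≤ M' * (1 + ‖z.2‖)) (ha : Reg C a) :
    potMul (fun z => V z - W z) a = potMul V a - potMul W a := by
  have h : ∀ z : Phase d, |V z - W z| ≤ (M + M') * (1 + ‖z.2‖) := fun z => by
    rw [add_mul]; exact (abs_sub _ _).trans (add_le_add (hM z) (hM' z))
  apply Lp.ext
  filter_upwards [potMul_coe hV hM ha, potMul_coe hW hM' ha, potMul_coe (V := fun z => V z - W z) (hV.sub hW) h ha,
    Lp.coeFn_sub (potMul V a) (potMul W a)] with z h1 h2 h3 h4
  rw [h3, h4, Pi.sub_apply, h1, h2]; push_cast; ring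

lemma norm_potMul_sub_le (hV : Measurable V) (hM : ∀ z, |V z| ≤ M * (1 + ‖z.2‖)) (hW : Measurable W)
    (hM' : ∀ z, |W z| ≤ M' * (1 + ‖z.2‖)) (ha : Reg C a) {ε : ℝ} (hε : 0 ≤ ε)
    (h : ∀ z, |V z - W z| ≤ ε * (1 + ‖z.2‖)) :
    ‖potMul V a - potMul W a‖ ≤ ε * ((d + 2) * C) := by
  rw [← potMul_sub_left hV hM hW hM' ha]
  exact norm_potMul_le (hV.sub hW) hε h ha

lemma potMul_sub_right (hV : Measurable V) (hM : ∀ z, |V z| ≤ M * (1 + ‖z.2‖)) (ha : Reg C a)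
    (hb : Reg C' b) : potMul V (a - b) = potMul V a - potMul V b := by
  apply Lp.ext
  filter_upwards [potMul_coe hV hM ha, potMul_coe hV hM hb, potMul_coe hV hM (ha.sub hb),
    Lp.coeFn_sub (potMul V a) (potMul V b), Lp.coeFn_sub a b] with z h1 h2 h3 h4 h5
  rw [h3, h4, Pi.sub_apply, h1, h2, h5, Pi.sub_apply]; ring

end potMul

/-! ### Passage to the limit in the regularized equations -/

section Limit

variable {V : ℝ → Phase d → ℝ} {A β μ : ℝ}

/-- On a test function the cutoff is invisible once it exceeds the support in ξ and the time under
consideration. -/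
lemma AdmPot.mulOp_cutPot_testLp (hV : AdmPot V A β μ) {φ : Phase d → ℂ} (hφ : IsTest φ) {R T t ρ : ℝ}
    (hR : 0 ≤ R) (hρ : ∀ z, ρ < ‖z.2‖ → φ z = 0) (hρR : ρ ≤ R) (ht : t ∈ Icc 0 T) :
    mulOp (cutPot V R T t) (testLp φ hφ) = potMul (V t) (testLp φ hφ) := by
  obtain ⟨C, hC⟩ := hφ.exists_reg
  obtain ⟨M, hM0, hM⟩ := hV.growth T
  have e : max 0 (min t T) = t := by rw [min_eq_left ht.2, max_eq_right ht.1]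
  apply Lp.ext
  filter_upwards [mulOp_coe (hV.isMult_cutPot (ht.1.trans ht.2) hR t) (testLp φ hφ),
    potMul_coe (hV.measurable t ht.1) (hM t ht) hC, testLp_coe hφ] with z h1 h2 h3
  rw [h1, h2, h3, cutPot, indicator, e]
  split_ifs with hz
  · rfl
  · rw [hρ z (hρR.trans_lt (not_le.1 hz))]; simp

/-- The regularization parameters along which the limit is taken. -/
def regPar (n : ℕ) : ℝ := n + 1

lemma regPar_pos (n : ℕ) : 0 < regPar n := by unfold regPar; positivity

lemma tendsto_regPar : Tendsto regPar atTop atTop :=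
  tendsto_atTop_add_const_right _ _ tendsto_natCast_atTop_atTop

/-- The generator along the sequence of regularizations. -/
def genSeq (V : ℝ → Phase d → ℝ) (n : ℕ) (t : ℝ) : L2 d →L[ℂ] L2 d :=
  genQ V (regPar n)⁻¹ (regPar n) (regPar n) t

/-- Consistency on test functions, uniform for times near t: δ comes from the time continuity of V,
and n₀ from the convergence of the difference operators and the removal of the cutoffs. -/
lemma AdmPot.genSeq_testLp (hV : AdmPot V A β μ) {φ : Phase d → ℂ} (hφ : IsTest φ) {t : ℝ}
    (ht : 0 ≤ t) {ε : ℝ} (hε : 0 < ε) : ∃ δ > 0, ∃ n₀, ∀ n ≥ n₀, ∀ r ∈ Ici 0 ∩ Metric.ball t δ,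
      ‖genSeq V n r (testLp φ hφ) - (testLp _ hφ.kinetic + potMul (V t) (testLp φ hφ))‖ ≤ ε := by
  obtain ⟨C, hC⟩ := hφ.exists_reg
  obtain ⟨ρ, hρ0, hρ⟩ := hφ.exists_support
  obtain ⟨M, hM0, hM⟩ := hV.growth (t + 1)
  have hC0 := hC.nonneg
  obtain ⟨δ, hδ, hcont⟩ := hV.cont t ht (ε / (2 * ((d + 2) * C + 1))) (by positivity)
  have h1 : Tendsto (fun n => kinQ (regPar n)⁻¹ (testLp φ hφ)) atTop (𝓝 (testLp _ hφ.kinetic)) := by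
    refine (tendsto_kinQ hφ).comp (tendsto_nhdsWithin_iff.2 ⟨?_, ?_⟩)
    · exact tendsto_inv_atTop_zero.comp tendsto_regPar
    · exact .of_forall fun n => inv_pos.2 (regPar_pos n)
  have h2 := (Metric.tendsto_nhds.1 h1 (ε / 2) (half_pos hε)).and
    (tendsto_regPar.eventually_ge_atTop (max ρ (t + 1)))
  obtain ⟨n₀, hn₀⟩ := eventually_atTop.1 h2
  refine ⟨min δ 1, lt_min hδ one_pos, n₀, fun n hn r ⟨hr0, hr⟩ => ?_⟩
  obtain ⟨h3, h4⟩ := hn₀ n hn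
  rw [Metric.mem_ball, Real.dist_eq, lt_min_iff] at hr
  rw [dist_eq_norm] at h3
  have hr0 : 0 ≤ r := hr0
  have hr1 : r ≤ t + 1 := by linarith [(abs_lt.1 hr.2).2]
  have hr' : r ∈ Icc 0 (t + 1) := ⟨hr0, hr1⟩
  have ht' : t ∈ Icc 0 (t + 1) := ⟨ht, by linarith⟩
  have h5 : genSeq V n r (testLp φ hφ)
      = kinQ (regPar n)⁻¹ (testLp φ hφ) + potMul (V r) (testLp φ hφ) := by
    rw [genSeq, genQ, add_apply, hV.mulOp_cutPot_testLp hφ (regPar_pos n).le hρ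
      ((le_max_left _ _).trans h4) ⟨hr0, hr1.trans ((le_max_right _ _).trans h4)⟩]
  have h6 := norm_potMul_sub_le (hV.measurable r hr0) (hM r hr') (hV.measurable t ht) (hM t ht') hC
    (by positivity) (hcont r hr0 hr.1)
  have h7 : ε / (2 * ((d + 2) * C + 1)) * ((d + 2) * C) ≤ ε / 2 := by
    rw [div_mul_eq_mul_div, div_le_div_iff₀ (by positivity) (by positivity)]
    nlinarith
  rw [h5, add_sub_add_comm]
  refine (norm_add_le _ _).trans ?_
  linarith

variable {u : ℕ → ℝ → L2 d} {m : ℝ}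

lemma inner_genSeq_hasDerivAt (hV : AdmPot V A β μ)
    (hu : ∀ n, IsApprox V (regPar n)⁻¹ (regPar n) (regPar n) (u n)) (φ : L2 d) (n : ℕ) (t : ℝ) :
    HasDerivAt (fun s => inner ℂ φ (u n s)) (-Complex.I * inner ℂ (genSeq V n t φ) (u n t)) t := by
  have h1 := ((innerSL ℂ φ).restrictScalars ℝ).hasFDerivAt.comp_hasDerivAt t (hu n t)
  refine h1.congr_deriv ?_
  have h2 := hV.inner_genQ (h := (regPar n)⁻¹) (t := t) (regPar_pos n).le (regPar_pos n).le φ (u n t)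
  rw [genSeq, h2]
  simp [inner_smul_right]

lemma AdmPot.equiLipschitz (hV : AdmPot V A β μ)
    (hu : ∀ n, IsApprox V (regPar n)⁻¹ (regPar n) (regPar n) (u n)) (hm : ∀ n t, ‖u n t‖ ≤ m)
    {φ : Phase d → ℂ} (hφ : IsTest φ) {t : ℝ} (ht : 0 ≤ t) :
    ∃ L, 0 ≤ L ∧ ∃ δ > 0, ∃ n₀, ∀ n ≥ n₀, ∀ r ∈ Ici 0 ∩ Metric.ball t δ,
      ‖inner ℂ (testLp φ hφ) (u n r - u n t)‖ ≤ L * |r - t| := by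
  obtain ⟨δ, hδ, n₀, h⟩ := hV.genSeq_testLp hφ ht one_pos
  have hm0 : 0 ≤ m := (norm_nonneg _).trans (hm 0 0)
  set ψ := testLp _ hφ.kinetic + potMul (V t) (testLp φ hφ) with hψ
  refine ⟨(1 + ‖ψ‖) * m, by positivity, δ, hδ, n₀, fun n hn r hr => ?_⟩
  have := Convex.norm_image_sub_le_of_norm_hasDerivWithin_le (C := (1 + ‖ψ‖) * m)
    (s := Ici 0 ∩ Metric.ball t δ) (x := t) (y := r)
    (fun s _ => (inner_genSeq_hasDerivAt hV hu (testLp φ hφ) n s).hasDerivWithinAt)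
    (fun s hs => ?_) ((convex_Ici 0).inter (convex_ball t δ)) ⟨ht, Metric.mem_ball_self hδ⟩ hr
  · rw [inner_sub_right]; exact this
  · rw [norm_mul, norm_neg, Complex.norm_I, one_mul]
    refine (norm_inner_le_norm _ _).trans (mul_le_mul ?_ (hm n s) (norm_nonneg _) (by positivity))
    have h1 := h n hn s hs
    have h2 := norm_sub_norm_le (genSeq V n s (testLp φ hφ)) ψ
    linarith

/-- The first order expansion of ⟨φ, u_n⟩ at t holds uniformly in n, and therefore survives the weak
limit at each fixed r. -/
lemma AdmPot.uniform_deriv (hV : AdmPot V A β μ)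
    (hu : ∀ n, IsApprox V (regPar n)⁻¹ (regPar n) (regPar n) (u n)) (hm : ∀ n t, ‖u n t‖ ≤ m)
    {φ : Phase d → ℂ} (hφ : IsTest φ) {t : ℝ} (ht : 0 ≤ t) {ε : ℝ} (hε : 0 < ε) :
    ∃ δ > 0, ∃ n₀, ∀ n ≥ n₀, ∀ r ∈ Ici 0 ∩ Metric.ball t δ,
      ‖inner ℂ (testLp φ hφ) (u n r) - inner ℂ (testLp φ hφ) (u n t) - (r - t) •
        (-Complex.I * inner ℂ (testLp _ hφ.kinetic + potMul (V t) (testLp φ hφ)) (u n t))‖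
        ≤ ε * |r - t| := by
  have hm0 : 0 ≤ m := (norm_nonneg _).trans (hm 0 0)
  set ψ := testLp _ hφ.kinetic + potMul (V t) (testLp φ hφ) with hψ
  set η := ε / (4 * (m + 1)) with hη
  have hη0 : 0 < η := by positivity
  -- The limiting functional ψ contains V φ and need not be a test function; an approximation makes
  -- `AdmPot.equiLipschitz` applicable. The three errors below are at most ε/4, ε/2 and ε/4.
  obtain ⟨χ, hχψ, χ', hχ', rfl⟩ := Metric.dense_iff.1 dense_testLp ψ η hη0
  obtain ⟨δ, hδ, n₀, h⟩ := hV.genSeq_testLp hφ ht hη0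
  obtain ⟨L, hL, δ', hδ', n₀', h'⟩ := hV.equiLipschitz hu hm hχ' ht
  have hηm : η * m ≤ ε / 4 := by
    rw [hη, div_mul_eq_mul_div, div_le_div_iff₀ (by positivity) (by positivity)]
    nlinarith
  refine ⟨min (min δ δ') (ε / (4 * (L + 1))), by positivity, max n₀ n₀', fun n hn r hr => ?_⟩
  have hmem : ∀ s ∈ Ici 0 ∩ Metric.ball t (min (min δ δ') (ε / (4 * (L + 1)))),
      ‖-Complex.I * inner ℂ (genSeq V n s (testLp φ hφ)) (u n s)
        - -Complex.I * inner ℂ ψ (u n t)‖ ≤ ε := by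
    rintro s ⟨hs0, hs⟩
    rw [Metric.mem_ball, lt_min_iff, lt_min_iff] at hs
    have e1 := h n ((le_max_left _ _).trans hn) s ⟨hs0, hs.1.1⟩
    have e2 := h' n ((le_max_right _ _).trans hn) s ⟨hs0, hs.1.2⟩
    have e3 : -Complex.I * inner ℂ (genSeq V n s (testLp φ hφ)) (u n s)
        - -Complex.I * inner ℂ ψ (u n t)
        = -Complex.I * (inner ℂ (genSeq V n s (testLp φ hφ) - ψ) (u n s)
          - inner ℂ (testLp χ' hχ' - ψ) (u n s - u n t)
          + inner ℂ (testLp χ' hχ') (u n s - u n t)) := by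
      simp only [inner_sub_left, inner_sub_right]; ring
    rw [e3, norm_mul, norm_neg, Complex.norm_I, one_mul]
    have e4 : ‖inner ℂ (genSeq V n s (testLp φ hφ) - ψ) (u n s)‖ ≤ η * m :=
      (norm_inner_le_norm _ _).trans (mul_le_mul e1 (hm n s) (norm_nonneg _) hη0.le)
    have e5 : ‖inner ℂ (testLp χ' hχ' - ψ) (u n s - u n t)‖ ≤ η * (2 * m) := by
      refine (norm_inner_le_norm _ _).trans (mul_le_mul ?_ ?_ (norm_nonneg _) hη0.le)
      · rw [← dist_eq_norm]; exact (Metric.mem_ball.1 hχψ).le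
      · refine (norm_sub_le _ _).trans ?_
        linarith [hm n s, hm n t]
    have e6 : L * |s - t| ≤ ε / 4 := by
      have : |s - t| ≤ ε / (4 * (L + 1)) := hs.2.le
      calc L * |s - t| ≤ L * (ε / (4 * (L + 1))) := by gcongr
        _ ≤ (L + 1) * (ε / (4 * (L + 1))) := by gcongr; linarith
        _ = ε / 4 := by field_simp
    refine (norm_add_le _ _).trans ((add_le_add_left (norm_sub_le _ _) _).trans ?_)
    linarith
  have := Convex.norm_image_sub_le_of_norm_hasDerivWithin_le (C := ε) (x := t) (y := r)
    (f := fun s => inner ℂ (testLp φ hφ) (u n s) - s • (-Complex.I * inner ℂ ψ (u n t)))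
    (fun s _ => HasDerivAt.hasDerivWithinAt ((inner_genSeq_hasDerivAt hV hu (testLp φ hφ) n s).sub
      (by simpa using (hasDerivAt_id s).smul_const (-Complex.I * inner ℂ ψ (u n t)))))
    hmem ((convex_Ici 0).inter (convex_ball t _))
    ⟨ht, Metric.mem_ball_self (by positivity)⟩ hr
  rw [Real.norm_eq_abs] at this
  refine le_trans (le_of_eq ?_) this
  congr 1
  rw [sub_smul]; ring

/-- The n-th approximation controls moments truncated at `regPar n`; this transfers the control to
any fixed smaller R. -/
lemma abs_clampV_mono {R R' : ℝ} (hR : 0 ≤ R) (h : R ≤ R') (i : Fin d) (z : Phase d) :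
    |clampV R i z| ≤ |clampV R' i z| := by
  rcases le_total |z.2 i| R with h1 | h1
  · rw [clampV_of_le h1, clampV_of_le (h1.trans h)]
  · have e : |clampV R' i z| = min R' |z.2 i| := by
      rcases le_total |z.2 i| R' with h2 | h2
      · rw [clampV_of_le h2, min_eq_right h2]
      · rw [min_eq_left h2, clampV]
        have hR' := hR.trans h
        rcases le_abs.1 h2 with h3 | h3
        · rw [min_eq_left h3, max_eq_right (by linarith), abs_of_nonneg hR']
        · rw [min_eq_right (by linarith), max_eq_left (by linarith), abs_neg, abs_of_nonneg hR']
    rw [e]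
    exact (abs_clampV_le hR i z).trans (le_min h h1)

/-- Global weak solvability of the linear equation, with propagation of regularity. -/
theorem AdmPot.exists_weakSol (hV : AdmPot V A β μ) (hA : 0 ≤ A) (hβ : 0 ≤ β) {Y C₀ : ℝ} {a₀ : L2 d}
    (h0 : Reg C₀ a₀) (hY : (2 * d + 1) * C₀ ≤ Y) (hβY : β * ‖a₀‖ ≤ A * Y)
    (hμ : 1 + A * (2 * d + 1) ≤ μ) :
    ∃ a : ℝ → L2 d, a 0 = a₀ ∧ (∀ t, 0 ≤ t → ‖a t‖ ≤ ‖a₀‖ ∧ Reg (Y * Real.exp (μ * t)) (a t)) ∧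
      WeakSol a (fun t => potMul (V t) (a t)) := by
  choose u hu0 hu using fun n => hV.exists_isApprox (regPar_pos n).le (regPar_pos n).le
    (regPar n)⁻¹ a₀
  have hm : ∀ n t, ‖u n t‖ ≤ ‖a₀‖ := fun n t => by
    rw [(hu n).norm_eq hV (regPar_pos n).le (regPar_pos n).le t, hu0]
  -- All times use the same ultrafilter, so pairings of `a` at two times are limits along the same
  -- filter.
  choose a ha using fun t => exists_weak_limit (fun n => hm n t)
  have hreg : ∀ n, ∀ t ∈ Icc 0 (regPar n), _ := fun n t ht => (hu n).reg hV (regPar_pos n).le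
    (inv_pos.2 (regPar_pos n)) hA hβ (by rw [hu0]; exact h0) hY (by rw [hu0]; exact hβY) hμ ht
  have hev : ∀ T : ℝ, ∀ᶠ n in (hyperfilter ℕ : Filter ℕ), T ≤ regPar n := fun T =>
    Nat.hyperfilter_le_atTop (tendsto_regPar.eventually_ge_atTop T)
  have hC0 := h0.nonneg
  have hd : (0 : ℝ) ≤ d := d.cast_nonneg
  have hCY : C₀ ≤ Y := by nlinarith
  have hY0 : 0 ≤ Y := hC0.trans hCY
  have hμ0 : 0 ≤ μ := by nlinarith [mul_nonneg hA hd]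
  have hn : ∀ t, ‖a t‖ ≤ ‖a₀‖ := fun t =>
    norm_weak_limit_le (ha t) (.of_forall fun n => hm n t)
  have hR : ∀ t, 0 ≤ t → Reg (Y * Real.exp (μ * t)) (a t) := by
    intro t ht
    refine ⟨?_, fun i s => ?_, fun i R hR => ?_⟩
    · refine (hn t).trans (h0.norm_le.trans (hCY.trans ?_))
      exact le_mul_of_one_le_right hY0 (Real.one_le_exp (by positivity))
    · refine norm_weak_limit_le (l := (hyperfilter ℕ : Filter ℕ))
        (u := fun n => transl (s • dirX i) (u n t) - u n t) (fun φ => ?_)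
        ((hev t).mono fun n h => (hreg n t ⟨ht, h⟩).1 i s)
      · have := (ha t (transl (-(s • dirX i)) φ)).sub (ha t φ)
        simpa only [inner_sub_right, inner_transl_left, neg_neg] using this
    · refine norm_weak_limit_le (l := (hyperfilter ℕ : Filter ℕ))
        (u := fun n => mulOp (clampV R i) (u n t)) (fun φ => ?_) ?_
      rotate_left
      · refine ((hev t).and (hev R)).mono fun n h => ?_
        refine (norm_mulOp_le_mulOp (isMult_clampV hR i) (isMult_clampV (regPar_pos n).le i)
          (fun z => abs_clampV_mono hR h.2 i z) _).trans ((hreg n t ⟨ht, h.1⟩).2 i)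
      · have := ha t (mulOp (clampV R i) φ)
        simpa only [inner_mulOp (isMult_clampV hR i)] using this
  refine ⟨a, ?_, fun t ht => ⟨hn t, hR t ht⟩, fun φ hφ t ht => ?_⟩
  · refine ext_inner_left ℂ fun φ => ?_
    have := ha 0 φ
    simp only [hu0] at this
    exact tendsto_nhds_unique this tendsto_const_nhds
  · obtain ⟨M, hM0, hM⟩ := hV.growth t
    obtain ⟨C, hC⟩ := hφ.exists_reg
    -- The potential is moved onto the test function, the form in which the approximate equations
    -- converge.
    rw [← inner_potMul (hV.measurable t ht) (hM t ⟨ht, le_rfl⟩) hC (hR t ht), ← inner_add_left]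
    rw [hasDerivWithinAt_iff_isLittleO, Asymptotics.isLittleO_iff]
    intro ε hε
    obtain ⟨δ, hδ, n₀, h⟩ := hV.uniform_deriv hu hm hφ ht hε
    filter_upwards [inter_mem_nhdsWithin (Ici 0) (Metric.ball_mem_nhds t hδ)] with r hr
    refine le_of_tendsto (x := (hyperfilter ℕ : Filter ℕ))
      (((ha r _).sub (ha t _)).sub (((ha t _).const_mul _).const_smul _)).norm ?_
    filter_upwards [Nat.hyperfilter_le_atTop (eventually_ge_atTop n₀)] with n hn
    exact h n hn r hr

end Limit

/-! ### Stability of the mean field equation -/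

lemma Reg.of_tendsto {C : ℝ} {u : ℕ → L2 d} {x : L2 d} (h : ∀ n, Reg C (u n))
    (hx : Tendsto u atTop (𝓝 x)) : Reg C x := by
  refine ⟨le_of_tendsto' hx.norm fun n => (h n).norm_le, fun i t => ?_, fun i R hR => ?_⟩
  · exact le_of_tendsto' ((((transl (t • dirX i)).continuous.tendsto x).comp hx).sub hx).norm
      fun n => (h n).shift i t
  · exact le_of_tendsto' (((mulOp (clampV R i)).continuous.tendsto x).comp hx).norm
      fun n => (h n).moment i R hR

section Stability

variable {Γ : Space d → ℝ} {K C : ℝ}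

/-- The Lipschitz constant of the mean field nonlinearity. -/
def lipConst (d : ℕ) (K C : ℝ) : ℝ := 2 * K * (d + 1) * (d + 2) * C ^ 2

lemma GradBound.norm_potMul_meanField_le (hΓ : GradBound Γ K) {a b : L2 d} (hb : Reg C b)
    (ha : Reg C a) :
    ‖potMul (meanField Γ b) a‖ ≤ K * (d + 1) * C ^ 2 * ((d + 2) * C) := by
  have := hΓ.nonneg
  exact norm_potMul_le (hΓ.measurable_meanField b) (by positivity) (hΓ.abs_meanField_le hb) ha

/-- In Va - V'a' = V(a - a') + (V - V')a' the first term is energy neutral, and the second uses the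
moment of a' against the L² distance of b and b'. -/
lemma GradBound.im_inner_potMul_sub_le (hΓ : GradBound Γ K) {a a' b b' : L2 d} (ha : Reg C a)
    (ha' : Reg C a') (hb : Reg C b) (hb' : Reg C b') :
    (inner ℂ (a - a') (potMul (meanField Γ b) a - potMul (meanField Γ b') a')).im
      ≤ lipConst d K C * ‖a - a'‖ * ‖b - b'‖ := by
  have hK := hΓ.nonneg
  have hC := ha.nonneg
  have e : potMul (meanField Γ b) a - potMul (meanField Γ b') a'
      = potMul (meanField Γ b) (a - a')
        + (potMul (meanField Γ b) a' - potMul (meanField Γ b') a') := by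
    rw [potMul_sub_right (hΓ.measurable_meanField b) (hΓ.abs_meanField_le hb) ha ha']; abel
  rw [e, inner_add_right, Complex.add_im, inner_potMul_self (hΓ.measurable_meanField b)
    (hΓ.abs_meanField_le hb) (ha.sub ha'), zero_add]
  refine (le_abs_self _).trans ((Complex.abs_im_le_norm _).trans ((norm_inner_le_norm _ _).trans ?_))
  have h1 := norm_potMul_sub_le (hΓ.measurable_meanField b) (hΓ.abs_meanField_le hb)
    (hΓ.measurable_meanField b') (hΓ.abs_meanField_le hb') ha'
    (ε := 2 * K * (d + 1) * C * ‖b - b'‖) (by positivity) (hΓ.abs_meanField_sub_le hb hb')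
  refine (mul_le_mul_of_nonneg_left h1 (norm_nonneg _)).trans (le_of_eq ?_)
  rw [lipConst]; ring

variable {a a' b b' : ℝ → L2 d} {T t : ℝ}

lemma GradBound.weakSol_continuousOn (hΓ : GradBound Γ K)
    (h : WeakSol a fun t => potMul (meanField Γ (b t)) (a t))
    (ha : ∀ t ∈ Icc 0 T, Reg C (a t)) (hb : ∀ t ∈ Icc 0 T, Reg C (b t)) :
    ContinuousOn a (Icc 0 T) :=
  h.continuousOn (fun t ht => (ha t ht).norm_le)
    fun t ht => hΓ.norm_potMul_meanField_le (hb t ht) (ha t ht)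

/-- The map `b ↦ a`, `i ∂ₜ a = (∇_x·∇_ξ + V̂ * |b|²) a`, is a contraction in a weighted norm. -/
lemma GradBound.contraction (hΓ : GradBound Γ K)
    (h : WeakSol a fun t => potMul (meanField Γ (b t)) (a t))
    (h' : WeakSol a' fun t => potMul (meanField Γ (b' t)) (a' t)) (h0 : a 0 = a' 0)
    (ha : ∀ t ∈ Icc 0 T, Reg C (a t)) (ha' : ∀ t ∈ Icc 0 T, Reg C (a' t))
    (hb : ∀ t ∈ Icc 0 T, Reg C (b t)) (hb' : ∀ t ∈ Icc 0 T, Reg C (b' t)) {D : ℝ} (hD : 0 ≤ D)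
    (hbb : ∀ t ∈ Icc 0 T, ‖b t - b' t‖ ≤ D * Real.exp (2 * lipConst d K C * t))
    (ht : t ∈ Icc 0 T) : ‖a t - a' t‖ ≤ D / 2 * Real.exp (2 * lipConst d K C * t) := by
  have hK := hΓ.nonneg
  have hL : 0 ≤ lipConst d K C := by unfold lipConst; positivity
  set L := lipConst d K C with hLd
  have hexp : ∀ t : ℝ, Real.exp (4 * L * t) = Real.exp (2 * L * t) ^ 2 := fun t => by
    rw [← Real.exp_nat_mul]; congr 1; push_cast; ring
  -- The weight e^{2Lt} yields the factor 1/2: 2L w D E ≤ 2L w² + (L/2) D² E², and (κ - k) D²/4 = L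
  -- D²/2.
  have := (h.sub h').norm_sq_le (T := T) (k := 2 * L) (κ := 4 * L) (b := D ^ 2 / 4)
    ((hΓ.weakSol_continuousOn h ha hb).sub (hΓ.weakSol_continuousOn h' ha' hb'))
    (fun t ht => (norm_sub_le _ _).trans (add_le_add
      (hΓ.norm_potMul_meanField_le (hb t ht) (ha t ht))
      (hΓ.norm_potMul_meanField_le (hb' t ht) (ha' t ht)))) (by positivity) (fun t ht => ?_)
    (by rw [h0, sub_self, norm_zero, zero_pow two_ne_zero]; positivity) ht
  · refine le_of_sq_le_sq (this.trans_eq ?_) (by positivity)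
    rw [hexp]; ring
  · have h1 := hΓ.im_inner_potMul_sub_le (ha t ht) (ha' t ht) (hb t ht) (hb' t ht)
    rw [← hLd] at h1
    rw [hexp]
    set E := Real.exp (2 * L * t)
    set w := ‖a t - a' t‖ with hw
    have hw0 : 0 ≤ w := norm_nonneg _
    have h2 : L * w * ‖b t - b' t‖ ≤ L * w * (D * E) := by gcongr; exact hbb t ht
    have h3 : 2 * (L * w * (D * E)) ≤ 2 * L * w ^ 2 + (4 * L - 2 * L) * (D ^ 2 / 4 * E ^ 2) := by
      have := mul_nonneg hL (sq_nonneg (w - D * E / 2))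
      linear_combination 2 * this
    linarith

/-- `L²` stability of the mean field equation. -/
lemma GradBound.stability (hΓ : GradBound Γ K)
    (h : WeakSol a fun t => potMul (meanField Γ (a t)) (a t))
    (h' : WeakSol b fun t => potMul (meanField Γ (b t)) (b t))
    (ha : ∀ t ∈ Icc 0 T, Reg C (a t)) (hb : ∀ t ∈ Icc 0 T, Reg C (b t)) (ht : t ∈ Icc 0 T) :
    ‖a t - b t‖ ≤ ‖a 0 - b 0‖ * Real.exp (lipConst d K C * t) := by
  have hK := hΓ.nonneg
  have hL : 0 ≤ lipConst d K C := by unfold lipConst; positivity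
  set L := lipConst d K C with hLd
  have := (h.sub h').norm_sq_le (T := T) (k := 2 * L) (κ := 2 * L) (b := ‖a 0 - b 0‖ ^ 2)
    ((hΓ.weakSol_continuousOn h ha ha).sub (hΓ.weakSol_continuousOn h' hb hb))
    (fun t ht => (norm_sub_le _ _).trans (add_le_add
      (hΓ.norm_potMul_meanField_le (ha t ht) (ha t ht))
      (hΓ.norm_potMul_meanField_le (hb t ht) (hb t ht)))) (by positivity) (fun t ht => ?_)
    le_rfl ht
  · refine le_of_sq_le_sq (this.trans_eq ?_) (by positivity)
    rw [mul_pow, ← Real.exp_nat_mul]; congr 2; push_cast; ring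
  · have h1 := hΓ.im_inner_potMul_sub_le (ha t ht) (hb t ht) (ha t ht) (hb t ht)
    rw [← hLd] at h1
    rw [sub_self, zero_mul, add_zero]
    linear_combination 2 * h1

end Stability

/-! ### Global existence for the mean field equation -/

section Existence

variable {Γ : Space d → ℝ} {K C₀ : ℝ}

/-- The growth rate of the regularity of solutions. -/
def regRate (d : ℕ) (K C₀ : ℝ) : ℝ := 1 + K * C₀ ^ 2 * (d + 1) * (2 * d + 1)

/-- The bound for the regularity of solutions at time `t`. -/
def regBound (d : ℕ) (K C₀ t : ℝ) : ℝ := (2 * d + 1) * C₀ * Real.exp (regRate d K C₀ * t)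

lemma regBound_mono (hK : 0 ≤ K) (hC : 0 ≤ C₀) {s t : ℝ} (h : s ≤ t) :
    regBound d K C₀ s ≤ regBound d K C₀ t := by
  unfold regBound regRate
  gcongr

lemma regBound_nonneg (hC : 0 ≤ C₀) (t : ℝ) : 0 ≤ regBound d K C₀ t := by
  unfold regBound; positivity

/-- Curves obeying the a priori bounds. -/
structure AdmCurve (K C₀ : ℝ) (b : ℝ → L2 d) : Prop where
  continuousOn : ContinuousOn b (Ici 0)
  norm_le : ∀ t, 0 ≤ t → ‖b t‖ ≤ C₀
  reg : ∀ t, 0 ≤ t → Reg (regBound d K C₀ t) (b t)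

/-- The coefficient A depends on b only through its L² bound, while the exponential `regBound`
enters only the source, with rate equal to `regRate`. Solutions of the linear equation therefore
obey the same bounds as b. -/
lemma GradBound.admPot (hΓ : GradBound Γ K) (hC : 0 ≤ C₀) {b : ℝ → L2 d} (hb : AdmCurve K C₀ b) :
    AdmPot (fun t => meanField Γ (b t)) (K * C₀ ^ 2 * (d + 1))
      (K * (d + 1) * ((2 * d + 1) * C₀) * C₀) (regRate d K C₀) := by
  have hK := hΓ.nonneg
  refine ⟨fun t _ => hΓ.measurable_meanField _, fun T => ?_, fun t ht i s z => ?_,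
    fun t ht ε hε => ?_⟩
  · have h0 := regBound_nonneg (d := d) (K := K) hC T
    refine ⟨K * (d + 1) * regBound d K C₀ T ^ 2, by positivity, fun t ht z => ?_⟩
    exact hΓ.abs_meanField_le ((hb.reg t ht.1).mono (regBound_mono hK hC ht.2)) z
  · have h1 := hΓ.abs_meanField_shift_le (hb.reg t ht) (s • EuclideanSpace.single i 1) z
    rw [smul_dirX]
    refine h1.trans ?_
    rw [norm_smul, PiLp.norm_single, norm_one, mul_one, Real.norm_eq_abs]
    have h2 := hb.norm_le t ht
    have h3 : K * ‖b t‖ ^ 2 * ‖z.2‖ ≤ K * C₀ ^ 2 * (d + 1) * ‖z.2‖ := by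
      have : (0 : ℝ) ≤ d := d.cast_nonneg
      have h4 : K * ‖b t‖ ^ 2 ≤ K * C₀ ^ 2 := by gcongr
      refine mul_le_mul_of_nonneg_right ?_ (norm_nonneg _)
      nlinarith [mul_nonneg (mul_nonneg hK (sq_nonneg C₀)) this]
    have h4 : K * (d + 1) * regBound d K C₀ t * ‖b t‖
        ≤ K * (d + 1) * ((2 * d + 1) * C₀) * C₀ * Real.exp (regRate d K C₀ * t) := by
      have h0 := regBound_nonneg (d := d) (K := K) hC t
      calc _ ≤ K * (d + 1) * regBound d K C₀ t * C₀ := by gcongr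
        _ = _ := by rw [regBound]; ring
    gcongr
  · have h0 := regBound_nonneg (d := d) (K := K) hC (t + 1)
    set q := 2 * K * (d + 1) * regBound d K C₀ (t + 1) with hq
    have hq0 : 0 ≤ q := by positivity
    obtain ⟨δ, hδ, h⟩ := Metric.continuousOn_iff.1 hb.continuousOn t ht (ε / (q + 1)) (by positivity)
    refine ⟨min δ 1, by positivity, fun s hs hst z => ?_⟩
    rw [lt_min_iff] at hst
    have h1 := h s hs hst.1
    rw [dist_eq_norm] at h1
    have hs1 : s ≤ t + 1 := by linarith [(abs_lt.1 hst.2).2]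
    refine (hΓ.abs_meanField_sub_le ((hb.reg s hs).mono (regBound_mono hK hC hs1))
      ((hb.reg t ht).mono (regBound_mono hK hC (by linarith))) z).trans ?_
    rw [← hq]
    gcongr
    calc q * ‖b s - b t‖ ≤ q * (ε / (q + 1)) := by gcongr
      _ ≤ (q + 1) * (ε / (q + 1)) := by gcongr; linarith
      _ = ε := by field_simp

lemma AdmCurve.reg_Icc (hK : 0 ≤ K) (hC : 0 ≤ C₀) {b : ℝ → L2 d} (hb : AdmCurve K C₀ b) {T : ℝ} :
    ∀ t ∈ Icc 0 T, Reg (regBound d K C₀ T) (b t) := fun t ht =>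
  (hb.reg t ht.1).mono (regBound_mono hK hC ht.2)

lemma continuousOn_Ici_of_Icc {b : ℝ → L2 d} (h : ∀ T, ContinuousOn b (Icc 0 T)) :
    ContinuousOn b (Ici 0) := by
  intro t ht
  refine ((h (t + 1)) t ⟨ht, by linarith⟩).mono_of_mem_nhdsWithin ?_
  rw [← Ici_inter_Iic]
  exact inter_mem_nhdsWithin _ (Iic_mem_nhds (by linarith))

/-- The solution of the linear equation with a given mean field. -/
lemma GradBound.exists_linear (hΓ : GradBound Γ K) {a₀ : L2 d} (h0 : Reg C₀ a₀) {b : ℝ → L2 d}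
    (hb : AdmCurve K C₀ b) : ∃ a : ℝ → L2 d, a 0 = a₀ ∧ AdmCurve K C₀ a ∧
      (∀ t, 0 ≤ t → ‖a t‖ ≤ ‖a₀‖) ∧ WeakSol a fun t => potMul (meanField Γ (b t)) (a t) := by
  have hK := hΓ.nonneg
  have hC := h0.nonneg
  -- With Y = (2d + 1) C₀, the source condition β ‖a₀‖ ≤ A Y follows from ‖a₀‖ ≤ C₀.
  obtain ⟨a, ha0, ha, hw⟩ := (hΓ.admPot hC hb).exists_weakSol (by positivity) (by positivity) h0
    le_rfl (by
      calc _ ≤ K * (d + 1) * ((2 * d + 1) * C₀) * C₀ * C₀ := by gcongr; exact h0.norm_le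
        _ = _ := by ring) (by rw [regRate])
  refine ⟨a, ha0, ⟨?_, fun t ht => (ha t ht).1.trans h0.norm_le, fun t ht => (ha t ht).2⟩,
    fun t ht => (ha t ht).1, hw⟩
  refine continuousOn_Ici_of_Icc fun T => hΓ.weakSol_continuousOn hw (C := regBound d K C₀ T) ?_
    (hb.reg_Icc hK hC)
  exact fun t ht => (ha t ht.1).2.mono (regBound_mono hK hC ht.2)

/-- Global existence for the mean field equation. -/
theorem GradBound.exists_weakSol (hΓ : GradBound Γ K) {a₀ : L2 d} (h0 : Reg C₀ a₀) :
    ∃ a : ℝ → L2 d, a 0 = a₀ ∧ AdmCurve K C₀ a ∧ (∀ t, 0 ≤ t → ‖a t‖ ≤ ‖a₀‖) ∧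
      WeakSol a fun t => potMul (meanField Γ (a t)) (a t) := by
  have hK := hΓ.nonneg
  have hC := h0.nonneg
  have hconst : AdmCurve (d := d) K C₀ fun _ => a₀ := by
    refine ⟨continuousOn_const, fun _ _ => h0.norm_le, fun t ht => h0.mono ?_⟩
    have h1 : (1 : ℝ) ≤ 2 * d + 1 := by have : (0 : ℝ) ≤ d := d.cast_nonneg; linarith
    have h2 : 1 ≤ Real.exp (regRate d K C₀ * t) :=
      Real.one_le_exp (mul_nonneg (by unfold regRate; positivity) ht)
    unfold regBound
    calc C₀ = 1 * C₀ * 1 := by ring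
      _ ≤ _ := by gcongr
  choose F hF0 hF hFn hFw using fun b : {b : ℝ → L2 d // AdmCurve K C₀ b} =>
    hΓ.exists_linear h0 b.2
  let G : {b : ℝ → L2 d // AdmCurve K C₀ b} → {b : ℝ → L2 d // AdmCurve K C₀ b} :=
    fun b => ⟨F b, hF b⟩
  let s : ℕ → {b : ℝ → L2 d // AdmCurve K C₀ b} := fun n => G^[n] ⟨fun _ => a₀, hconst⟩
  have hs : ∀ n, (s (n + 1)).1 = F (s n) := fun n => by
    simp only [s, Function.iterate_succ_apply']; rfl
  -- The iterates do not depend on T; only the weight of the norm in which they contract does, so a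
  -- single limit serves all times.
  let Λ : ℝ → ℝ := fun T => 2 * lipConst d K (regBound d K C₀ T)
  have hΛ : ∀ T, 0 ≤ Λ T := fun T => by simp only [Λ, lipConst]; positivity
  have hG : ∀ (b c : {b : ℝ → L2 d // AdmCurve K C₀ b}) (T D : ℝ), 0 ≤ D →
      (∀ t ∈ Icc 0 T, ‖b.1 t - c.1 t‖ ≤ D * Real.exp (Λ T * t)) →
      ∀ t ∈ Icc 0 T, ‖F b t - F c t‖ ≤ D / 2 * Real.exp (Λ T * t) := fun b c T D hD h t ht =>
    hΓ.contraction (hFw b) (hFw c) (by rw [hF0, hF0]) ((hF b).reg_Icc hK hC)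
      ((hF c).reg_Icc hK hC) (b.2.reg_Icc hK hC) (c.2.reg_Icc hK hC) hD h ht
  have hstep : ∀ T n, ∀ t ∈ Icc 0 T, ‖(s n).1 t - (s (n + 1)).1 t‖
      ≤ 2 * C₀ * (1 / 2) ^ n * Real.exp (Λ T * t) := by
    intro T n
    induction n with
    | zero =>
      intro t ht
      have h1 : 1 ≤ Real.exp (Λ T * t) := Real.one_le_exp (mul_nonneg (hΛ T) ht.1)
      refine (norm_sub_le _ _).trans ?_
      have h2 := (s 0).2.norm_le t ht.1
      have h3 := (s 1).2.norm_le t ht.1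
      nlinarith
    | succ n ih =>
      intro t ht
      rw [hs, hs]
      refine (hG _ _ T _ (by positivity) ih t ht).trans_eq ?_
      rw [pow_succ]; ring
  have hdist : ∀ t, 0 ≤ t → ∀ n, dist ((s n).1 t) ((s (n + 1)).1 t)
      ≤ 2 * C₀ * Real.exp (Λ t * t) * (1 / 2) ^ n := fun t ht n => by
    rw [dist_eq_norm]
    exact (hstep t n t ⟨ht, le_rfl⟩).trans_eq (by ring)
  have hlim : ∀ t : ℝ, ∃ x : L2 d, 0 ≤ t → Tendsto (fun n => (s n).1 t) atTop (𝓝 x) := by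
    intro t
    by_cases ht : 0 ≤ t
    · obtain ⟨x, hx⟩ := cauchySeq_tendsto_of_complete
        (cauchySeq_of_le_geometric _ _ (by norm_num) (hdist t ht))
      exact ⟨x, fun _ => hx⟩
    · exact ⟨0, fun h => absurd h ht⟩
  choose b hb using hlim
  -- The geometric tail of 2 C₀ 2^{-k} from k = n sums to 4 C₀ 2^{-n}.
  have hbd : ∀ T n, ∀ t ∈ Icc 0 T, ‖b t - (s n).1 t‖
      ≤ 4 * C₀ * (1 / 2) ^ n * Real.exp (Λ T * t) := by
    intro T n t ht
    have := dist_le_of_le_geometric_of_tendsto (1 / 2) (2 * C₀ * Real.exp (Λ T * t)) (by norm_num)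
      (f := fun n => (s n).1 t) (fun n => by
        rw [dist_eq_norm]; exact (hstep T n t ht).trans_eq (by ring)) (hb t ht.1) n
    rw [dist_eq_norm, norm_sub_rev] at this
    refine this.trans_eq ?_
    ring
  have hgeom : Tendsto (fun n : ℕ => (1 / 2 : ℝ) ^ n) atTop (𝓝 0) :=
    tendsto_pow_atTop_nhds_zero_of_lt_one (by norm_num) (by norm_num)
  have hbA : AdmCurve K C₀ b := by
    refine ⟨continuousOn_Ici_of_Icc fun T => ?_,
      fun t ht => le_of_tendsto' (hb t ht).norm fun n => (s n).2.norm_le t ht,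
      fun t ht => Reg.of_tendsto (fun n => (s n).2.reg t ht) (hb t ht)⟩
    have h1 : TendstoUniformlyOn (fun n t => (s n).1 t) b atTop (Icc 0 T) := by
      rw [Metric.tendstoUniformlyOn_iff]
      intro ε hε
      have h2 : Tendsto (fun n : ℕ => 4 * C₀ * (1 / 2) ^ n * Real.exp (Λ T * T)) atTop (𝓝 0) := by
        simpa using (hgeom.const_mul (4 * C₀)).mul_const (Real.exp (Λ T * T))
      filter_upwards [h2.eventually_lt_const hε] with n hn t ht
      rw [dist_eq_norm]
      refine (hbd T n t ht).trans_lt (lt_of_le_of_lt ?_ hn)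
      have := hΛ T
      have := ht.2
      gcongr
    exact h1.continuousOn (.of_forall fun n =>
      (s n).2.continuousOn.mono Icc_subset_Ici_self)
  -- The fixed point identity is asserted only for t ≥ 0; values at negative times are not
  -- controlled.
  have hfix : ∀ t, 0 ≤ t → F ⟨b, hbA⟩ t = b t := by
    intro t ht
    refine tendsto_nhds_unique (f := fun n => (s (n + 1)).1 t) (l := atTop) ?_
      ((hb t ht).comp (tendsto_add_atTop_nat 1))
    rw [tendsto_iff_norm_sub_tendsto_zero]
    have h2 : Tendsto (fun n : ℕ => 4 * C₀ * (1 / 2) ^ n / 2 * Real.exp (Λ t * t)) atTop (𝓝 0) := by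
      simpa using ((hgeom.const_mul (4 * C₀)).div_const 2).mul_const (Real.exp (Λ t * t))
    refine squeeze_zero (fun _ => norm_nonneg _) (fun n => ?_) h2
    rw [norm_sub_rev, hs]
    exact hG ⟨b, hbA⟩ (s n) t _ (by positivity) (hbd t n) t ⟨ht, le_rfl⟩
  refine ⟨F ⟨b, hbA⟩, hF0 _, hF _, hFn _, fun φ hφ t ht => ?_⟩
  have := hFw ⟨b, hbA⟩ φ hφ t ht
  beta_reduce at this ⊢
  rw [hfix t ht] at this ⊢
  exact this

end Existence

/-! ### Global solutions are weak solutions -/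

section Equivalence

variable {Γ : Space d → ℝ} {K : ℝ} {a₀ : L2 d} {a b : ℝ → L2 d}

lemma integrable_mul_test (a : L2 d) {φ : Phase d → ℂ} (h : IsTest φ) :
    Integrable fun z => a z * φ z :=
  (Lp.memLp a).integrable_mul (h.memLp 2)

lemma GradBound.integral_equation (hΓ : GradBound Γ K) {C : ℝ} {a : L2 d} (ha : Reg C a)
    {φ : Phase d → ℂ} (h : IsTest φ) :
    ∫ z, a z * (kinetic φ z + (meanField Γ a z : ℂ) * φ z)
      = inner ℂ (testLp _ h.conj.kinetic) a
        + inner ℂ (testLp _ h.conj) (potMul (meanField Γ a) a) := by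
  have h1 := potMul_coe (hΓ.measurable_meanField a) (hΓ.abs_meanField_le ha) ha
  have e1 : ∫ z, a z * (kinetic φ z + (meanField Γ a z : ℂ) * φ z)
      = ∫ z, (a z * kinetic φ z + potMul (meanField Γ a) a z * φ z) := by
    refine integral_congr_ae ?_
    filter_upwards [h1] with z hz
    rw [hz]; ring
  rw [e1, integral_add (integrable_mul_test a h.kinetic) (integrable_mul_test _ h),
    integral_mul_test h.kinetic, integral_mul_test h,
    testLp_congr h.kinetic.conj h.conj.kinetic fun z => (kinetic_conj h z).symm]

lemma IsGlobalSolution.exists_reg (h : IsGlobalSolution Γ a₀ a) (T : ℝ) :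
    ∃ C, ∀ t ∈ Icc 0 T, Reg C (a t) := by
  obtain ⟨C, hC⟩ := h.locallyBounded T
  -- The added 1 makes the bound on the M¹ norm strict.
  refine ⟨C + 1, fun t ht => .of_m1Norm_lt ((hC t ht).trans_lt ?_)⟩
  rw [← ENNReal.ofReal_coe_nnreal]
  exact (ENNReal.ofReal_lt_ofReal_iff (by positivity)).2 (by linarith)

lemma IsGlobalSolution.weakSol (hΓ : GradBound Γ K) (h : IsGlobalSolution Γ a₀ a) :
    WeakSol a fun t => potMul (meanField Γ (a t)) (a t) := by
  intro φ hφ t ht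
  obtain ⟨C, hC⟩ := h.exists_reg t
  have h1 := h.equation _ hφ.conj t ht
  rw [hΓ.integral_equation (hC t ⟨ht, le_rfl⟩) hφ.conj] at h1
  have e : ∀ z, starRingEnd ℂ (starRingEnd ℂ (φ z)) = φ z := fun z => Complex.conj_conj _
  have e1 : testLp _ hφ.conj.conj = testLp φ hφ := testLp_congr _ _ e
  have e2 : testLp _ hφ.conj.conj.kinetic = testLp _ hφ.kinetic :=
    testLp_congr _ _ fun z => by simp only [e]
  simp only [integral_mul_test hφ.conj] at h1
  rw [e1, e2] at h1
  exact h1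

lemma AdmCurve.isGlobalSolution (hΓ : GradBound Γ K) {C₀ : ℝ} (hC : 0 ≤ C₀)
    (ha : AdmCurve K C₀ a) (h0 : a 0 = a₀)
    (h : WeakSol a fun t => potMul (meanField Γ (a t)) (a t)) : IsGlobalSolution Γ a₀ a := by
  refine ⟨ha.continuousOn, fun T => ?_, h0, fun φ hφ t ht => ?_⟩
  · refine ⟨((2 * d + 1) * regBound d K C₀ T).toNNReal, fun t ht => ?_⟩
    exact (ha.reg_Icc hΓ.nonneg hC t ht).m1Norm_le
  · rw [hΓ.integral_equation (ha.reg t ht) hφ]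
    simp only [integral_mul_test hφ]
    exact h _ hφ.conj t ht

/-- Global solutions are unique. -/
lemma IsGlobalSolution.eqOn (hΓ : GradBound Γ K) (h : IsGlobalSolution Γ a₀ a)
    (h' : IsGlobalSolution Γ a₀ b) : EqOn b a (Ici 0) := by
  intro t ht
  obtain ⟨C, hC⟩ := h.exists_reg t
  obtain ⟨C', hC'⟩ := h'.exists_reg t
  have := hΓ.stability (h'.weakSol hΓ) (h.weakSol hΓ)
    (fun s hs => (hC' s hs).mono (le_max_right C C'))
    (fun s hs => (hC s hs).mono (le_max_left C C')) ⟨ht, le_rfl⟩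
  rw [h.initial, h'.initial, sub_self, norm_zero, zero_mul] at this
  exact sub_eq_zero.1 (norm_le_zero_iff.1 this)

/-- The bounds for a global solution depend only on the regularity of its initial datum. -/
lemma IsGlobalSolution.bounds (hΓ : GradBound Γ K) (h : IsGlobalSolution Γ a₀ a) {C₀ : ℝ}
    (h0 : Reg C₀ a₀) {t : ℝ} (ht : 0 ≤ t) : ‖a t‖ ≤ ‖a₀‖ ∧ Reg (regBound d K C₀ t) (a t) := by
  -- By uniqueness the given solution is the constructed one, so it inherits bounds depending only
  -- on C₀ rather than on its own local M¹ bound.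
  obtain ⟨b, hb0, hb, hbn, hw⟩ := hΓ.exists_weakSol h0
  rw [(hb.isGlobalSolution hΓ h0.nonneg hb0 hw).eqOn hΓ h ht]
  exact ⟨hbn t ht, hb.reg t ht⟩

end Equivalence

end HamiltonHartree

end

/-! ### Well-posedness in M¹ -/

theorem theorem3p10 {d : ℕ} (hd : 1 ≤ d) (Γ : HamiltonHartree.Space d → ℝ)
    (hΓ : HamiltonHartree.IsPotential Γ) :
    -- existence and uniqueness of the global solution for every initial datum
    (∀ a₀ ∈ HamiltonHartree.M1 d, ∃ a : ℝ → HamiltonHartree.L2 d,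
      HamiltonHartree.IsGlobalSolution Γ a₀ a ∧
      ∀ b : ℝ → HamiltonHartree.L2 d, HamiltonHartree.IsGlobalSolution Γ a₀ b →
        Set.EqOn b a (Set.Ici 0)) ∧
    -- the solution map from `M¹` to `L^∞([0,T]; L²)` is locally Lipschitz
    (∀ T : ℝ, ∀ a₀ ∈ HamiltonHartree.M1 d, ∃ r : ℝ, 0 < r ∧ ∃ L : ℝ≥0,
      ∀ b₀ ∈ HamiltonHartree.M1 d, ∀ c₀ ∈ HamiltonHartree.M1 d,
        HamiltonHartree.m1Norm (b₀ - a₀) < ENNReal.ofReal r →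
        HamiltonHartree.m1Norm (c₀ - a₀) < ENNReal.ofReal r →
        ∀ b c : ℝ → HamiltonHartree.L2 d,
          HamiltonHartree.IsGlobalSolution Γ b₀ b → HamiltonHartree.IsGlobalSolution Γ c₀ c →
          ∀ t ∈ Set.Icc 0 T, ‖b t - c t‖ₑ ≤ L * HamiltonHartree.m1Norm (b₀ - c₀)) ∧
    -- solutions are in `L^∞([0,∞); L²)` and in `L^∞_loc([0,∞); M¹)`
    (∀ a₀ ∈ HamiltonHartree.M1 d, ∀ a : ℝ → HamiltonHartree.L2 d,
      HamiltonHartree.IsGlobalSolution Γ a₀ a →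
      (∃ C : ℝ, ∀ t : ℝ, 0 ≤ t → ‖a t‖ ≤ C) ∧
      (∀ t : ℝ, 0 ≤ t → a t ∈ HamiltonHartree.M1 d) ∧
      (∀ T : ℝ, ∃ C : ℝ≥0, ∀ t ∈ Set.Icc 0 T, HamiltonHartree.m1Norm (a t) ≤ C)) := by
  obtain ⟨K, hK0, hK1, hK2⟩ := hΓ.exists_bound
  have hK : HamiltonHartree.GradBound Γ K := ⟨hK0, hK1, hK2⟩
  refine ⟨fun a₀ ha₀ => ?_, fun T a₀ ha₀ => ?_, fun a₀ ha₀ a ha => ?_⟩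
  · obtain ⟨C₀, h0⟩ := HamiltonHartree.exists_reg_of_mem_M1 ha₀
    obtain ⟨a, ha0, ha, -, hw⟩ := hK.exists_weakSol h0
    have hs := ha.isGlobalSolution hK h0.nonneg ha0 hw
    exact ⟨a, hs, fun b hb => hs.eqOn hK hb⟩
  · obtain ⟨C₀, h0⟩ := HamiltonHartree.exists_reg_of_mem_M1 ha₀
    -- Radius one suffices: b₀ = (b₀ - a₀) + a₀ has regularity 1 + C₀, which gives one stability
    -- constant for the whole ball.
    have hball : ∀ b₀, HamiltonHartree.m1Norm (b₀ - a₀) < ENNReal.ofReal 1 →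
        HamiltonHartree.Reg (1 + C₀) b₀ := fun b₀ hb₀ => by
      simpa using (HamiltonHartree.Reg.of_m1Norm_lt hb₀).add h0
    have hC : 0 ≤ 1 + C₀ := by linarith [h0.nonneg]
    set C := HamiltonHartree.regBound d K (1 + C₀) T with hCd
    refine ⟨1, one_pos, (Real.exp (HamiltonHartree.lipConst d K C * T)).toNNReal,
      fun b₀ _ c₀ _ hb₀ hc₀ b c hb hc t ht => ?_⟩
    have hL : 0 ≤ HamiltonHartree.lipConst d K C := by
      unfold HamiltonHartree.lipConst; positivity
    have h1 := hK.stability (C := C) (hb.weakSol hK) (hc.weakSol hK)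
      (fun s hs => (hb.bounds hK (hball b₀ hb₀) hs.1).2.mono
        (HamiltonHartree.regBound_mono hK0 hC hs.2))
      (fun s hs => (hc.bounds hK (hball c₀ hc₀) hs.1).2.mono
        (HamiltonHartree.regBound_mono hK0 hC hs.2)) ht
    rw [hb.initial, hc.initial] at h1
    have h2 : ‖b t - c t‖ ≤ Real.exp (HamiltonHartree.lipConst d K C * T) * ‖b₀ - c₀‖ := by
      rw [mul_comm]
      refine h1.trans (mul_le_mul_of_nonneg_left ?_ (norm_nonneg _))
      exact Real.exp_le_exp.2 (mul_le_mul_of_nonneg_left ht.2 hL)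
    calc ‖b t - c t‖ₑ = ENNReal.ofReal ‖b t - c t‖ := (ofReal_norm _).symm
      _ ≤ ENNReal.ofReal (Real.exp (HamiltonHartree.lipConst d K C * T) * ‖b₀ - c₀‖) :=
        ENNReal.ofReal_le_ofReal h2
      _ = (Real.exp (HamiltonHartree.lipConst d K C * T)).toNNReal * ‖b₀ - c₀‖ₑ := by
        rw [ENNReal.ofReal_mul (Real.exp_pos _).le, ofReal_norm]; rfl
      _ ≤ _ := by gcongr; exact HamiltonHartree.enorm_le_m1Norm _
  · obtain ⟨C₀, h0⟩ := HamiltonHartree.exists_reg_of_mem_M1 ha₀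
    refine ⟨⟨‖a₀‖, fun t ht => (ha.bounds hK h0 ht).1⟩, fun t ht => ?_, ha.locallyBounded⟩
    obtain ⟨C, hC⟩ := ha.locallyBounded t
    exact HamiltonHartree.mem_M1_iff.2 ((hC t ⟨ht, le_rfl⟩).trans_lt ENNReal.coe_lt_top)
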